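/- Let $0<q<1$, $n\ge 0$ and $a_1,\dots,a_n\in\mathbf Z_{\ge 0}$. Notation: $(a;Q)_k=\prod_{l<k}(1-aQ^l)$, $(a;Q)_\infty=\lim_k (a;Q)_k$, $(a,b,\dots;Q)_\infty=(a;Q)_\infty(b;Q)_\infty\cdots$, $[m]_Q!=\prod_{j=1}^m\frac{Q^j-1}{Q-1}$, $e_Q(z)=\sum_k \frac{z^k}{(Q;Q)_k}$, $E_Q(z)=\sum_k\frac{Q^{k(k-1)/2}z^k}{(Q;Q)_k}$, and $h_l(z;q^2)=(q^2;q^2)_l\sum_{k=0}^{\lfloor l/2\rfloor}\frac{(-1)^kq^{2k(k-1)}z^{l-2k}}{(q^4;q^4)_k(q^2;q^2)_{l-2k}}$ (discrete $q^2$-Hermite I polynomials). For a multi-index $E$ put $|E|=\sum_j e_j$. Let $\hat V$ be the algebra of formal complex power series in $x_1,\dots,x_n$ with $x_ix_j=qx_jx_i$ for $i>j$, with basis monomials $x^E=x_1^{e_1}\cdots x_n^{e_n}$, and $V$ the algebra of formal complex power series in $\partial_1,\dots,\partial_n$ with $\partial_i\partial_j=q\partial_j\partial_i$ for $i<j$,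 with basis monomials $\partial_n^{e_n}\cdots\partial_1^{e_1}$ and braided antipode $S(\partial_n^{e_n}\cdots\partial_1^{e_1})=(-1)^{|E|}q^{|E|^2-|E|}\partial_n^{e_n}\cdots\partial_1^{e_1}$. For $f=\sum_E c_Ex^E\in\hat V$ let $f_{\cdot1}(z)=\sum_E c_Ez_1^{e_1}\cdots z_n^{e_n}$ in commuting variables; when this series converges absolutely near $0$ and continues analytically to $\mathbf R^n+iU$ for an open neighbourhood $U$ of $0$ in $\mathbf R^n$, $f_{\cdot 1}$ also denotes the continuation. For $s\in\mathbf Z_{\ge0}^n$ the formal integral $\int_{-q^{s_n}x_n\cdot\infty}^{q^{s_n}x_n\cdot\infty}\cdots\int_{-q^{s_1}x_1\cdot\infty}^{q^{s_1}x_1\cdot\infty}f$ is the iterated formal sum obtained from $$\int_{-q^sx_i\cdot\infty}^{q^sx_i\cdot\infty}f=(1-q^2)\sum_{k\in\mathbf Z}\sum_{\varepsilon=\pm1}q^{2k+s}x_i\,f(q^{-2}x_1,\dots,q^{-2}x_{i-1},\varepsilon q^{2k+s}x_i,x_{i+1},\dots,x_n).$$ It is realized at a point $\gamma\in(\mathbf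 R\setminus\{0\})^n$ by applying $g\mapsto g_{\cdot1}(\gamma)$ to each term and summing, and formal integrals are identified when all their realizations at points of $(\mathbf R\setminus\{0\})^n$ agree. Write $I$ for the case $s=0$, $\Pi_0f=2^{-n}\sum_{\varepsilon\in\{\pm1\}^n}f(\varepsilon_1x_1,\dots,\varepsilon_nx_n)$ and $I'=I\circ\Pi_0$. Call $f$ integrable if $f_{\cdot1}$ has a continuation as above and $\sum_{K\in\mathbf Z^n,\ \varepsilon\in\{\pm1\}^n}q^{2|K|}|z_1\cdots z_n|\,|f_{\cdot1}(\varepsilon_1q^{2k_1}z_1,\dots,\varepsilon_nq^{2k_n}z_n)|<\infty$ for all $z\in(\mathbf R\setminus\{0\})^n$; say that $f$ is of class $\mathcal R$ if $\Pi_0(f x^E)$ is integrable for every $E$. For $f$ of class $\mathcal R$ the braided Fourier transform is $$F_S(f)=\sum_E I'\bigl(f\,x^E\bigr)\otimes S\Bigl(\prod_{j=n}^{1}\frac{(c_j\partial_j)^{e_j}}{[e_j]_{q^2}!}\Bigr),\qquad c_j=\frac{iq^2}{1-q^2}\,q^{n-j},$$ the product being taken in decreasing order of $j$; $(\pi_\gamma\otimes\mathrm{id})F_S(f)\in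 V$ denotes the series obtained by realizing the first factor at $\gamma$. Let $M=e_{q^4}(-x_1^2)x_1^{a_1}\cdots e_{q^4}(-x_n^2)x_n^{a_n}$, let $g_{q^2}=e_{q^4}(-\sum_jx_j^2)$, let $B_j$ be the number of $i<j$ with $a_i$ odd, let $|A|=\sum_ja_j$, and put $$c_{q^2}(\gamma)=\frac{2(1-q^2)\,\gamma\,(q^4,-q^2\gamma^2,-q^2\gamma^{-2};q^4)_\infty}{(-\gamma^2,-q^4\gamma^{-2},q^2;q^4)_\infty}.$$ Then $M$ is of class $\mathcal R$, $g_{q^2}$ is integrable, and for every $\gamma\in(\mathbf R\setminus\{0\})^n$, with all products over noncommuting factors taken in increasing order, $$(\pi_\gamma\otimes\mathrm{id})F_S(M)=\prod_{j=1}^n\Bigl[c_{q^2}(q^{n-j+B_j}\gamma_j)\sum_{e\ge0,\ e+a_j\text{ even}}\frac{(-i)^eq^{e^2+e}}{(q^2;q^2)_e}q^{-(e+a_j)^2/2}(q^2;q^4)_{(e+a_j)/2}\,\partial_j^e\Bigr]$$ $$=(-i)^{|A|}\Bigl[\prod_{j=1}^nc_{q^2}(q^{n-j+B_j}\gamma_j)\Bigr]q^{\sum_ja_j(1-a_j)}\prod_{k=1}^n\bigl[E_{q^4}(-q^4\partial_k^2)h_{a_k}(\partial_k;q^2)\bigr].\tag{1}$$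 Moreover the shifted integral of $g_{q^2}$ below converges absolutely at every such $\gamma$, and $$F_S(M)=\Bigl[\int_{-q^{B_n}x_n\cdot\infty}^{q^{B_n}x_n\cdot\infty}\cdots\int_{-q^{B_1}x_1\cdot\infty}^{q^{B_1}x_1\cdot\infty}g_{q^2}\Bigr]\otimes(-i)^{|A|}q^{\sum_ja_j(1-a_j)}\prod_{k=1}^n\bigl[E_{q^4}(-q^4\partial_k^2)h_{a_k}(\partial_k;q^2)\bigr],\tag{2}$$ i.e. both sides have the same realization at every $\gamma\in(\mathbf R\setminus\{0\})^n$. -/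

import Mathlib

open scoped BigOperators

namespace BraidedFourier

/-! ### Formal power series in q-commuting variables -/

/-- Formal power series in `n` noncommuting variables `v_0, …, v_{n-1}` that commute up to powers
of `q`, written in a fixed normal form: a series is its family of coefficients with respect to the
normally ordered monomials `v^E`, and `w` records the reordering rule
`v^E * v^F = q ^ (∑ i, ∑ j, w i j * e_i * f_j) • v^(E + F)`. -/
def QSeries (n : ℕ) (_q : ℝ) (_w : Fin n → Fin n → ℕ) : Type := (Fin n →₀ ℕ) → ℂ

noncomputable section

namespace QSeries

variable {n : ℕ} {q : ℝ} {w : Fin n → Fin n → ℕ}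

instance : AddCommGroup (QSeries n q w) := inferInstanceAs (AddCommGroup ((Fin n →₀ ℕ) → ℂ))

instance : Module ℂ (QSeries n q w) := inferInstanceAs (Module ℂ ((Fin n →₀ ℕ) → ℂ))

/-- The series with given coefficients. -/
def mk (c : (Fin n →₀ ℕ) → ℂ) : QSeries n q w := c

/-- The coefficient of the normally ordered monomial `v^E`. -/
def coeff (E : Fin n →₀ ℕ) (f : QSeries n q w) : ℂ := f E

@[ext] theorem ext {f g : QSeries n q w} (h : ∀ E, coeff E f = coeff E g) : f = g := funext h

@[simp] theorem coeff_mk (c : (Fin n →₀ ℕ) → ℂ) (E : Fin n →₀ ℕ) :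
    coeff E (mk c : QSeries n q w) = c E := rfl

@[simp] theorem coeff_zero (E : Fin n →₀ ℕ) : coeff E (0 : QSeries n q w) = 0 := rfl

@[simp] theorem coeff_add (E : Fin n →₀ ℕ) (f g : QSeries n q w) :
    coeff E (f + g) = coeff E f + coeff E g := rfl

@[simp] theorem coeff_neg (E : Fin n →₀ ℕ) (f : QSeries n q w) :
    coeff E (-f) = -coeff E f := rfl

@[simp] theorem coeff_smul (E : Fin n →₀ ℕ) (c : ℂ) (f : QSeries n q w) :
    coeff E (c • f) = c * coeff E f := rfl

/-- The exponent `∑ i, ∑ j, w i j * e_i * f_j` of `q` in the reordering of `v^E * v^F`. -/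
def reorder (w : Fin n → Fin n → ℕ) (E F : Fin n →₀ ℕ) : ℕ := ∑ i, ∑ j, w i j * E i * F j

theorem reorder_add_left (E E' F : Fin n →₀ ℕ) :
    reorder w (E + E') F = reorder w E F + reorder w E' F := by
  simp [reorder, mul_add, add_mul, Finset.sum_add_distrib]

theorem reorder_add_right (E F F' : Fin n →₀ ℕ) :
    reorder w E (F + F') = reorder w E F + reorder w E F' := by
  simp [reorder, mul_add, Finset.sum_add_distrib]

@[simp] theorem reorder_zero_left (F : Fin n →₀ ℕ) : reorder w 0 F = 0 := by simp [reorder]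

@[simp] theorem reorder_zero_right (E : Fin n →₀ ℕ) : reorder w E 0 = 0 := by simp [reorder]

/-- The scalar multiple `c • v^E` of a normally ordered monomial. -/
def monomial (E : Fin n →₀ ℕ) (c : ℂ) : QSeries n q w := mk fun F => if F = E then c else 0

instance : One (QSeries n q w) := ⟨monomial 0 1⟩

instance : Mul (QSeries n q w) :=
  ⟨fun f g => mk fun E => ∑ p ∈ Finset.HasAntidiagonal.antidiagonal E,
    (q : ℂ) ^ reorder w p.1 p.2 * coeff p.1 f * coeff p.2 g⟩

theorem coeff_one (E : Fin n →₀ ℕ) : coeff E (1 : QSeries n q w) = if E = 0 then 1 else 0 := rfl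

theorem coeff_mul (E : Fin n →₀ ℕ) (f g : QSeries n q w) :
    coeff E (f * g) = ∑ p ∈ Finset.HasAntidiagonal.antidiagonal E,
      (q : ℂ) ^ reorder w p.1 p.2 * coeff p.1 f * coeff p.2 g := rfl

theorem coeff_monomial (E F : Fin n →₀ ℕ) (c : ℂ) :
    coeff F (monomial E c : QSeries n q w) = if F = E then c else 0 := rfl

/-- Normally ordered monomials multiply by adding exponents and collecting powers of `q`. -/
theorem monomial_mul_monomial (E F : Fin n →₀ ℕ) (a b : ℂ) :
    (monomial E a * monomial F b : QSeries n q w) =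
      monomial (E + F) ((q : ℂ) ^ reorder w E F * a * b) := by
  ext G
  rw [coeff_mul, coeff_monomial]
  simp only [coeff_monomial]
  split_ifs with h
  · subst h
    rw [Finset.sum_eq_single (E, F)]
    · simp
    · rintro ⟨A, B⟩ _ hne
      by_cases hA : A = E
      · by_cases hB : B = F
        · exact absurd (by rw [hA, hB]) hne
        · simp [hB]
      · simp [hA]
    · intro hn
      exact (hn (by simp)).elim
  · refine Finset.sum_eq_zero ?_
    rintro ⟨A, B⟩ hAB
    rw [Finset.HasAntidiagonal.mem_antidiagonal] at hAB
    by_cases hA : A = E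
    · by_cases hB : B = F
      · exact absurd (by rw [← hAB, hA, hB]) h
      · simp [hB]
    · simp [hA]

private theorem one_mul' (f : QSeries n q w) : 1 * f = f := by
  ext E
  rw [coeff_mul, Finset.sum_eq_single (0, E)]
  · simp [coeff_one]
  · rintro ⟨A, B⟩ hAB hne
    rw [Finset.HasAntidiagonal.mem_antidiagonal] at hAB
    by_cases hA : A = 0
    · exact absurd (by rw [← hAB, hA]; simp) hne
    · simp [coeff_one, hA]
  · simp

private theorem mul_one' (f : QSeries n q w) : f * 1 = f := by
  ext E
  rw [coeff_mul, Finset.sum_eq_single (E, 0)]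
  · simp [coeff_one]
  · rintro ⟨A, B⟩ hAB hne
    rw [Finset.HasAntidiagonal.mem_antidiagonal] at hAB
    by_cases hB : B = 0
    · exact absurd (by rw [← hAB, hB]; simp) hne
    · simp [coeff_one, hB]
  · simp

private theorem mul_assoc' (f g h : QSeries n q w) : f * g * h = f * (g * h) := by
  ext E
  simp only [coeff_mul, Finset.sum_mul, Finset.mul_sum, Finset.sum_sigma']
  apply Finset.sum_nbij' (fun ⟨⟨_i, j⟩, ⟨k, l⟩⟩ ↦ ⟨(k, l + j), (l, j)⟩)
    (fun ⟨⟨i, _j⟩, ⟨k, l⟩⟩ ↦ ⟨(i + k, l), (i, k)⟩)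
  · rintro ⟨⟨i, j⟩, ⟨k, l⟩⟩ hx
    simp only [Finset.mem_sigma, Finset.HasAntidiagonal.mem_antidiagonal] at hx ⊢
    exact ⟨by rw [← hx.1, ← hx.2, add_assoc], trivial⟩
  · rintro ⟨⟨i, j⟩, ⟨k, l⟩⟩ hx
    simp only [Finset.mem_sigma, Finset.HasAntidiagonal.mem_antidiagonal] at hx ⊢
    exact ⟨by rw [← hx.1, ← hx.2, add_assoc], trivial⟩
  · rintro ⟨⟨i, j⟩, ⟨k, l⟩⟩ hx
    simp only [Finset.mem_sigma, Finset.HasAntidiagonal.mem_antidiagonal] at hx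
    obtain ⟨_, rfl⟩ := hx
    rfl
  · rintro ⟨⟨i, j⟩, ⟨k, l⟩⟩ hx
    simp only [Finset.mem_sigma, Finset.HasAntidiagonal.mem_antidiagonal] at hx
    obtain ⟨_, rfl⟩ := hx
    rfl
  · rintro ⟨⟨i, j⟩, ⟨k, l⟩⟩ hx
    simp only [Finset.mem_sigma, Finset.HasAntidiagonal.mem_antidiagonal] at hx
    obtain ⟨_, rfl⟩ := hx
    simp only [reorder_add_left, reorder_add_right, pow_add]
    ring

instance : Ring (QSeries n q w) where
  mul_assoc := mul_assoc'
  one_mul := one_mul'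
  mul_one := mul_one'
  zero_mul f := by ext E; simp [coeff_mul]
  mul_zero f := by ext E; simp [coeff_mul]
  left_distrib f g h := by ext E; simp [coeff_mul, mul_add, Finset.sum_add_distrib]
  right_distrib f g h := by ext E; simp [coeff_mul, mul_add, add_mul, Finset.sum_add_distrib]
  neg_add_cancel := neg_add_cancel
  zsmul := (· • ·)
  zsmul_zero' := SubNegMonoid.zsmul_zero'
  zsmul_succ' := SubNegMonoid.zsmul_succ'
  zsmul_neg' := SubNegMonoid.zsmul_neg'

instance : Algebra ℂ (QSeries n q w) :=
  Algebra.ofModule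
    (fun r f g => by
      ext E; simp only [coeff_mul, coeff_smul, Finset.mul_sum]
      exact Finset.sum_congr rfl fun _ _ => by ring)
    (fun r f g => by
      ext E; simp only [coeff_mul, coeff_smul, Finset.mul_sum]
      exact Finset.sum_congr rfl fun _ _ => by ring)

/-- The `j`-th variable. -/
def X (j : Fin n) : QSeries n q w := monomial (Finsupp.single j 1) 1

theorem X_mul_X (i j : Fin n) :
    (X i * X j : QSeries n q w) =
      monomial (Finsupp.single i 1 + Finsupp.single j 1) ((q : ℂ) ^ w i j) := by
  rw [X, X, monomial_mul_monomial]
  congr 1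
  simp [reorder, Finsupp.single_apply]

/-- The rescaled series `f(c_0 v_0, …, c_{n-1} v_{n-1})`. -/
def rescale (c : Fin n → ℂ) (f : QSeries n q w) : QSeries n q w :=
  mk fun E => (∏ j, c j ^ E j) * coeff E f

/-- `φ(u) = ∑ k, φ_k u^k` for a one-variable power series `φ` and a series `u` without constant
term.  For such `u` the power `u^k` has no monomials of total degree less than `k`, so each
coefficient of `φ(u)` is a finite sum. -/
def subst (φ : PowerSeries ℂ) (u : QSeries n q w) : QSeries n q w :=
  mk fun E => ∑ k ∈ Finset.range ((∑ j, E j) + 1), PowerSeries.coeff k φ * coeff E (u ^ k)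

end QSeries

open QSeries

/-- The braided covector algebra: power series in `x_1, …, x_n` with `x_i x_j = q x_j x_i` for `i > j`, in the
basis of increasingly ordered monomials `x_1^{e_1} ⋯ x_n^{e_n}`. -/
abbrev Covec (n : ℕ) (q : ℝ) : Type := QSeries n q fun i j => if j < i then 1 else 0

/-- The braided vector algebra: power series in `∂_1, …, ∂_n` with `∂_i ∂_j = q ∂_j ∂_i` for `i < j`, in the
basis of decreasingly ordered monomials `∂_n^{e_n} ⋯ ∂_1^{e_1}`. -/
abbrev Vec (n : ℕ) (q : ℝ) : Type := QSeries n q fun i j => if i < j then 1 else 0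

theorem covec_relation {n : ℕ} {q : ℝ} {i j : Fin n} (h : j < i) :
    (X i * X j : Covec n q) = (q : ℂ) • (X j * X i) := by
  rw [X_mul_X, X_mul_X]
  ext E
  rw [coeff_smul, coeff_monomial, coeff_monomial, add_comm (Finsupp.single j 1)]
  simp [h, h.not_gt]

theorem vec_relation {n : ℕ} {q : ℝ} {i j : Fin n} (h : i < j) :
    (X i * X j : Vec n q) = (q : ℂ) • (X j * X i) := by
  rw [X_mul_X, X_mul_X]
  ext E
  rw [coeff_smul, coeff_monomial, coeff_monomial, add_comm (Finsupp.single j 1)]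
  simp [h, h.not_gt]

/-! ### q-special functions -/

/-- The `q`-shifted factorial `(a; Q)_k`. -/
def qPoch (a Q : ℝ) (k : ℕ) : ℝ := ∏ l ∈ Finset.range k, (1 - a * Q ^ l)

/-- The infinite `q`-shifted factorial `(a; Q)_∞`. -/
def qPochInf (a Q : ℝ) : ℝ := ∏' l : ℕ, (1 - a * Q ^ l)

/-- `[m]_Q ! = ∏_{j=1}^m (Q^j - 1) / (Q - 1)`. -/
def qFact (Q : ℝ) (m : ℕ) : ℝ := ∏ j ∈ Finset.range m, (Q ^ (j + 1) - 1) / (Q - 1)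

/-- `e_Q(z) = ∑ z^k / (Q; Q)_k`. -/
def eSeries (Q : ℝ) : PowerSeries ℂ := PowerSeries.mk fun k => ((1 / qPoch Q Q k : ℝ) : ℂ)

/-- `E_Q(z) = ∑ Q^{k(k-1)/2} z^k / (Q; Q)_k`. -/
def ESeries (Q : ℝ) : PowerSeries ℂ :=
  PowerSeries.mk fun k => ((Q ^ (k * (k - 1) / 2) / qPoch Q Q k : ℝ) : ℂ)

/-- The discrete `q`-Hermite I polynomial `h_l(u; q)` evaluated at an element of a `ℂ`-algebra:
`(q; q)_l ∑_{k ≤ l/2} (-1)^k q^{k(k-1)} u^{l-2k} / ((q²; q²)_k (q; q)_{l-2k})`. -/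
def hermiteI {A : Type*} [Ring A] [Algebra ℂ A] (q : ℝ) (l : ℕ) (u : A) : A :=
  ∑ k ∈ Finset.range (l / 2 + 1),
    ((qPoch q q l * ((-1) ^ k * q ^ (k * (k - 1)) /
      (qPoch (q ^ 2) (q ^ 2) k * qPoch q q (l - 2 * k))) : ℝ) : ℂ) • u ^ (l - 2 * k)

/-- `c_q(γ) = 2 (1-q) γ (q², -qγ², -qγ⁻²; q²)_∞ / (-γ², -q²γ⁻², q; q²)_∞`, to be used at `q²`. -/
def cConst (q γ : ℝ) : ℝ :=
  2 * (1 - q) * γ *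
    (qPochInf (q ^ 2) (q ^ 2) * qPochInf (-q * γ ^ 2) (q ^ 2) * qPochInf (-q / γ ^ 2) (q ^ 2)) /
    (qPochInf (-γ ^ 2) (q ^ 2) * qPochInf (-q ^ 2 / γ ^ 2) (q ^ 2) * qPochInf q (q ^ 2))

/-! ### Realization and integration on `Covec` -/

section Integral

variable {n : ℕ} {q : ℝ}

/-- `F` is an analytic continuation of `f_{·1} = f ▷ 1`, the power series in commuting variables
`z_1, …, z_n` whose coefficients are those of `f` in normal form: this power series converges
absolutely to `F` near `0`, and `F` is analytic on `ℝⁿ + iU` for an open neighbourhood `U` of `0`.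
Such an `F` is unique on `ℝⁿ`. -/
def IsContinuation (f : Covec n q) (F : (Fin n → ℂ) → ℂ) : Prop :=
  (∃ r : ℝ, 0 < r ∧ ∀ z : Fin n → ℂ, (∀ j, ‖z j‖ < r) →
    HasSum (fun E : Fin n →₀ ℕ => coeff E f * ∏ j, z j ^ E j) (F z)) ∧
  ∃ U : Set (Fin n → ℝ), IsOpen U ∧ 0 ∈ U ∧
    AnalyticOnNhd ℂ F {z | (fun j => (z j).im) ∈ U}

open Classical in
/-- The value at `z ∈ ℝⁿ` of (the analytic continuation of) `f_{·1}`. -/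
def value (f : Covec n q) (z : Fin n → ℝ) : ℂ :=
  if h : ∃ F, IsContinuation f F then h.choose fun j => (z j : ℂ) else 0

/-- One term of the formal integral `∫_{-q^s x_i·∞}^{q^s x_i·∞} f`, which is the formal sum over
`k ∈ ℤ` and `ε = ±1` of
`(1-q²) q^{2k+s} x_i f(q⁻² x_1, …, q⁻² x_{i-1}, ε q^{2k+s} x_i, x_{i+1}, …, x_n)`. -/
def integralStep (i : Fin n) (s : ℕ) (k : ℤ) (ε : ℤˣ) (f : Covec n q) : Covec n q :=
  (((1 - q ^ 2) * q ^ (2 * k + s) : ℝ) : ℂ) •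
    (X i * rescale (fun j => if j < i then (((q ^ 2)⁻¹ : ℝ) : ℂ)
      else if j = i then ((((ε : ℤ) : ℝ) * q ^ (2 * k + s) : ℝ) : ℂ) else 1) f)

/-- One term, indexed by `K ∈ ℤⁿ` and `ε ∈ {±1}ⁿ`, of the iterated formal integral
`∫_{-q^{s_n} x_n·∞}^{q^{s_n} x_n·∞} ⋯ ∫_{-q^{s_1} x_1·∞}^{q^{s_1} x_1·∞} f`
(the integral over `x_1` is the innermost one). -/
def integralTerm (s : Fin n → ℕ) (p : (Fin n → ℤ) × (Fin n → ℤˣ)) (f : Covec n q) : Covec n q :=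
  (List.finRange n).foldl (fun g i => integralStep i (s i) (p.1 i) (p.2 i) g) f

/-- The formal integral `∫_{-q^{s_n} x_n·∞}^{q^{s_n} x_n·∞} ⋯ ∫_{-q^{s_1} x_1·∞}^{q^{s_1} x_1·∞} f`
applied to `1` and evaluated at `z = γ`. -/
def shiftedIntegral (s : Fin n → ℕ) (f : Covec n q) (γ : Fin n → ℝ) : ℂ :=
  ∑' p : (Fin n → ℤ) × (Fin n → ℤˣ), value (integralTerm s p f) γ

/-- `(I · f)_{·1}` evaluated at `z = γ`. -/
def integral (f : Covec n q) (γ : Fin n → ℝ) : ℂ := shiftedIntegral 0 f γ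

/-- Integrable series: `f_{·1}` continues analytically to `ℝⁿ + iU`, and it is absolutely
`q²`-integrable at every `z ∈ ℝⁿ` off the coordinate hyperplanes. -/
def IsIntegrable (f : Covec n q) : Prop :=
  (∃ F, IsContinuation f F) ∧
  ∀ z : Fin n → ℝ, (∀ j, z j ≠ 0) →
    Summable fun p : (Fin n → ℤ) × (Fin n → ℤˣ) =>
      q ^ (2 * ∑ j, p.1 j) * (∏ j, |z j|) *
        ‖value f fun j => ((p.2 j : ℤ) : ℝ) * q ^ (2 * p.1 j) * z j‖

/-- `Π_0 f = 2⁻ⁿ ∑_{ε ∈ {±1}ⁿ} f(ε_1 x_1, …, ε_n x_n)`, the part of `f` even in every variable. -/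
def evenPart (f : Covec n q) : Covec n q :=
  ((2 : ℂ) ^ n)⁻¹ • ∑ ε : Fin n → ℤˣ, rescale (fun j => (((ε j : ℤˣ) : ℤ) : ℂ)) f

/-- The class `R`: every `f x_1^{e_1} ⋯ x_n^{e_n}` is integrable for `I' = I ∘ Π_0`. -/
def IsClassR (f : Covec n q) : Prop :=
  ∀ E : Fin n →₀ ℕ, IsIntegrable (evenPart (f * monomial E 1))

/-! ### The braided Fourier transform -/

/-- The exponential
`exp(x | (c_1 ∂_1, …, c_n ∂_n)) = ∑_E x^E ⊗ ((c_n ∂_n)^{e_n} / [e_n]_{q²}!) ⋯ ((c_1 ∂_1)^{e_1} / [e_1]_{q²}!)`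
in the completed tensor product `Covec ⊗ Vec`, whose elements are given by the coefficients in
`Covec` of the basis monomials `∂_n^{e_n} ⋯ ∂_1^{e_1}`. -/
def expElement (c : Fin n → ℂ) (E : Fin n →₀ ℕ) : Covec n q :=
  monomial E (∏ j, c j ^ E j / ((qFact (q ^ 2) (E j) : ℝ) : ℂ))

/-- The braided antipode of `Vec`:
`S(∂_n^{e_n} ⋯ ∂_1^{e_1}) = (-1)^{|E|} q^{|E|² - |E|} ∂_n^{e_n} ⋯ ∂_1^{e_1}`. -/
def antipode (g : Vec n q) : Vec n q :=
  QSeries.mk fun E =>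
    (-1) ^ (∑ j, E j) * (q : ℂ) ^ ((∑ j, E j) * ((∑ j, E j) - 1)) * coeff E g

/-- The braided Fourier transform
`F_S = (I' ⊗ S) (m ⊗ id) (id ⊗ exp(x | (i q² / (1-q²)) (q^{n-1} ∂_1, …, q^{n-j} ∂_j, …, ∂_n)))`,
its first tensor factor (a formal integral) being realized at the point `γ`. -/
def fourierS (f : Covec n q) (γ : Fin n → ℝ) : Vec n q :=
  antipode (QSeries.mk fun E => integral (evenPart (f * expElement
    (fun j => Complex.I * (q : ℂ) ^ 2 / (1 - (q : ℂ) ^ 2) * (q : ℂ) ^ (n - 1 - (j : ℕ))) E)) γ)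

end Integral

/-- The `q²`-Gaussian `g_{q²}(x) = e_{q⁴}(-(x_1² + ⋯ + x_n²))`. -/
def gaussian (n : ℕ) (q : ℝ) : Covec n q := subst (eSeries (q ^ 4)) (-∑ j, X j ^ 2)

/-- `M(x, A) = e_{q⁴}(-x_1²) x_1^{a_1} ⋯ e_{q⁴}(-x_n²) x_n^{a_n}`. -/
def gaussianMonomial {n : ℕ} (q : ℝ) (a : Fin n → ℕ) : Covec n q :=
  (List.ofFn fun j => subst (eSeries (q ^ 4)) (-X j ^ 2) * X j ^ a j).prod

/-- `B_j = #{i < j : a_i odd}`. -/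
def parityShift {n : ℕ} (a : Fin n → ℕ) (j : Fin n) : ℕ := ∑ i ∈ Finset.Iio j, a i % 2

/-- `(-i)^{|A|} q^{∑ a_j (1 - a_j)} ∏_k [E_{q⁴}(-q⁴ ∂_k²) h_{a_k}(∂_k; q²)]`, the product being
taken in increasing order. -/
def hermiteGaussian {n : ℕ} (q : ℝ) (a : Fin n → ℕ) : Vec n q :=
  ((-Complex.I) ^ (∑ j, a j) * (q : ℂ) ^ (∑ j, (a j : ℤ) * (1 - (a j : ℤ)))) •
    (List.ofFn fun k =>
      subst (ESeries (q ^ 4)) (-((q : ℂ) ^ 4 • (X k : Vec n q) ^ 2)) *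
        hermiteI (q ^ 2) (a k) (X k : Vec n q)).prod

/-- The series
`∑_{e + a even} ((-i)^e q^{e²+e} / (q²; q²)_e) q^{-(e+a)²/2} (q²; q⁴)_{(e+a)/2} t^e`. -/
def transformSeries (q : ℝ) (a : ℕ) : PowerSeries ℂ :=
  PowerSeries.mk fun e =>
    if Even (e + a) then
      (-Complex.I) ^ e * ((q ^ (e ^ 2 + e) / qPoch (q ^ 2) (q ^ 2) e *
        (q ^ ((e + a) ^ 2 / 2))⁻¹ * qPoch (q ^ 2) (q ^ 4) ((e + a) / 2) : ℝ) : ℂ)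
    else 0

end

end BraidedFourier

namespace BraidedFourier

open Filter Topology

/-! ### Euler's two `q`-exponential sums -/

section Euler

variable {Q : ℝ}

/-! Everything reduces to sums in one variable. Normal ordering of M x^E produces a power of q, the
monomial z^(A+E), and a dilation of the j-th Gaussian factor by q^(S_j), where S_j = ∑_{i<j} e_i
(`isContinuation_gaussianMonomial_mul`). Each later step of the iterated integral multiplies an
earlier variable by q⁻², and moving the prefactor x_i into place gives back one q. Hence every term
of the integral factors over j, with the j-th variable evaluated at ±q^(2k) y_j, where y_j is γ_j
times a fixed power of q (`IsContinuation.value_integralTerm`). The even projection keeps M x^E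
whole when every a_j + e_j = 2m_j is even and kills it otherwise (`evenPart_gaussianMonomial_mul`).

The one-variable integral of x^(2m)/(-x²; q⁴)_∞ is, up to elementary factors, ∑_k z^k/(-cQ^k; Q)_∞
with Q = q⁴, c = y², z = q^(4m+2). This is the case b = 0 of Ramanujan's ₁ψ₁ sum
(`bilateralSum_eq`). For m = 0 it yields c_{q²}(y), and the contiguity relation `bilateralSum_mul`
adds the factor q^(-2m²) (q²; q⁴)_m (`tsum_gaussTerm`). Ramanujan's sum itself is obtained by
multiplying with (z; Q)_∞: the Laurent coefficients satisfy the recursion of a theta series, their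
normalization is read off at -∞, and a telescoping sum of all of them supplies Jacobi's triple
product.

Being a sum over the lattice y q^(2ℤ), c_{q²}(y) does not change when y is multiplied by q². As e_i
and a_i have equal parity, S_j can be replaced by B_j, so the constants no longer depend on E. This
is what lets the transform factor. The powers of q coming from the antipode, the c_j, the reordering
and the dilations add up to ∑ (e_j² + e_j) + ∑_{i<j} e_i e_j, besides the exponents -2m_j² of the
one-variable integrals; the cross term is exactly the price of rewriting an increasing product of
∂'s in the decreasing basis (`coeff_fourierS`).

For the closed form, the explicit coefficients and E_{q⁴}(-q⁴t²) h_a(t; q²) satisfy the same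
three-term recurrence in a (`hermiteGaussSeries_eq`, `transformSeries_eq`). For the shifted
integral, a q-multinomial theorem identifies the coefficients of the Gaussian with those of an
ordered product (`coeff_gaussian`), so its integral with shifts B_j is the product of the same
constants (`shiftedIntegral_gaussian`). -/

theorem qPoch_succ (a Q : ℝ) (k : ℕ) : qPoch a Q (k + 1) = qPoch a Q k * (1 - a * Q ^ k) :=
  Finset.prod_range_succ _ _

@[simp] theorem qPoch_zero (a Q : ℝ) : qPoch a Q 0 = 1 := Finset.prod_range_zero _

theorem qPoch_self_succ (Q : ℝ) (k : ℕ) : qPoch Q Q (k + 1) = qPoch Q Q k * (1 - Q ^ (k + 1)) := by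
  rw [qPoch_succ, pow_succ']

theorem qPoch_self_pos (h0 : 0 < Q) (h1 : Q < 1) (k : ℕ) : 0 < qPoch Q Q k := by
  induction k with
  | zero => simp
  | succ k ih =>
    rw [qPoch_self_succ]
    exact mul_pos ih (sub_pos.2 (pow_lt_one₀ h0.le h1 (by simp)))

/-- The coefficients of `(z; Q)_∞` as a power series in `z`. -/
noncomputable def eulerCoeff (Q : ℝ) (j : ℕ) : ℝ := (-1) ^ j * Q ^ (j * (j - 1) / 2) / qPoch Q Q j

theorem eulerCoeff_zero (Q : ℝ) : eulerCoeff Q 0 = 1 := by simp [eulerCoeff]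

theorem triangle_succ (j : ℕ) : (j + 1) * (j + 1 - 1) / 2 = j * (j - 1) / 2 + j := by
  rw [← Nat.choose_two_right, ← Nat.choose_two_right, Nat.choose_succ_succ' j 1, Nat.choose_one_right,
    add_comm]

theorem eulerCoeff_succ (h0 : 0 < Q) (h1 : Q < 1) (j : ℕ) :
    (1 - Q ^ (j + 1)) * eulerCoeff Q (j + 1) = -Q ^ j * eulerCoeff Q j := by
  have hj := (qPoch_self_pos h0 h1 j).ne'
  have h : 1 - Q ^ (j + 1) ≠ 0 := (sub_pos.2 (pow_lt_one₀ h0.le h1 (by simp))).ne'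
  rw [eulerCoeff, eulerCoeff, qPoch_self_succ, triangle_succ, pow_add Q (_ / _), pow_succ (-1 : ℝ),
    mul_div_assoc', div_eq_iff (mul_ne_zero hj h)]
  field_simp

/-- Consecutive coefficients have ratio at most Q^j/(1-Q), which tends to 0. This is the majorant
behind the continuity and differentiability of `eulerE`. -/
theorem summable_eulerCoeff (h0 : 0 < Q) (h1 : Q < 1) (R : ℝ) :
    Summable fun j => |eulerCoeff Q j| * R ^ j := by
  refine summable_of_ratio_norm_eventually_le (r := 1 / 2) (by norm_num) ?_
  have hlim : Tendsto (fun j : ℕ => Q ^ j * (|R| / (1 - Q))) atTop (𝓝 (0 * (|R| / (1 - Q)))) :=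
    (tendsto_pow_atTop_nhds_zero_of_lt_one h0.le h1).mul_const _
  rw [zero_mul] at hlim
  filter_upwards [hlim.eventually (gt_mem_nhds (show (0 : ℝ) < 1 / 2 by norm_num))] with j hj
  have hQ : 0 < 1 - Q := sub_pos.2 h1
  have h : 1 - Q ≤ 1 - Q ^ (j + 1) := by
    have := pow_le_of_le_one h0.le h1.le j.add_one_ne_zero
    linarith
  have hrec := congrArg abs (eulerCoeff_succ h0 h1 j)
  rw [abs_mul, abs_mul, abs_of_pos (hQ.trans_le h), abs_neg, abs_of_pos (pow_pos h0 j)] at hrec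
  simp only [norm_mul, norm_pow, Real.norm_eq_abs, abs_abs]
  rw [pow_succ |R|]
  have h2 : |eulerCoeff Q (j + 1)| ≤ Q ^ j / (1 - Q) * |eulerCoeff Q j| := by
    rw [div_mul_eq_mul_div, le_div_iff₀ hQ, ← hrec, mul_comm]
    exact mul_le_mul_of_nonneg_right h (abs_nonneg _)
  calc |eulerCoeff Q (j + 1)| * (|R| ^ j * |R|)
      ≤ Q ^ j / (1 - Q) * |eulerCoeff Q j| * (|R| ^ j * |R|) :=
        mul_le_mul_of_nonneg_right h2 (by positivity)
    _ = Q ^ j * (|R| / (1 - Q)) * (|eulerCoeff Q j| * |R| ^ j) := by ring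
    _ ≤ 1 / 2 * (|eulerCoeff Q j| * |R| ^ j) :=
        mul_le_mul_of_nonneg_right hj.le (by positivity)

variable {𝕜 : Type*} [RCLike 𝕜]

/-- `(z; Q)_∞` as the sum of its power series. -/
noncomputable def eulerE (Q : ℝ) (z : 𝕜) : 𝕜 := ∑' j, eulerCoeff Q j • z ^ j

theorem norm_eulerCoeff_smul_le {R : ℝ} {z : 𝕜} (hz : ‖z‖ ≤ R) (j : ℕ) :
    ‖eulerCoeff Q j • z ^ j‖ ≤ |eulerCoeff Q j| * R ^ j := by
  rw [norm_smul, norm_pow, Real.norm_eq_abs]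
  gcongr

theorem summable_eulerE (h0 : 0 < Q) (h1 : Q < 1) (z : 𝕜) :
    Summable fun j => eulerCoeff Q j • z ^ j :=
  .of_norm_bounded (summable_eulerCoeff h0 h1 ‖z‖) (norm_eulerCoeff_smul_le le_rfl)

theorem eulerE_zero (Q : ℝ) : eulerE Q (0 : 𝕜) = 1 := by
  rw [eulerE, tsum_eq_single 0 fun j hj => by simp [hj]]
  simp [eulerCoeff_zero]

theorem continuous_eulerE (h0 : 0 < Q) (h1 : Q < 1) : Continuous (eulerE Q : 𝕜 → 𝕜) := by
  rw [continuous_iff_continuousAt]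
  intro z
  have h : ContinuousOn (eulerE Q : 𝕜 → 𝕜) (Metric.ball 0 (‖z‖ + 1)) :=
    continuousOn_tsum (fun j => by fun_prop) (summable_eulerCoeff h0 h1 (‖z‖ + 1))
      fun j x hx => norm_eulerCoeff_smul_le (mem_ball_zero_iff.1 hx).le j
  exact h.continuousAt (Metric.isOpen_ball.mem_nhds (by simp))

theorem differentiable_eulerE (h0 : 0 < Q) (h1 : Q < 1) : Differentiable ℂ (eulerE Q : ℂ → ℂ) := by
  intro z
  have h : DifferentiableOn ℂ (eulerE Q : ℂ → ℂ) (Metric.ball 0 (‖z‖ + 1)) :=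
    Complex.differentiableOn_tsum_of_summable_norm (summable_eulerCoeff h0 h1 (‖z‖ + 1))
      (fun j => by fun_prop) Metric.isOpen_ball
      fun j x hx => norm_eulerCoeff_smul_le (mem_ball_zero_iff.1 hx).le j
  exact h.differentiableAt (Metric.isOpen_ball.mem_nhds (by simp))

/-- Coefficientwise this is `eulerCoeff_succ`. Iterated, it peels the factors of the infinite
product off the power series. -/
theorem eulerE_eq (h0 : 0 < Q) (h1 : Q < 1) (z : 𝕜) :
    eulerE Q z = (1 - z) * eulerE Q ((Q : 𝕜) * z) := by
  have hs := summable_eulerE h0 h1 z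
  have hs' := summable_eulerE h0 h1 ((Q : 𝕜) * z)
  have h : eulerE Q z - eulerE Q ((Q : 𝕜) * z) = -(z * eulerE Q ((Q : 𝕜) * z)) := by
    rw [eulerE, eulerE, ← hs.tsum_sub hs', (hs.sub hs').tsum_eq_zero_add, ← tsum_mul_left, ← tsum_neg]
    simp only [pow_zero, sub_self, zero_add]
    refine tsum_congr fun j => ?_
    have hrec := congrArg (fun x : ℝ => (x : 𝕜)) (eulerCoeff_succ h0 h1 j)
    simp only [RCLike.real_smul_eq_coe_mul]
    push_cast at hrec
    rw [mul_pow, mul_pow]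
    linear_combination z ^ (j + 1) * hrec
  linear_combination h

theorem eulerE_eq_prod (h0 : 0 < Q) (h1 : Q < 1) (z : 𝕜) (N : ℕ) :
    eulerE Q z = (∏ l ∈ Finset.range N, (1 - z * (Q : 𝕜) ^ l)) * eulerE Q ((Q : 𝕜) ^ N * z) := by
  induction N with
  | zero => simp
  | succ N ih =>
    rw [ih, eulerE_eq h0 h1, Finset.prod_range_succ, pow_succ']
    ring_nf

theorem tendsto_pow_mul_zero (h0 : 0 < Q) (h1 : Q < 1) (z : 𝕜) :
    Tendsto (fun N : ℕ => (Q : 𝕜) ^ N * z) atTop (𝓝 0) := by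
  have h : ‖(Q : 𝕜)‖ < 1 := by rwa [RCLike.norm_ofReal, abs_of_pos h0]
  simpa using (tendsto_pow_atTop_nhds_zero_of_norm_lt_one h).mul_const z

theorem tendsto_eulerE_pow (h0 : 0 < Q) (h1 : Q < 1) (z : 𝕜) :
    Tendsto (fun N : ℕ => eulerE Q ((Q : 𝕜) ^ N * z)) atTop (𝓝 1) := by
  rw [← eulerE_zero (𝕜 := 𝕜) Q]
  exact ((continuous_eulerE h0 h1).tendsto 0).comp (tendsto_pow_mul_zero h0 h1 z)

/-- Far along the orbit Q^N z the value is close to 1, so a zero can only come from one of finitely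
many explicit factors. -/
theorem eulerE_ne_zero (h0 : 0 < Q) (h1 : Q < 1) {z : 𝕜} (hz : ∀ l : ℕ, 1 - z * (Q : 𝕜) ^ l ≠ 0) :
    eulerE Q z ≠ 0 := by
  obtain ⟨N, hN⟩ := ((tendsto_eulerE_pow h0 h1 z).eventually_ne one_ne_zero).exists
  rw [eulerE_eq_prod h0 h1 z N]
  exact mul_ne_zero (Finset.prod_ne_zero_iff.2 fun l _ => hz l) hN

theorem tendsto_qPoch (h0 : 0 < Q) (h1 : Q < 1) (x : ℝ) :
    Tendsto (qPoch x Q) atTop (𝓝 (qPochInf x Q)) := by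
  have hs : Summable fun l : ℕ => -(x * Q ^ l) :=
    ((summable_geometric_of_lt_one h0.le h1).mul_left x).neg
  have h := (Real.multipliable_one_add_of_summable hs).hasProd.tendsto_prod_nat
  simp only [← sub_eq_add_neg] at h
  exact h

theorem eulerE_real (h0 : 0 < Q) (h1 : Q < 1) (x : ℝ) : eulerE Q x = qPochInf x Q := by
  have h := (tendsto_qPoch h0 h1 x).mul (tendsto_eulerE_pow h0 h1 x)
  rw [mul_one] at h
  refine tendsto_nhds_unique (tendsto_const_nhds.congr fun N => ?_) h
  exact eulerE_eq_prod h0 h1 x N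

/-- Bridge between the entire function used for analytic continuation and the real infinite products
in which the integrals are evaluated. -/
theorem eulerE_ofReal (h0 : 0 < Q) (h1 : Q < 1) (x : ℝ) :
    eulerE Q (x : 𝕜) = (qPochInf x Q : ℝ) := by
  have h : HasSum (fun j => eulerCoeff Q j • x ^ j) (qPochInf x Q) :=
    eulerE_real h0 h1 x ▸ (summable_eulerE h0 h1 x).hasSum
  have h' : HasSum _ ((qPochInf x Q : ℝ) : 𝕜) := RCLike.ofRealCLM.hasSum h
  rw [eulerE, ← h'.tsum_eq]
  simp [RCLike.real_smul_eq_coe_mul]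

/-! ### The series e_Q on the unit disc as the reciprocal of (z; Q)_∞. -/

theorem summable_one_div_qPoch (h0 : 0 < Q) (h1 : Q < 1) {R : ℝ} (hR0 : 0 ≤ R) (hR : R < 1) :
    Summable fun k => 1 / qPoch Q Q k * R ^ k := by
  obtain ⟨r, hr, hr1⟩ := exists_between hR
  refine summable_of_ratio_norm_eventually_le hr1 ?_
  have hlim : Tendsto (fun k : ℕ => R / (1 - Q ^ (k + 1))) atTop (𝓝 (R / (1 - 0))) :=
    tendsto_const_nhds.div (tendsto_const_nhds.sub ((tendsto_add_atTop_iff_nat 1).2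
      (tendsto_pow_atTop_nhds_zero_of_lt_one h0.le h1))) (by norm_num)
  rw [sub_zero, div_one] at hlim
  filter_upwards [hlim.eventually (gt_mem_nhds hr)] with k hk
  have hp := qPoch_self_pos h0 h1
  rw [Real.norm_of_nonneg (by have := hp (k + 1); positivity),
    Real.norm_of_nonneg (by have := hp k; positivity)]
  have h := qPoch_self_succ Q k
  have h' : 0 < 1 - Q ^ (k + 1) := sub_pos.2 (pow_lt_one₀ h0.le h1 (by simp))
  calc 1 / qPoch Q Q (k + 1) * R ^ (k + 1)
      = R / (1 - Q ^ (k + 1)) * (1 / qPoch Q Q k * R ^ k) := by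
        have := (hp k).ne'
        rw [h, pow_succ' R]; field_simp
    _ ≤ r * (1 / qPoch Q Q k * R ^ k) :=
        mul_le_mul_of_nonneg_right hk.le (by have := hp k; positivity)

/-- `e_Q(z) = ∑ z^k / (Q; Q)_k`. -/
noncomputable def eulerSum (Q : ℝ) (z : ℂ) : ℂ := ∑' k, ((1 / qPoch Q Q k : ℝ) : ℂ) * z ^ k

theorem summable_norm_eulerSum (h0 : 0 < Q) (h1 : Q < 1) {z : ℂ} (hz : ‖z‖ < 1) :
    Summable fun k => ‖((1 / qPoch Q Q k : ℝ) : ℂ) * z ^ k‖ := by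
  refine (summable_one_div_qPoch h0 h1 (norm_nonneg z) hz).congr fun k => ?_
  rw [norm_mul, norm_pow, Complex.norm_real, Real.norm_of_nonneg]
  have := qPoch_self_pos h0 h1 k
  positivity

theorem summable_eulerSum (h0 : 0 < Q) (h1 : Q < 1) {z : ℂ} (hz : ‖z‖ < 1) :
    Summable fun k => ((1 / qPoch Q Q k : ℝ) : ℂ) * z ^ k :=
  (summable_norm_eulerSum h0 h1 hz).of_norm

theorem eulerSum_mul (h0 : 0 < Q) (h1 : Q < 1) {z : ℂ} (hz : ‖z‖ < 1) :
    eulerSum Q (Q * z) = (1 - z) * eulerSum Q z := by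
  have hz' : ‖(Q : ℂ) * z‖ < 1 := by
    rw [norm_mul, Complex.norm_real, Real.norm_of_nonneg h0.le]
    nlinarith [norm_nonneg z]
  have hs := summable_eulerSum h0 h1 hz
  have hs' := summable_eulerSum h0 h1 hz'
  have h : eulerSum Q z - eulerSum Q (Q * z) = z * eulerSum Q z := by
    rw [eulerSum, eulerSum, ← hs.tsum_sub hs', (hs.sub hs').tsum_eq_zero_add, ← tsum_mul_left]
    simp only [pow_zero, sub_self, zero_add]
    refine tsum_congr fun j => ?_
    have hj : (qPoch Q Q j : ℂ) ≠ 0 := by exact_mod_cast (qPoch_self_pos h0 h1 j).ne'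
    have h : (1 - (Q : ℂ) ^ (j + 1)) ≠ 0 := by
      exact_mod_cast (sub_pos.2 (pow_lt_one₀ h0.le h1 (Nat.succ_ne_zero j))).ne'
    rw [qPoch_self_succ]
    push_cast
    rw [mul_pow]
    field_simp
    ring
  linear_combination -h

theorem continuousAt_eulerSum (h0 : 0 < Q) (h1 : Q < 1) : ContinuousAt (eulerSum Q) 0 := by
  have h : ContinuousOn (eulerSum Q) (Metric.ball 0 (1 / 2)) :=
    continuousOn_tsum (fun j => by fun_prop)
      (summable_one_div_qPoch h0 h1 (R := 1 / 2) (by norm_num) (by norm_num)) fun j x hx => by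
        have := qPoch_self_pos h0 h1 j
        rw [norm_mul, norm_pow, Complex.norm_real, Real.norm_of_nonneg (by positivity)]
        gcongr
        exact (mem_ball_zero_iff.1 hx).le
  exact h.continuousAt (Metric.isOpen_ball.mem_nhds (by simp))

/-- The two functional equations make the product invariant under z ↦ Qz; it is continuous at 0 with
value 1 there, hence equal to 1. -/
theorem eulerSum_mul_eulerE (h0 : 0 < Q) (h1 : Q < 1) {z : ℂ} (hz : ‖z‖ < 1) :
    eulerSum Q z * eulerE Q z = 1 := by
  have hzN : ∀ N : ℕ, ‖(Q : ℂ) ^ N * z‖ < 1 := fun N => by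
    rw [norm_mul, norm_pow, Complex.norm_real, Real.norm_of_nonneg h0.le]
    have := pow_le_one₀ h0.le h1.le (n := N)
    have := pow_pos h0 N
    nlinarith [norm_nonneg z]
  have hinv : ∀ N : ℕ, eulerSum Q ((Q : ℂ) ^ N * z) * eulerE Q ((Q : ℂ) ^ N * z) =
      eulerSum Q z * eulerE Q z := fun N => by
    induction N with
    | zero => simp
    | succ N ih =>
      have h3 := eulerE_eq h0 h1 ((Q : ℂ) ^ N * z)
      simp only [Complex.coe_algebraMap] at h3
      rw [← ih, pow_succ', mul_assoc, eulerSum_mul h0 h1 (hzN N), h3]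
      ring
  have hl := (((continuousAt_eulerSum h0 h1).mul
    (continuous_eulerE h0 h1).continuousAt).tendsto.comp (tendsto_pow_mul_zero h0 h1 z))
  have hzero : eulerSum Q 0 = 1 := by
    rw [eulerSum, tsum_eq_single 0 fun j hj => by simp [hj]]
    simp
  rw [Pi.mul_apply, hzero, eulerE_zero, one_mul] at hl
  exact tendsto_nhds_unique (tendsto_const_nhds.congr fun N => (hinv N).symm) hl

end Euler

end BraidedFourier

namespace BraidedFourier

open Filter Topology

/-! ### Ramanujan's bilateral sum -/

section Ramanujan

variable {Q c z : ℝ}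

theorem qPochInf_eq (h0 : 0 < Q) (h1 : Q < 1) (x : ℝ) :
    qPochInf x Q = (1 - x) * qPochInf (Q * x) Q := by
  rw [← eulerE_real h0 h1, ← eulerE_real h0 h1]
  exact eulerE_eq h0 h1 x

theorem one_le_qPochInf_neg (h0 : 0 < Q) (h1 : Q < 1) {y : ℝ} (hy : 0 ≤ y) :
    1 ≤ qPochInf (-y) Q := by
  refine ge_of_tendsto' (tendsto_qPoch h0 h1 (-y)) fun k => ?_
  induction k with
  | zero => simp
  | succ k ih =>
    rw [qPoch_succ]
    have := mul_nonneg hy (pow_pos h0 k).le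
    exact one_le_mul_of_one_le_of_one_le ih (by linarith)

/-- The function `k ↦ 1 / (-c Q^k; Q)_∞` on `ℤ`. -/
noncomputable def invPoch (Q c : ℝ) (k : ℤ) : ℝ := (qPochInf (-(c * Q ^ k)) Q)⁻¹

theorem invPoch_pos (h0 : 0 < Q) (h1 : Q < 1) (hc : 0 < c) (k : ℤ) : 0 < invPoch Q c k :=
  inv_pos.2 (one_pos.trans_le (one_le_qPochInf_neg h0 h1 (by positivity)))

theorem invPoch_le_one (h0 : 0 < Q) (h1 : Q < 1) (hc : 0 < c) (k : ℤ) : invPoch Q c k ≤ 1 :=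
  inv_le_one_of_one_le₀ (one_le_qPochInf_neg h0 h1 (by positivity))

theorem abs_invPoch_le_one (h0 : 0 < Q) (h1 : Q < 1) (hc : 0 < c) (k : ℤ) :
    |invPoch Q c k| ≤ 1 := by
  rw [abs_of_pos (invPoch_pos h0 h1 hc k)]
  exact invPoch_le_one h0 h1 hc k

theorem invPoch_succ (h0 : 0 < Q) (h1 : Q < 1) (hc : 0 < c) (k : ℤ) :
    invPoch Q c (k + 1) = (1 + c * Q ^ k) * invPoch Q c k := by
  have hk : 0 < c * Q ^ k := by positivity
  have h := qPochInf_eq h0 h1 (-(c * Q ^ k))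
  have h' : Q * -(c * Q ^ k) = -(c * Q ^ (k + 1)) := by rw [zpow_add_one₀ h0.ne']; ring
  rw [h', sub_neg_eq_add] at h
  rw [invPoch, invPoch, h, mul_inv, mul_inv_cancel_left₀ (by positivity)]

theorem invPoch_mono (h0 : 0 < Q) (h1 : Q < 1) (hc : 0 < c) : Monotone (invPoch Q c) :=
  monotone_int_of_le_succ fun k => by
    rw [invPoch_succ h0 h1 hc]
    have hk : 0 < c * Q ^ k := by positivity
    exact le_mul_of_one_le_left (invPoch_pos h0 h1 hc k).le (by linarith)

/-- Drops the 1 in the factor 1 + c Q^(-(n+1)). The resulting decay at -∞ is faster than any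
geometric one. -/
theorem invPoch_neg_succ_le (h0 : 0 < Q) (h1 : Q < 1) (hc : 0 < c) (n : ℕ) :
    invPoch Q c (-((n : ℤ) + 1)) ≤ Q ^ (n + 1) / c * invPoch Q c (-(n : ℤ)) := by
  have h := invPoch_succ h0 h1 hc (-((n : ℤ) + 1))
  rw [show -((n : ℤ) + 1) + 1 = -(n : ℤ) by ring] at h
  have hQ : Q ^ (-((n : ℤ) + 1)) = (Q ^ (n + 1))⁻¹ := by
    rw [zpow_neg]; norm_cast
  have hp := invPoch_pos h0 h1 hc (-((n : ℤ) + 1))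
  have hq : 0 < Q ^ (n + 1) := pow_pos h0 _
  rw [hQ] at h
  rw [h]
  have h2 : Q ^ (n + 1) / c * ((1 + c * (Q ^ (n + 1))⁻¹) * invPoch Q c (-((n : ℤ) + 1))) =
      invPoch Q c (-((n : ℤ) + 1)) + Q ^ (n + 1) / c * invPoch Q c (-((n : ℤ) + 1)) := by
    field_simp
    ring
  rw [h2]
  have : 0 < Q ^ (n + 1) / c * invPoch Q c (-((n : ℤ) + 1)) := by positivity
  linarith

theorem tendsto_invPoch (h0 : 0 < Q) (h1 : Q < 1) (c : ℝ) :
    Tendsto (fun n : ℕ => invPoch Q c n) atTop (𝓝 1) := by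
  have h := (tendsto_eulerE_pow h0 h1 (-c)).inv₀ one_ne_zero
  rw [inv_one] at h
  refine h.congr fun n => ?_
  rw [eulerE_real h0 h1, invPoch, zpow_natCast]
  congr 3
  simp [mul_comm]

theorem tendsto_pow_succ_div (h0 : 0 < Q) (h1 : Q < 1) (c : ℝ) :
    Tendsto (fun n : ℕ => Q ^ (n + 1) / c) atTop (𝓝 0) := by
  simpa using ((tendsto_add_atTop_iff_nat 1).2
    (tendsto_pow_atTop_nhds_zero_of_lt_one h0.le h1)).div_const c

theorem tendsto_invPoch_neg (h0 : 0 < Q) (h1 : Q < 1) (hc : 0 < c) :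
    Tendsto (fun n : ℕ => invPoch Q c (-(n : ℤ))) atTop (𝓝 0) := by
  rw [← tendsto_add_atTop_iff_nat 1]
  refine squeeze_zero (fun n => (invPoch_pos h0 h1 hc _).le) (fun n => ?_)
    (tendsto_pow_succ_div h0 h1 c)
  push_cast
  have hq : 0 < Q ^ (n + 1) / c := by positivity
  exact (invPoch_neg_succ_le h0 h1 hc n).trans
    (mul_le_of_le_one_right hq.le (invPoch_le_one h0 h1 hc _))

/-- At +∞ the geometric factor suffices, as z < 1; at -∞ the growth of z^k is beaten by the decay of
`invPoch`. -/
theorem summable_zpow_mul_invPoch (h0 : 0 < Q) (h1 : Q < 1) (hc : 0 < c) (hz0 : 0 < z)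
    (hz1 : z < 1) : Summable fun k : ℤ => z ^ k * invPoch Q c k := by
  refine .of_nat_of_neg ?_ ?_
  · refine .of_nonneg_of_le (fun n => ?_) (fun n => ?_)
      (summable_geometric_of_lt_one hz0.le hz1)
    · exact mul_nonneg (by positivity) (invPoch_pos h0 h1 hc _).le
    · rw [zpow_natCast]
      exact mul_le_of_le_one_right (by positivity) (invPoch_le_one h0 h1 hc _)
  · refine summable_of_ratio_norm_eventually_le (r := 1 / 2) (by norm_num) ?_
    have hlim := tendsto_pow_succ_div h0 h1 (c * z)
    filter_upwards [hlim.eventually (gt_mem_nhds (show (0 : ℝ) < 1 / 2 by norm_num))] with n hn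
    have hp := fun k => invPoch_pos h0 h1 hc k
    rw [Real.norm_of_nonneg (mul_nonneg (by positivity) (hp _).le),
      Real.norm_of_nonneg (mul_nonneg (by positivity) (hp _).le)]
    push_cast
    calc z ^ (-((n : ℤ) + 1)) * invPoch Q c (-((n : ℤ) + 1))
        ≤ z ^ (-((n : ℤ) + 1)) * (Q ^ (n + 1) / c * invPoch Q c (-(n : ℤ))) :=
          mul_le_mul_of_nonneg_left (invPoch_neg_succ_le h0 h1 hc n) (by positivity)
      _ = Q ^ (n + 1) / (c * z) * (z ^ (-(n : ℤ)) * invPoch Q c (-(n : ℤ))) := by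
          rw [neg_add, zpow_add₀ hz0.ne', zpow_neg_one]
          field_simp
      _ ≤ 1 / 2 * (z ^ (-(n : ℤ)) * invPoch Q c (-(n : ℤ))) :=
          mul_le_mul_of_nonneg_right hn.le (mul_nonneg (by positivity) (hp _).le)

/-! ### Laurent coefficients of (z; Q)_∞ times the bilateral sum. -/

theorem summable_abs_eulerCoeff (h0 : 0 < Q) (h1 : Q < 1) : Summable fun j => |eulerCoeff Q j| := by
  simpa using summable_eulerCoeff h0 h1 1

theorem tsum_eulerCoeff_mul_pow (h0 : 0 < Q) (h1 : Q < 1) (x : ℝ) :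
    ∑' j, eulerCoeff Q j * x ^ j = qPochInf x Q := by
  rw [← eulerE_real h0 h1]; rfl

/-- The coefficient of `z^m` in `(z; Q)_∞ ∑ₖ z^k / (-c Q^k; Q)_∞`. -/
noncomputable def bilateralCoeff (Q c : ℝ) (m : ℤ) : ℝ :=
  ∑' j : ℕ, eulerCoeff Q j * invPoch Q c (m - j)

/-- The sum `∑ⱼ Q^j t_j u_{m-j}`, whose first difference is `bilateralCoeff`. -/
noncomputable def bilateralPrim (Q c : ℝ) (m : ℤ) : ℝ :=
  ∑' j : ℕ, Q ^ j * eulerCoeff Q j * invPoch Q c (m - j)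

theorem norm_eulerCoeff_mul_invPoch_le (h0 : 0 < Q) (h1 : Q < 1) (hc : 0 < c) (j : ℕ) (k : ℤ) :
    ‖eulerCoeff Q j * invPoch Q c k‖ ≤ |eulerCoeff Q j| := by
  rw [norm_mul]
  exact mul_le_of_le_one_right (abs_nonneg _) (abs_invPoch_le_one h0 h1 hc k)

theorem norm_pow_mul_eulerCoeff_mul_invPoch_le (h0 : 0 < Q) (h1 : Q < 1) (hc : 0 < c) (j : ℕ)
    (k : ℤ) : ‖Q ^ j * eulerCoeff Q j * invPoch Q c k‖ ≤ |eulerCoeff Q j| := by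
  rw [mul_assoc, norm_mul]
  refine (mul_le_of_le_one_left (norm_nonneg _) ?_).trans
    (norm_eulerCoeff_mul_invPoch_le h0 h1 hc j k)
  rw [Real.norm_of_nonneg (by positivity)]
  exact pow_le_one₀ h0.le h1.le

theorem summable_bilateralCoeff (h0 : 0 < Q) (h1 : Q < 1) (hc : 0 < c) (m : ℤ) :
    Summable fun j : ℕ => eulerCoeff Q j * invPoch Q c (m - j) :=
  .of_norm_bounded (summable_abs_eulerCoeff h0 h1)
    fun j => norm_eulerCoeff_mul_invPoch_le h0 h1 hc j _

theorem summable_bilateralPrim (h0 : 0 < Q) (h1 : Q < 1) (hc : 0 < c) (m : ℤ) :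
    Summable fun j : ℕ => Q ^ j * eulerCoeff Q j * invPoch Q c (m - j) :=
  .of_norm_bounded (summable_abs_eulerCoeff h0 h1)
    fun j => norm_pow_mul_eulerCoeff_mul_invPoch_le h0 h1 hc j _

/-- Write t_j for the Euler coefficients. Replacing (1 - Q^j) t_j by -Q^(j-1) t_(j-1) shifts the
index by one, so the total of the coefficients telescopes. -/
theorem bilateralCoeff_eq_sub (h0 : 0 < Q) (h1 : Q < 1) (hc : 0 < c) (m : ℤ) :
    bilateralCoeff Q c m = bilateralPrim Q c m - bilateralPrim Q c (m - 1) := by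
  have hs := summable_bilateralCoeff h0 h1 hc m
  have hs' := summable_bilateralPrim h0 h1 hc m
  have h : bilateralCoeff Q c m - bilateralPrim Q c m = -bilateralPrim Q c (m - 1) := by
    rw [bilateralCoeff, bilateralPrim, ← hs.tsum_sub hs', (hs.sub hs').tsum_eq_zero_add,
      bilateralPrim, ← tsum_neg]
    simp only [pow_zero, one_mul, sub_self, zero_add]
    refine tsum_congr fun j => ?_
    rw [show m - ((j + 1 : ℕ) : ℤ) = m - 1 - j by push_cast; ring]
    linear_combination invPoch Q c (m - 1 - j) * eulerCoeff_succ h0 h1 j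
  linear_combination h

/-- With t_j the Euler coefficients and u_k = `invPoch Q c k`, the recursion u_(k+1) - u_k = c Q^k
u_k turns the difference of consecutive coefficients into a sum weighted by Q^(m-j), and (Q^j - 1)
t_j = Q^(j-1) t_(j-1) shifts the rest down. The defect from the theta recursion is therefore
independent of m. -/
theorem bilateralCoeff_succ_sub (h0 : 0 < Q) (h1 : Q < 1) (hc : 0 < c) (m : ℤ) :
    bilateralCoeff Q c (m + 1) - c * Q ^ m * bilateralCoeff Q c m =
      bilateralCoeff Q c m - c * Q ^ (m - 1) * bilateralCoeff Q c (m - 1) := by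
  have hs := summable_bilateralCoeff h0 h1 hc m
  have hs' := summable_bilateralCoeff h0 h1 hc (m + 1)
  have hd := (hs.mul_left (c * Q ^ m)).sub (hs'.sub hs)
  have h : c * Q ^ m * bilateralCoeff Q c m - (bilateralCoeff Q c (m + 1) - bilateralCoeff Q c m) =
      -(-(c * Q ^ (m - 1)) * bilateralCoeff Q c (m - 1)) := by
    rw [bilateralCoeff, bilateralCoeff, bilateralCoeff, ← tsum_mul_left, ← hs'.tsum_sub hs,
      ← (hs.mul_left (c * Q ^ m)).tsum_sub (hs'.sub hs), hd.tsum_eq_zero_add, ← tsum_mul_left,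
      ← tsum_neg]
    have hu : ∀ j : ℕ, invPoch Q c (m + 1 - j) =
        (1 + c * Q ^ (m - j)) * invPoch Q c (m - j) := fun j => by
      rw [← invPoch_succ h0 h1 hc]; ring_nf
    simp only [hu]
    have hz : c * Q ^ m * (eulerCoeff Q 0 * invPoch Q c (m - ((0 : ℕ) : ℤ))) -
        (eulerCoeff Q 0 * ((1 + c * Q ^ (m - ((0 : ℕ) : ℤ))) * invPoch Q c (m - ((0 : ℕ) : ℤ))) -
          eulerCoeff Q 0 * invPoch Q c (m - ((0 : ℕ) : ℤ))) = 0 := by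
      push_cast; rw [sub_zero]; ring
    rw [hz, zero_add]
    refine tsum_congr fun j => ?_
    have e1 : m - ((j + 1 : ℕ) : ℤ) = m - 1 - j := by push_cast; ring
    have e2 : Q ^ m = Q ^ (m - 1 - j) * Q ^ (j + 1) := by
      rw [← zpow_natCast Q, ← zpow_add₀ h0.ne']; congr 1; push_cast; ring
    have e3 : Q ^ (m - 1) = Q ^ (m - 1 - j) * Q ^ j := by
      rw [← zpow_natCast Q, ← zpow_add₀ h0.ne']; congr 1; ring
    rw [e1, e2, e3]
    linear_combination -c * Q ^ (m - 1 - j) * invPoch Q c (m - 1 - j) * eulerCoeff_succ h0 h1 j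
  linear_combination -h

theorem tendsto_bilateral_atTop (h0 : 0 < Q) (h1 : Q < 1) {g : ℕ → ℝ}
    (hg : ∀ j k, ‖g j * invPoch Q c k‖ ≤ |eulerCoeff Q j|) :
    Tendsto (fun m : ℕ => ∑' j : ℕ, g j * invPoch Q c (m - j)) atTop (𝓝 (∑' j, g j)) := by
  refine tendsto_tsum_of_dominated_convergence (summable_abs_eulerCoeff h0 h1) (fun j => ?_)
    (.of_forall fun m j => hg j _)
  have h := (tendsto_invPoch h0 h1 c).const_mul (g j)
  rw [mul_one] at h
  rw [← tendsto_add_atTop_iff_nat j]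
  refine h.congr fun m => ?_
  push_cast
  rw [add_sub_cancel_right]

theorem tendsto_bilateral_atBot (h0 : 0 < Q) (h1 : Q < 1) (hc : 0 < c) {g : ℕ → ℝ}
    (hg : ∀ j k, ‖g j * invPoch Q c k‖ ≤ |eulerCoeff Q j|) :
    Tendsto (fun m : ℕ => ∑' j : ℕ, g j * invPoch Q c (-(m : ℤ) - j)) atTop (𝓝 0) := by
  have h : Tendsto (fun m : ℕ => ∑' j : ℕ, g j * invPoch Q c (-(m : ℤ) - j)) atTop
      (𝓝 (∑' _ : ℕ, (0 : ℝ))) := by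
    refine tendsto_tsum_of_dominated_convergence (summable_abs_eulerCoeff h0 h1) (fun j => ?_)
      (.of_forall fun m j => hg j _)
    have h : Tendsto (fun m : ℕ => invPoch Q c (-(m : ℤ) - j)) atTop (𝓝 0) :=
      squeeze_zero (fun m => (invPoch_pos h0 h1 hc _).le)
        (fun m => invPoch_mono h0 h1 hc (by lia)) (tendsto_invPoch_neg h0 h1 hc)
    simpa using h.const_mul (g j)
  simpa using h

/-- The constant defect vanishes because it tends to 0 at +∞. -/
theorem bilateralCoeff_succ (h0 : 0 < Q) (h1 : Q < 1) (hc : 0 < c) (m : ℤ) :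
    bilateralCoeff Q c (m + 1) = c * Q ^ m * bilateralCoeff Q c m := by
  set D : ℤ → ℝ := fun m => bilateralCoeff Q c (m + 1) - c * Q ^ m * bilateralCoeff Q c m with hD
  have hstep : ∀ m, D (m + 1) = D m := fun m => by
    have h := bilateralCoeff_succ_sub h0 h1 hc (m + 1)
    rwa [add_sub_cancel_right] at h
  have hconst : ∀ m, D m = D 0 := fun m => by
    induction m using Int.induction_on with
    | zero => rfl
    | succ n ih => rw [hstep, ih]
    | pred n ih => rw [← ih, ← hstep, sub_add_cancel]
  -- The limit is the sum of the Euler coefficients, (1; Q)_∞, whose first factor is zero.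
  have hr : Tendsto (fun m : ℕ => bilateralCoeff Q c m) atTop (𝓝 0) := by
    have h := tendsto_bilateral_atTop h0 h1 (norm_eulerCoeff_mul_invPoch_le h0 h1 hc)
    have h1' := tsum_eulerCoeff_mul_pow h0 h1 1
    simp only [one_pow, mul_one] at h1'
    rwa [h1', qPochInf_eq h0 h1, sub_self, zero_mul] at h
  have hlim : Tendsto (fun m : ℕ => D m) atTop (𝓝 (0 - c * 0 * 0)) := by
    refine .sub ?_ (.mul (.mul tendsto_const_nhds ?_) hr)
    · refine ((tendsto_add_atTop_iff_nat 1).2 hr).congr fun m => ?_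
      push_cast; rfl
    · simpa using tendsto_pow_atTop_nhds_zero_of_lt_one h0.le h1
  have hzero : D 0 = 0 := by
    simpa using tendsto_nhds_unique (tendsto_const_nhds.congr fun n : ℕ => (hconst n).symm) hlim
  have := (hconst m).trans hzero
  simp only [hD] at this
  linarith

/-- The coefficients `c^m Q^{m(m-1)/2}` of the theta series. -/
noncomputable def thetaCoeff (Q c : ℝ) (m : ℤ) : ℝ := c ^ m * Q ^ (m * (m - 1) / 2)

theorem thetaCoeff_zero (Q c : ℝ) : thetaCoeff Q c 0 = 1 := by simp [thetaCoeff]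

theorem thetaCoeff_pos (h0 : 0 < Q) (hc : 0 < c) (m : ℤ) : 0 < thetaCoeff Q c m := by
  unfold thetaCoeff; positivity

theorem thetaCoeff_succ (h0 : 0 < Q) (hc : 0 < c) (m : ℤ) :
    thetaCoeff Q c (m + 1) = c * Q ^ m * thetaCoeff Q c m := by
  have h : (m + 1) * (m + 1 - 1) / 2 = m * (m - 1) / 2 + m := by
    rw [show (m + 1) * (m + 1 - 1) = m * (m - 1) + m * 2 by ring,
      Int.add_mul_ediv_right _ _ two_ne_zero]
  rw [thetaCoeff, thetaCoeff, h, zpow_add_one₀ hc.ne', zpow_add₀ h0.ne']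
  ring

theorem thetaCoeff_neg_succ (h0 : 0 < Q) (hc : 0 < c) (n : ℕ) :
    thetaCoeff Q c (-((n : ℤ) + 1)) = Q ^ (n + 1) / c * thetaCoeff Q c (-(n : ℤ)) := by
  have h := thetaCoeff_succ h0 hc (-((n : ℤ) + 1))
  rw [show -((n : ℤ) + 1) + 1 = -(n : ℤ) by ring, zpow_neg,
    show Q ^ ((n : ℤ) + 1) = Q ^ (n + 1) by norm_cast] at h
  rw [h]
  field_simp

theorem thetaCoeff_mul (Q c z : ℝ) (m : ℤ) :
    z ^ m * thetaCoeff Q c m = thetaCoeff Q (c * z) m := by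
  rw [thetaCoeff, thetaCoeff, mul_zpow]; ring

theorem bilateralCoeff_eq (h0 : 0 < Q) (h1 : Q < 1) (hc : 0 < c) (m : ℤ) :
    bilateralCoeff Q c m = thetaCoeff Q c m * bilateralCoeff Q c 0 := by
  induction m using Int.induction_on with
  | zero => rw [thetaCoeff_zero, one_mul]
  | succ n ih => rw [bilateralCoeff_succ h0 h1 hc, thetaCoeff_succ h0 hc, ih]; ring
  | pred n ih =>
    have h := bilateralCoeff_succ h0 h1 hc (-(n : ℤ) - 1)
    have h' := thetaCoeff_succ h0 hc (-(n : ℤ) - 1)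
    rw [sub_add_cancel] at h h'
    rw [h, h', mul_assoc (c * Q ^ _)] at ih
    exact mul_left_cancel₀ (by positivity) ih

theorem summable_thetaCoeff (h0 : 0 < Q) (h1 : Q < 1) (hc : 0 < c) :
    Summable (thetaCoeff Q c) := by
  have hp := thetaCoeff_pos h0 hc
  refine .of_nat_of_neg ?_ ?_
  · refine summable_of_ratio_norm_eventually_le (r := 1 / 2) (by norm_num) ?_
    have hlim : Tendsto (fun n : ℕ => c * Q ^ n) atTop (𝓝 0) := by
      simpa using (tendsto_pow_atTop_nhds_zero_of_lt_one h0.le h1).const_mul c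
    filter_upwards [hlim.eventually (gt_mem_nhds (show (0 : ℝ) < 1 / 2 by norm_num))] with n hn
    rw [Real.norm_of_nonneg (hp _).le, Real.norm_of_nonneg (hp _).le]
    push_cast
    rw [thetaCoeff_succ h0 hc, zpow_natCast]
    exact mul_le_mul_of_nonneg_right hn.le (hp _).le
  · refine summable_of_ratio_norm_eventually_le (r := 1 / 2) (by norm_num) ?_
    filter_upwards [(tendsto_pow_succ_div h0 h1 c).eventually
      (gt_mem_nhds (show (0 : ℝ) < 1 / 2 by norm_num))] with n hn
    rw [Real.norm_of_nonneg (hp _).le, Real.norm_of_nonneg (hp _).le]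
    push_cast
    rw [thetaCoeff_neg_succ h0 hc]
    exact mul_le_mul_of_nonneg_right hn.le (hp _).le

theorem summable_bilateralCoeff_int (h0 : 0 < Q) (h1 : Q < 1) (hc : 0 < c) :
    Summable (bilateralCoeff Q c) :=
  ((summable_thetaCoeff h0 h1 hc).mul_right _).congr fun m => (bilateralCoeff_eq h0 h1 hc m).symm

/-- Telescoping: `bilateralPrim` tends to 0 at -∞ and to the Euler series at z = Q at +∞. Together
with the theta form of the coefficients this amounts to Jacobi's triple product. -/
theorem hasSum_bilateralCoeff (h0 : 0 < Q) (h1 : Q < 1) (hc : 0 < c) :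
    HasSum (bilateralCoeff Q c) (qPochInf Q Q) := by
  have hs := summable_bilateralCoeff_int h0 h1 hc
  have hsub := bilateralCoeff_eq_sub h0 h1 hc
  have hle := norm_pow_mul_eulerCoeff_mul_invPoch_le h0 h1 hc
  have htop : Tendsto (fun m : ℕ => bilateralPrim Q c m) atTop (𝓝 (qPochInf Q Q)) := by
    have h := tendsto_bilateral_atTop h0 h1 hle
    simp_rw [mul_comm (Q ^ _) (eulerCoeff Q _), tsum_eulerCoeff_mul_pow h0 h1] at h
    simpa only [bilateralPrim, mul_comm (Q ^ _) (eulerCoeff Q _)] using h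
  have hbot : Tendsto (fun m : ℕ => bilateralPrim Q c (-(m : ℤ))) atTop (𝓝 0) :=
    tendsto_bilateral_atBot h0 h1 hc hle
  have hA : HasSum (fun n : ℕ => bilateralCoeff Q c n)
      (qPochInf Q Q - bilateralPrim Q c (-1)) := by
    have hs' : Summable fun n : ℕ => bilateralCoeff Q c n := hs.comp_injective Nat.cast_injective
    rw [hs'.hasSum_iff_tendsto_nat, ← tendsto_add_atTop_iff_nat 1]
    refine (htop.sub_const _).congr fun n => ?_
    induction n with
    | zero => simp [hsub]
    | succ n ih =>
      rw [Finset.sum_range_succ, ← ih, hsub]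
      push_cast
      rw [add_sub_cancel_right]; ring
  have hB : HasSum (fun n : ℕ => bilateralCoeff Q c (-((n : ℤ) + 1)))
      (bilateralPrim Q c (-1) - 0) := by
    have hinj : Function.Injective fun n : ℕ => -((n : ℤ) + 1) := fun a b h => by
      simp only at h; lia
    have hs' : Summable fun n : ℕ => bilateralCoeff Q c (-((n : ℤ) + 1)) := hs.comp_injective hinj
    rw [hs'.hasSum_iff_tendsto_nat]
    have hbot' := (tendsto_add_atTop_iff_nat 1).2 hbot
    refine (hbot'.const_sub _).congr fun n => ?_
    induction n with
    | zero => simp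
    | succ n ih =>
      rw [Finset.sum_range_succ, ← ih, hsub]
      push_cast
      rw [show -((n : ℤ) + 1) - 1 = -((n : ℤ) + 1 + 1) by ring]; ring
  have h := hA.of_nat_of_neg_add_one hB
  simpa using h

/-- Going down one index divides `invPoch` by 1 + cQ^(-k) = cQ^(-k)(1 + Q^k/c). The first factor is
absorbed by the theta coefficient, and the second one builds the shifted factorial. -/
theorem invPoch_neg_div_thetaCoeff (h0 : 0 < Q) (h1 : Q < 1) (hc : 0 < c) (n : ℕ) :
    invPoch Q c (-(n : ℤ)) / thetaCoeff Q c (-(n : ℤ)) =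
      invPoch Q c 0 / qPoch (-(Q / c)) Q n := by
  induction n with
  | zero => simp [thetaCoeff_zero]
  | succ n ih =>
    have hp : 0 < qPoch (-(Q / c)) Q n :=
      Finset.prod_pos fun l _ => by have : 0 < Q / c * Q ^ l := by positivity
                                    linarith
    have ht := thetaCoeff_pos h0 hc (-(n : ℤ))
    have h := invPoch_succ h0 h1 hc (-((n : ℤ) + 1))
    rw [show -((n : ℤ) + 1) + 1 = -(n : ℤ) by ring, zpow_neg,
      show Q ^ ((n : ℤ) + 1) = Q ^ (n + 1) by norm_cast] at h
    push_cast
    rw [thetaCoeff_neg_succ h0 hc, qPoch_succ, ← div_div (invPoch Q c 0), ← ih, h]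
    have h2 : 1 - -(Q / c) * Q ^ n = (c + Q ^ (n + 1)) / c := by field_simp; ring
    have h3 : 1 + c * (Q ^ (n + 1))⁻¹ = (c + Q ^ (n + 1)) / Q ^ (n + 1) := by field_simp; ring
    have h4 : 0 < c + Q ^ (n + 1) := by positivity
    rw [h2, h3]
    field_simp

/-- The ratio of `bilateralCoeff` to `thetaCoeff` is constant, so it can be computed at -∞. There
`invPoch` decays so fast that only the term j = 0 of the coefficient survives. -/
theorem bilateralCoeff_zero (h0 : 0 < Q) (h1 : Q < 1) (hc : 0 < c) :
    bilateralCoeff Q c 0 = (qPochInf (-c) Q * qPochInf (-(Q / c)) Q)⁻¹ := by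
  have hpos : qPochInf (-(Q / c)) Q ≠ 0 :=
    (one_pos.trans_le (one_le_qPochInf_neg h0 h1 (by positivity))).ne'
  have hlim1 : Tendsto (fun n : ℕ => invPoch Q c (-(n : ℤ)) / thetaCoeff Q c (-(n : ℤ))) atTop
      (𝓝 (invPoch Q c 0 / qPochInf (-(Q / c)) Q)) := by
    simp only [invPoch_neg_div_thetaCoeff h0 h1 hc]
    exact tendsto_const_nhds.div (tendsto_qPoch h0 h1 _) hpos
  have hup := fun k => invPoch_pos h0 h1 hc k
  have hlim2 : Tendsto (fun n : ℕ => ∑' j : ℕ, eulerCoeff Q j *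
      (invPoch Q c (-(n : ℤ) - j) / invPoch Q c (-(n : ℤ)))) atTop
      (𝓝 (∑' j : ℕ, if j = 0 then 1 else 0)) := by
    have hle : ∀ (n j : ℕ), invPoch Q c (-(n : ℤ) - j) / invPoch Q c (-(n : ℤ)) ≤ 1 := fun n j =>
      (div_le_one (hup _)).2 (invPoch_mono h0 h1 hc (by lia))
    refine tendsto_tsum_of_dominated_convergence (summable_abs_eulerCoeff h0 h1) (fun j => ?_)
      (.of_forall fun n j => ?_)
    · rcases j with - | j
      · have : ∀ n : ℕ, invPoch Q c (-(n : ℤ)) ≠ 0 := fun n => (hup _).ne'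
        simp [eulerCoeff_zero, this]
      · rw [if_neg j.succ_ne_zero, ← mul_zero (eulerCoeff Q (j + 1))]
        refine .const_mul _ (squeeze_zero (fun n => (div_pos (hup _) (hup _)).le) (fun n => ?_)
          (tendsto_pow_succ_div h0 h1 c))
        rw [div_le_iff₀ (hup _)]
        exact (invPoch_mono h0 h1 hc (by push_cast; lia)).trans (invPoch_neg_succ_le h0 h1 hc n)
    · rw [norm_mul, Real.norm_of_nonneg (div_pos (hup _) (hup _)).le]
      exact mul_le_of_le_one_right (norm_nonneg _) (hle n j)
  rw [tsum_ite_eq] at hlim2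
  have hlim := hlim2.mul hlim1
  have h : invPoch Q c 0 / qPochInf (-(Q / c)) Q =
      (qPochInf (-c) Q * qPochInf (-(Q / c)) Q)⁻¹ := by
    rw [invPoch, zpow_zero, mul_one, mul_inv, div_eq_mul_inv]
  rw [one_mul, h] at hlim
  refine tendsto_nhds_unique (tendsto_const_nhds.congr fun n => ?_) hlim
  have ht := (thetaCoeff_pos h0 hc (-(n : ℤ))).ne'
  have hu := (hup (-(n : ℤ))).ne'
  have hr := bilateralCoeff_eq h0 h1 hc (-(n : ℤ))
  rw [← mul_right_inj' ht, ← hr, bilateralCoeff]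
  rw [← tsum_mul_right, ← tsum_mul_left]
  refine tsum_congr fun j => ?_
  field_simp

/-- The bilateral sum `∑ₖ z^k / (-c Q^k; Q)_∞`. -/
noncomputable def bilateralSum (Q c z : ℝ) : ℝ := ∑' k : ℤ, z ^ k * invPoch Q c k

theorem bilateralSum_mul_qPochInf (h0 : 0 < Q) (h1 : Q < 1) (hc : 0 < c) (hz0 : 0 < z)
    (hz1 : z < 1) : bilateralSum Q c z * qPochInf z Q =
      bilateralCoeff Q c 0 * ∑' m : ℤ, thetaCoeff Q (c * z) m := by
  have hs1 := (summable_zpow_mul_invPoch h0 h1 hc hz0 hz1).norm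
  have hs2 : Summable fun j : ℕ => ‖eulerCoeff Q j * z ^ j‖ := (summable_eulerE h0 h1 z).norm
  have hs := summable_mul_of_summable_norm hs1 hs2
  -- A shear of the index set that groups the double sum by the total power z^m.
  let e : ℤ × ℕ ≃ ℤ × ℕ :=
    { toFun := fun p => (p.1 - p.2, p.2)
      invFun := fun p => (p.1 + p.2, p.2)
      left_inv := fun p => by simp
      right_inv := fun p => by simp }
  have hs' : Summable fun p : ℤ × ℕ =>
      z ^ (e p).1 * invPoch Q c (e p).1 * (eulerCoeff Q (e p).2 * z ^ (e p).2) :=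
    e.summable_iff.2 hs
  rw [bilateralSum, ← tsum_eulerCoeff_mul_pow h0 h1, tsum_mul_tsum_of_summable_norm hs1 hs2,
    ← e.tsum_eq, hs'.tsum_prod, ← tsum_mul_left]
  refine tsum_congr fun m => ?_
  rw [← thetaCoeff_mul, mul_left_comm, mul_comm (bilateralCoeff Q c 0),
    ← bilateralCoeff_eq h0 h1 hc, bilateralCoeff, ← tsum_mul_left]
  refine tsum_congr fun j => ?_
  have h : z ^ m = z ^ (m - j) * z ^ j := by
    rw [← zpow_natCast z, ← zpow_add₀ hz0.ne', sub_add_cancel]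
  simp only [e, Equiv.coe_fn_mk]
  rw [h]; ring

/-- The case `b = 0` of Ramanujan's `₁ψ₁` summation. -/
theorem bilateralSum_eq (h0 : 0 < Q) (h1 : Q < 1) (hc : 0 < c) (hz0 : 0 < z) (hz1 : z < 1) :
    bilateralSum Q c z =
      qPochInf Q Q * qPochInf (-(c * z)) Q * qPochInf (-(Q / (c * z))) Q /
        (qPochInf (-c) Q * qPochInf (-(Q / c)) Q * qPochInf z Q) := by
  have hcz : 0 < c * z := mul_pos hc hz0
  have hzne : qPochInf z Q ≠ 0 := by
    rw [← eulerE_real h0 h1]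
    refine eulerE_ne_zero h0 h1 fun l => ?_
    have := pow_le_one₀ h0.le h1.le (n := l)
    have := pow_pos h0 l
    simp only [RCLike.ofReal_real_eq_id, id]
    nlinarith
  have hp : ∀ {y : ℝ}, 0 < y → qPochInf (-y) Q ≠ 0 := fun hy =>
    (one_pos.trans_le (one_le_qPochInf_neg h0 h1 hy.le)).ne'
  -- The triple product, from the known total of the coefficients for the parameter cz rather than
  -- c.
  have htheta : bilateralCoeff Q (c * z) 0 * ∑' m : ℤ, thetaCoeff Q (c * z) m = qPochInf Q Q := by
    rw [← (hasSum_bilateralCoeff h0 h1 hcz).tsum_eq, ← tsum_mul_left]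
    exact tsum_congr fun m => by rw [bilateralCoeff_eq h0 h1 hcz m, mul_comm]
  have h := bilateralSum_mul_qPochInf h0 h1 hc hz0 hz1
  rw [bilateralCoeff_zero h0 h1 hc] at h
  rw [bilateralCoeff_zero h0 h1 hcz] at htheta
  have a1 := hp hcz
  have a2 := hp (div_pos h0 hcz)
  have a3 := hp hc
  have a4 := hp (div_pos h0 hc)
  rw [inv_mul_eq_iff_eq_mul₀ (mul_ne_zero a1 a2)] at htheta
  rw [htheta] at h
  rw [eq_div_iff (mul_ne_zero (mul_ne_zero a3 a4) hzne)]
  calc _ = (qPochInf (-c) Q * qPochInf (-(Q / c)) Q) * (bilateralSum Q c z * qPochInf z Q) := by ring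
    _ = _ := by rw [h, mul_inv_cancel_left₀ (mul_ne_zero a3 a4)]; ring

/-- Multiply u_(k+1) - u_k = c Q^k u_k, where u is `invPoch Q c`, by z^k and sum; the index shift
produces z⁻¹. -/
theorem bilateralSum_mul (h0 : 0 < Q) (h1 : Q < 1) (hc : 0 < c) (hz0 : 0 < z) (hz1 : z < 1) :
    c * bilateralSum Q c (Q * z) = (z⁻¹ - 1) * bilateralSum Q c z := by
  have hs := summable_zpow_mul_invPoch h0 h1 hc hz0 hz1
  have hshift : ∑' k : ℤ, z ^ k * invPoch Q c (k + 1) = z⁻¹ * bilateralSum Q c z := by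
    rw [bilateralSum, ← (Equiv.addRight (1 : ℤ)).tsum_eq fun k => z ^ k * invPoch Q c k,
      ← tsum_mul_left]
    refine tsum_congr fun k => ?_
    rw [Equiv.coe_addRight, zpow_add_one₀ hz0.ne']
    field_simp
  have hs' : Summable fun k : ℤ => z ^ k * invPoch Q c (k + 1) := by
    have h := ((Equiv.addRight (1 : ℤ)).summable_iff.2 hs).mul_left z⁻¹
    refine h.congr fun k => ?_
    simp only [Function.comp, Equiv.coe_addRight]
    rw [zpow_add_one₀ hz0.ne']
    field_simp
  rw [sub_mul, one_mul, ← hshift, bilateralSum, bilateralSum, ← hs'.tsum_sub hs, ← tsum_mul_left]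
  refine tsum_congr fun k => ?_
  rw [invPoch_succ h0 h1 hc, mul_zpow]
  ring

end Ramanujan

end BraidedFourier

namespace BraidedFourier

open QSeries

/-! ### Series in one of the variables -/

namespace QSeries

variable {n : ℕ} {q : ℝ} {w : Fin n → Fin n → ℕ}

theorem coeff_sum {ι : Type*} (s : Finset ι) (f : ι → QSeries n q w) (E : Fin n →₀ ℕ) :
    coeff E (∑ i ∈ s, f i) = ∑ i ∈ s, coeff E (f i) := by
  classical
  induction s using Finset.induction_on with
  | empty => simp
  | insert a s ha ih => rw [Finset.sum_insert ha, Finset.sum_insert ha, coeff_add, ih]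

/-- Coefficients of a product with a monomial on the right. -/
theorem coeff_mul_monomial_add (E F : Fin n →₀ ℕ) (c : ℂ) (f : QSeries n q w) :
    coeff (F + E) (f * monomial F c) = (q : ℂ) ^ reorder w E F * coeff E f * c := by
  rw [coeff_mul, Finset.sum_eq_single (E, F)]
  · simp [coeff_monomial]
  · rintro ⟨A, B⟩ hAB hne
    rw [Finset.HasAntidiagonal.mem_antidiagonal] at hAB
    have hB : B ≠ F := by
      rintro rfl
      have hA : A = E := add_right_cancel (hAB.trans (add_comm B E))
      exact hne (by rw [hA])
    simp [coeff_monomial, hB]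
  · intro h
    exact (h (by simp [add_comm])).elim

theorem coeff_mul_monomial_of_not_le {E F : Fin n →₀ ℕ} (h : ¬F ≤ E) (c : ℂ)
    (f : QSeries n q w) : coeff E (f * monomial F c) = 0 := by
  rw [coeff_mul]
  refine Finset.sum_eq_zero ?_
  rintro ⟨A, B⟩ hAB
  rw [Finset.HasAntidiagonal.mem_antidiagonal] at hAB
  have hB : B ≠ F := by
    rintro rfl
    exact h (hAB ▸ le_add_self)
  simp [coeff_monomial, hB]

/-- Coefficients of a product with a monomial on the left. -/
theorem coeff_monomial_mul_add (E F : Fin n →₀ ℕ) (c : ℂ) (f : QSeries n q w) :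
    coeff (F + E) (monomial F c * f) = (q : ℂ) ^ reorder w F E * c * coeff E f := by
  rw [coeff_mul, Finset.sum_eq_single (F, E)]
  · simp [coeff_monomial]
  · rintro ⟨A, B⟩ hAB hne
    rw [Finset.HasAntidiagonal.mem_antidiagonal] at hAB
    have hA : A ≠ F := by
      rintro rfl
      have hB : B = E := add_left_cancel hAB
      exact hne (by rw [hB])
    simp [coeff_monomial, hA]
  · intro h
    exact (h (by simp)).elim

theorem coeff_monomial_mul_of_not_le {E F : Fin n →₀ ℕ} (h : ¬F ≤ E) (c : ℂ)
    (f : QSeries n q w) : coeff E (monomial F c * f) = 0 := by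
  rw [coeff_mul]
  refine Finset.sum_eq_zero ?_
  rintro ⟨A, B⟩ hAB
  rw [Finset.HasAntidiagonal.mem_antidiagonal] at hAB
  have hA : A ≠ F := by
    rintro rfl
    exact h (hAB ▸ le_self_add)
  simp [coeff_monomial, hA]

theorem reorder_single_single (i j : Fin n) (a b : ℕ) :
    reorder w (Finsupp.single i a) (Finsupp.single j b) = w i j * a * b := by
  rw [reorder, Finset.sum_eq_single i, Finset.sum_eq_single j]
  · simp
  · intro k _ hk; simp [Finsupp.single_eq_of_ne hk]
  · simp
  · intro k _ hk; simp [Finsupp.single_eq_of_ne hk]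
  · simp

theorem reorder_single_right (E : Fin n →₀ ℕ) (j : Fin n) (b : ℕ) :
    reorder w E (Finsupp.single j b) = (∑ i, w i j * E i) * b := by
  rw [reorder, Finset.sum_mul]
  refine Finset.sum_congr rfl fun i _ => ?_
  rw [Finset.sum_eq_single j]
  · simp
  · intro k _ hk; simp [Finsupp.single_eq_of_ne hk]
  · simp

theorem reorder_single_left (E : Fin n →₀ ℕ) (i : Fin n) (a : ℕ) :
    reorder w (Finsupp.single i a) E = a * ∑ j, w i j * E j := by
  rw [reorder, Finset.sum_eq_single i, Finset.mul_sum]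
  · refine Finset.sum_congr rfl fun j _ => ?_
    rw [Finsupp.single_eq_same]; ring
  · intro k _ hk; simp [Finsupp.single_eq_of_ne hk]
  · simp

/-- The series `φ(v_j)` as a homomorphism in `φ`. -/
noncomputable def ofVar (j : Fin n) (hj : w j j = 0) : PowerSeries ℂ →ₐ[ℂ] QSeries n q w :=
  AlgHom.ofLinearMap
    { toFun := fun φ => mk fun E =>
        if E = Finsupp.single j (E j) then PowerSeries.coeff (E j) φ else 0
      map_add' := fun φ ψ => by
        ext E; simp only [coeff_mk, coeff_add]; split_ifs <;> simp
      map_smul' := fun c φ => by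
        ext E; simp only [coeff_mk, coeff_smul, RingHom.id_apply]; split_ifs <;> simp }
    (by
      ext E
      change (if _ then _ else _) = _
      rw [coeff_one, PowerSeries.coeff_one]
      by_cases h : E = 0
      · simp [h]
      · rw [if_neg h]
        split_ifs with h1 h2
        · exact absurd (by rw [h1, h2, Finsupp.single_zero]) h
        · rfl
        · rfl)
    (fun φ ψ => by
      ext E
      change (if _ then _ else _) = _
      rw [coeff_mul]
      split_ifs with h
      · rw [PowerSeries.coeff_mul]
        refine Finset.sum_of_injOn (fun p => (Finsupp.single j p.1, Finsupp.single j p.2)) ?_ ?_ ?_ ?_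
        · rintro ⟨a, b⟩ _ ⟨c, d⟩ _ hp
          simp only [Prod.mk.injEq] at hp
          rw [Finsupp.single_injective j hp.1, Finsupp.single_injective j hp.2]
        · rintro ⟨a, b⟩ hab
          simp only [Finset.mem_coe, Finset.HasAntidiagonal.mem_antidiagonal] at hab ⊢
          rw [← Finsupp.single_add, hab, ← h]
        · rintro ⟨A, B⟩ hAB hn
          simp only [LinearMap.coe_mk, AddHom.coe_mk, coeff_mk]
          rw [Finset.HasAntidiagonal.mem_antidiagonal] at hAB
          by_cases hA : A = Finsupp.single j (A j)
          · by_cases hB : B = Finsupp.single j (B j)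
            · refine (hn ⟨(A j, B j), ?_, ?_⟩).elim
              · simp [← hAB]
              · simp only [← hA, ← hB]
            · rw [if_neg hB, mul_zero]
          · rw [if_neg hA, mul_zero, zero_mul]
        · rintro ⟨a, b⟩ _
          simp [reorder_single_single, hj]
      · symm
        refine Finset.sum_eq_zero ?_
        rintro ⟨A, B⟩ hAB
        rw [Finset.HasAntidiagonal.mem_antidiagonal] at hAB
        simp only [LinearMap.coe_mk, AddHom.coe_mk, coeff_mk]
        by_cases hA : A = Finsupp.single j (A j)
        · by_cases hB : B = Finsupp.single j (B j)
          · refine (h ?_).elim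
            rw [← hAB, Finsupp.add_apply, Finsupp.single_add, ← hA, ← hB]
          · rw [if_neg hB, mul_zero]
        · rw [if_neg hA, mul_zero, zero_mul])

theorem coeff_ofVar (j : Fin n) (hj : w j j = 0) (φ : PowerSeries ℂ) (E : Fin n →₀ ℕ) :
    coeff E (ofVar j hj φ : QSeries n q w) =
      if E = Finsupp.single j (E j) then PowerSeries.coeff (E j) φ else 0 := rfl

theorem ofVar_X (j : Fin n) (hj : w j j = 0) :
    (ofVar j hj PowerSeries.X : QSeries n q w) = X j := by
  ext E
  rw [coeff_ofVar, X, coeff_monomial, PowerSeries.coeff_X]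
  by_cases h : E = Finsupp.single j 1
  · simp [h]
  · rw [if_neg h]
    split_ifs with h1 h2
    · exact absurd (by rw [h1, h2]) h
    · rfl
    · rfl

theorem X_pow (j : Fin n) (hj : w j j = 0) (k : ℕ) :
    (X j : QSeries n q w) ^ k = monomial (Finsupp.single j k) 1 := by
  induction k with
  | zero => rw [pow_zero, Finsupp.single_zero]; rfl
  | succ k ih =>
    rw [pow_succ, ih, X, monomial_mul_monomial, reorder_single_single, hj, ← Finsupp.single_add]
    simp

/-- Composition `φ(u)` of one-variable series, meaningful if `u` has no constant term. -/
noncomputable def psComp (φ u : PowerSeries ℂ) : PowerSeries ℂ :=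
  PowerSeries.mk fun e => ∑ k ∈ Finset.range (e + 1),
    PowerSeries.coeff k φ * PowerSeries.coeff e (u ^ k)

/-- Since `ofVar` is an algebra homomorphism, substitution into a series in one variable can be
carried out in commutative power series. -/
theorem subst_ofVar (j : Fin n) (hj : w j j = 0) (φ u : PowerSeries ℂ) :
    subst φ (ofVar j hj u : QSeries n q w) = ofVar j hj (psComp φ u) := by
  ext E
  rw [subst, coeff_mk, coeff_ofVar]
  simp only [← map_pow, coeff_ofVar]
  split_ifs with h
  · have hsum : ∑ i, E i = E j := by
      rw [h, Finset.sum_eq_single j]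
      · intro k _ hk; simp [Finsupp.single_eq_of_ne hk]
      · simp
    rw [psComp, PowerSeries.coeff_mk, hsum]
  · simp

theorem psComp_X (φ : PowerSeries ℂ) : psComp φ PowerSeries.X = φ := by
  ext e
  rw [psComp, PowerSeries.coeff_mk, Finset.sum_eq_single e]
  · simp [PowerSeries.coeff_X_pow]
  · intro k _ hk; simp [PowerSeries.coeff_X_pow, hk.symm]
  · simp

theorem coeff_psComp_smul_sq (φ : PowerSeries ℂ) (c : ℂ) (e : ℕ) :
    PowerSeries.coeff e (psComp φ (c • PowerSeries.X ^ 2)) =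
      if Even e then c ^ (e / 2) * PowerSeries.coeff (e / 2) φ else 0 := by
  have hpow : ∀ k, PowerSeries.coeff e ((c • (PowerSeries.X : PowerSeries ℂ) ^ 2) ^ k) =
      if e = 2 * k then c ^ k else 0 := fun k => by
    rw [smul_pow, ← pow_mul, PowerSeries.coeff_smul, PowerSeries.coeff_X_pow]
    split_ifs <;> simp
  simp only [psComp, PowerSeries.coeff_mk, hpow]
  split_ifs with h
  · obtain ⟨m, rfl⟩ := h
    rw [Finset.sum_eq_single m]
    · rw [if_pos (by ring), show (m + m) / 2 = m by lia, mul_comm]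
    · intro k _ hk; rw [if_neg (by lia), mul_zero]
    · intro hm; exact (hm (by simp)).elim
  · refine Finset.sum_eq_zero fun k _ => ?_
    rw [if_neg, mul_zero]
    rintro rfl
    exact h (even_two_mul k)

/-- The left factor is free of v_k, so the whole exponent of v_k must come from φ and a single pair
of the antidiagonal contributes. -/
theorem coeff_mul_ofVar (k : Fin n) (hk : w k k = 0) (f : QSeries n q w)
    (hf : ∀ E : Fin n →₀ ℕ, E k ≠ 0 → coeff E f = 0) (φ : PowerSeries ℂ) (E : Fin n →₀ ℕ) :
    coeff E (f * ofVar k hk φ) =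
      (q : ℂ) ^ reorder w (E.erase k) (Finsupp.single k (E k)) * coeff (E.erase k) f *
        PowerSeries.coeff (E k) φ := by
  rw [coeff_mul, Finset.sum_eq_single (E.erase k, Finsupp.single k (E k))]
  · simp [coeff_ofVar]
  · rintro ⟨A, B⟩ hAB hne
    rw [Finset.HasAntidiagonal.mem_antidiagonal] at hAB
    by_cases hA : A k = 0
    · by_cases hB : B = Finsupp.single k (B k)
      · refine (hne ?_).elim
        have hk' : E k = B k := by rw [← hAB, Finsupp.add_apply, hA, zero_add]
        have hB' : B = Finsupp.single k (E k) := by rw [hk']; exact hB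
        have hA' : A = E.erase k := by
          ext i
          by_cases hi : i = k
          · rw [hi, hA, Finsupp.erase_same]
          · rw [Finsupp.erase_ne hi, ← hAB, Finsupp.add_apply, hB, Finsupp.single_eq_of_ne hi,
              add_zero]
        rw [hA', hB']
      · rw [coeff_ofVar, if_neg hB, mul_zero]
    · rw [hf A hA, mul_zero, zero_mul]
  · intro h
    exact (h (by simp [Finsupp.erase_add_single])).elim

/-- The exponent `∑_{i<j} w i j e_i e_j`. -/
def crossExp (w : Fin n → Fin n → ℕ) (E : Fin n →₀ ℕ) : ℕ :=
  ∑ i, ∑ j, if i < j then w i j * E i * E j else 0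

/-- Induction on the last, hence largest, variable. Appending v_k costs the reordering of the
earlier exponents against e_k, which are the new pairs in `crossExp`. -/
theorem coeff_list_prod_ofVar (hw : ∀ j, w j j = 0) (φ : Fin n → PowerSeries ℂ) (L : List (Fin n))
    (hL : L.Pairwise (· < ·)) (E : Fin n →₀ ℕ) :
    coeff E ((L.map fun j => ofVar j (hw j) (φ j)).prod : QSeries n q w) =
      if ∀ j ∉ L, E j = 0 then
        (q : ℂ) ^ crossExp w E * (L.map fun j => PowerSeries.coeff (E j) (φ j)).prod
      else 0 := by
  induction L using List.reverseRecOn generalizing E with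
  | nil =>
    rw [List.map_nil, List.prod_nil, coeff_one]
    by_cases h : E = 0
    · simp [h, crossExp]
    · rw [if_neg h, if_neg]
      intro h'
      exact h (Finsupp.ext fun j => h' j (by simp))
  | append_singleton L k ih =>
    rw [List.pairwise_append] at hL
    obtain ⟨hL, -, hlt⟩ := hL
    have hlt : ∀ i ∈ L, i < k := fun i hi => hlt i hi k (by simp)
    have hkL : k ∉ L := fun h => lt_irrefl _ (hlt k h)
    have ih := ih hL
    rw [List.map_append, List.prod_append, List.map_singleton, List.prod_singleton,
      coeff_mul_ofVar k (hw k) _ fun E hE => by rw [ih, if_neg fun h => hE (h k hkL)], ih,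
      List.map_append, List.prod_append, List.map_singleton, List.prod_singleton]
    have hiff : (∀ j ∉ L, E.erase k j = 0) ↔ ∀ j ∉ L ++ [k], E j = 0 := by
      constructor
      · intro h j hj
        simp only [List.mem_append, List.mem_singleton, not_or] at hj
        rw [← Finsupp.erase_ne hj.2]; exact h j hj.1
      · intro h j hj
        by_cases hjk : j = k
        · rw [hjk, Finsupp.erase_same]
        · rw [Finsupp.erase_ne hjk]; exact h j (by simp [hj, hjk])
    by_cases h : ∀ j ∉ L ++ [k], E j = 0
    · rw [if_pos (hiff.2 h), if_pos h]
      have hgt : ∀ j, k < j → E j = 0 := fun j hj => h j (by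
        simp only [List.mem_append, List.mem_singleton, not_or]
        exact ⟨fun hj' => lt_asymm hj (hlt j hj'), hj.ne'⟩)
      have hexp : crossExp w E =
          reorder w (E.erase k) (Finsupp.single k (E k)) + crossExp w (E.erase k) := by
        rw [crossExp, crossExp, reorder, ← Finset.sum_add_distrib]
        refine Finset.sum_congr rfl fun i _ => ?_
        rw [← Finset.sum_add_distrib]
        refine Finset.sum_congr rfl fun j _ => ?_
        by_cases hi : i = k
        · subst hi
          rw [Finsupp.erase_same]
          split_ifs with hij
          · simp [hgt j hij]
          · simp
        · rw [Finsupp.erase_ne hi]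
          by_cases hj : j = k
          · subst hj
            rw [Finsupp.erase_same, Finsupp.single_eq_same]
            split_ifs with hij
            · simp
            · simp [hgt i (lt_of_le_of_ne (not_lt.1 hij) (Ne.symm hi))]
          · rw [Finsupp.erase_ne hj, Finsupp.single_eq_of_ne hj]
            simp
      have hmap : (L.map fun j => PowerSeries.coeff (E.erase k j) (φ j)) =
          L.map fun j => PowerSeries.coeff (E j) (φ j) :=
        List.map_congr_left fun j hj => by rw [Finsupp.erase_ne (hlt j hj).ne]
      rw [hmap, hexp, pow_add]
      ring
    · rw [if_neg (mt hiff.1 h), if_neg h]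
      ring

/-- Coefficients of an increasingly ordered product of one-variable series. -/
theorem coeff_prod_ofVar (hw : ∀ j, w j j = 0) (φ : Fin n → PowerSeries ℂ) (E : Fin n →₀ ℕ) :
    coeff E ((List.ofFn fun j => ofVar j (hw j) (φ j)).prod : QSeries n q w) =
      (q : ℂ) ^ crossExp w E * ∏ j, PowerSeries.coeff (E j) (φ j) := by
  rw [List.ofFn_eq_map, coeff_list_prod_ofVar hw φ _ (List.pairwise_lt_finRange n), if_pos]
  · rw [← List.ofFn_eq_map, List.prod_ofFn]
  · intro j hj; exact (hj (List.mem_finRange j)).elim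

end QSeries

/-! ### The Gaussian -/

section Gaussian

variable {n : ℕ} {q : ℝ}

/-- The coefficients of `e_{q⁴}(-t²)`. -/
noncomputable def gaussCoeff (q : ℝ) (e : ℕ) : ℂ :=
  if Even e then (-1) ^ (e / 2) * ((1 / qPoch (q ^ 4) (q ^ 4) (e / 2) : ℝ) : ℂ) else 0

theorem pow_four_pos (h0 : 0 < q) : 0 < q ^ 4 := pow_pos h0 4

theorem pow_four_lt_one (h0 : 0 < q) (h1 : q < 1) : q ^ 4 < 1 :=
  pow_lt_one₀ h0.le h1 (by norm_num)

theorem gaussCoeff_add_two (h0 : 0 < q) (h1 : q < 1) (e : ℕ) :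
    gaussCoeff q e = -(1 - ((q : ℂ) ^ 4) ^ ((e + 2) / 2)) * gaussCoeff q (e + 2) := by
  rw [gaussCoeff, gaussCoeff]
  have heven : Even (e + 2) ↔ Even e := by simp [Nat.even_add]
  simp only [heven]
  split_ifs with h
  · obtain ⟨m, rfl⟩ := h
    rw [show (m + m + 2) / 2 = m + 1 by lia, show (m + m) / 2 = m by lia, qPoch_self_succ]
    have hm : ((qPoch (q ^ 4) (q ^ 4) m : ℝ) : ℂ) ≠ 0 := by
      exact_mod_cast (qPoch_self_pos (pow_four_pos h0) (pow_four_lt_one h0 h1) m).ne'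
    have h : (1 - ((q : ℂ) ^ 4) ^ (m + 1)) ≠ 0 := by
      exact_mod_cast (sub_pos.2 (pow_lt_one₀ (pow_four_pos h0).le (pow_four_lt_one h0 h1)
        (Nat.succ_ne_zero m))).ne'
    push_cast
    rw [pow_succ (-1 : ℂ)]
    field_simp
  · simp

theorem coeff_psComp_eSeries (q : ℝ) (e : ℕ) :
    PowerSeries.coeff e (psComp (eSeries (q ^ 4)) ((-1 : ℂ) • PowerSeries.X ^ 2)) =
      gaussCoeff q e := by
  rw [coeff_psComp_smul_sq, gaussCoeff, eSeries, PowerSeries.coeff_mk]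

theorem covec_weight_self (j : Fin n) : (fun i j : Fin n => if j < i then 1 else 0) j j = 0 := by
  simp

theorem vec_weight_self (j : Fin n) : (fun i j : Fin n => if i < j then 1 else 0) j j = 0 := by
  simp

/-- Increasing order is already the normal order for the x's, so no power of q appears. -/
theorem crossExp_covec (E : Fin n →₀ ℕ) : crossExp (fun i j => if j < i then 1 else 0) E = 0 := by
  rw [crossExp]
  refine Finset.sum_eq_zero fun i _ => Finset.sum_eq_zero fun j _ => ?_
  split_ifs with h1 h2
  · exact (lt_asymm h1 h2).elim
  · simp
  · rfl

theorem gaussianMonomial_eq (q : ℝ) (a : Fin n → ℕ) :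
    gaussianMonomial q a = (List.ofFn fun j => ofVar j (covec_weight_self j)
      (psComp (eSeries (q ^ 4)) ((-1 : ℂ) • PowerSeries.X ^ 2) * PowerSeries.X ^ a j)).prod := by
  rw [gaussianMonomial]
  congr 2
  funext j
  rw [map_mul, map_pow, ofVar_X, ← subst_ofVar, map_smul, map_pow, ofVar_X, neg_one_smul]

theorem coeff_gaussianMonomial (q : ℝ) (a : Fin n → ℕ) (E : Fin n →₀ ℕ) :
    coeff E (gaussianMonomial q a) =
      ∏ j, if a j ≤ E j then gaussCoeff q (E j - a j) else 0 := by
  rw [gaussianMonomial_eq, coeff_prod_ofVar, crossExp_covec, pow_zero, one_mul]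
  simp only [PowerSeries.coeff_mul_X_pow', coeff_psComp_eSeries]

/-- A telescoping sum: the j-th term is Q^(∑_{i>j} m_i) - Q^(∑_{i≥j} m_i). -/
theorem sum_pow_sum_Ioi_mul (Q : ℂ) (m : Fin n → ℕ) :
    ∑ j, Q ^ (∑ i ∈ Finset.Ioi j, m i) * (1 - Q ^ m j) = 1 - Q ^ ∑ j, m j := by
  induction n with
  | zero => simp
  | succ n ih =>
    rw [Fin.sum_univ_succ, Fin.sum_univ_succ]
    simp only [Fin.sum_Ioi_zero, Fin.sum_Ioi_succ]
    rw [ih fun i => m i.succ, pow_add]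
    ring

/-- A q-multinomial theorem for the squares, which commute up to q⁴. Multiplying on the right by
x_j² moves it past the x_i with i > j, giving q⁴ to the power ∑_{i>j} e_i/2; the sum over j then
telescopes to 1 - q^(4(k+1)). -/
theorem coeff_sq_sum_pow (h0 : 0 < q) (h1 : q < 1) (k : ℕ) (E : Fin n →₀ ℕ) :
    coeff E ((-∑ j, X j ^ 2 : Covec n q) ^ k) =
      if ∑ j, E j / 2 = k then
        ((qPoch (q ^ 4) (q ^ 4) k : ℝ) : ℂ) * ∏ j, gaussCoeff q (E j) else 0 := by
  induction k generalizing E with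
  | zero =>
    rw [pow_zero, coeff_one, qPoch_zero, Complex.ofReal_one, one_mul]
    by_cases h : E = 0
    · simp [h, gaussCoeff]
    · rw [if_neg h]
      split_ifs with hs
      -- Halves are rounded down, so a nonzero exponent can still have all halves zero. Some
      -- exponent is then 1, and its Gaussian coefficient vanishes.
      · obtain ⟨j, hj⟩ := Finsupp.ne_iff.1 h
        have hj2 : E j / 2 = 0 := (Finset.sum_eq_zero_iff.1 hs) j (Finset.mem_univ j)
        have hj1 : E j = 1 := by have : E j ≠ 0 := hj
                                 lia
        exact (Finset.prod_eq_zero (Finset.mem_univ j) (by simp [hj1, gaussCoeff])).symm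
      · rfl
  | succ k ih =>
    have hterm : ∀ j, coeff E ((-∑ j, X j ^ 2 : Covec n q) ^ k * X j ^ 2) =
        if ∑ i, E i / 2 = k + 1 then
          -((((q : ℂ) ^ 4) ^ (∑ i ∈ Finset.Ioi j, E i / 2) * (1 - ((q : ℂ) ^ 4) ^ (E j / 2))) *
            (((qPoch (q ^ 4) (q ^ 4) k : ℝ) : ℂ) * ∏ i, gaussCoeff q (E i))) else 0 := fun j => by
      rw [X_pow j (covec_weight_self j)]
      by_cases hj : 2 ≤ E j
      · obtain ⟨F, rfl⟩ : ∃ F, E = Finsupp.single j 2 + F :=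
          ⟨E - Finsupp.single j 2, (add_tsub_cancel_of_le (Finsupp.single_le_iff.2 hj)).symm⟩
        have hsum : ∑ i, (Finsupp.single j 2 + F : Fin n →₀ ℕ) i / 2 = ∑ i, F i / 2 + 1 := by
          rw [← Finset.add_sum_erase _ _ (Finset.mem_univ j),
            ← Finset.add_sum_erase _ (fun i => F i / 2) (Finset.mem_univ j)]
          have : ∑ i ∈ Finset.univ.erase j, (Finsupp.single j 2 + F : Fin n →₀ ℕ) i / 2 =
              ∑ i ∈ Finset.univ.erase j, F i / 2 :=
            Finset.sum_congr rfl fun i hi => by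
              simp [Finsupp.single_eq_of_ne (Finset.ne_of_mem_erase hi)]
          rw [this, Finsupp.add_apply, Finsupp.single_eq_same]
          lia
        rw [coeff_mul_monomial_add, ih, hsum, mul_one]
        by_cases hk : ∑ i, F i / 2 = k
        · rw [if_pos hk, if_pos (by lia)]
          have hprod : ∏ i, gaussCoeff q (F i) =
              -(1 - ((q : ℂ) ^ 4) ^ ((F j + 2) / 2)) *
                ∏ i, gaussCoeff q ((Finsupp.single j 2 + F : Fin n →₀ ℕ) i) := by
            rw [← Finset.mul_prod_erase _ _ (Finset.mem_univ j), gaussCoeff_add_two h0 h1,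
              ← Finset.mul_prod_erase _ (fun i => gaussCoeff q
                ((Finsupp.single j 2 + F : Fin n →₀ ℕ) i)) (Finset.mem_univ j),
              Finsupp.add_apply, Finsupp.single_eq_same, add_comm 2 (F j), ← mul_assoc]
            congr 1
            exact Finset.prod_congr rfl fun i hi => by
              simp [Finsupp.single_eq_of_ne (Finset.ne_of_mem_erase hi)]
          rw [hprod]
          -- The reordering exponent 2 ∑ F_i equals 4 ∑ F_i/2 only for even exponents; if one is
          -- odd, both sides are zero.
          by_cases hE : ∀ i, Even (F i)
          · have hexp : (q : ℂ) ^ reorder (fun i j : Fin n => if j < i then 1 else 0) F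
                (Finsupp.single j 2) = ((q : ℂ) ^ 4) ^ (∑ i ∈ Finset.Ioi j,
                  (Finsupp.single j 2 + F : Fin n →₀ ℕ) i / 2) := by
              rw [reorder_single_right, ← pow_mul]
              congr 1
              have : (∑ i, (if j < i then 1 else 0) * F i) = ∑ i ∈ Finset.Ioi j, F i := by
                simp only [ite_mul, one_mul, zero_mul]
                rw [← Finset.sum_filter]
                congr 1
                ext i; simp
              rw [this, Finset.sum_mul, Finset.mul_sum]
              refine Finset.sum_congr rfl fun i hi => ?_
              obtain ⟨m, hm⟩ := hE i
              rw [Finsupp.add_apply, Finsupp.single_eq_of_ne (Finset.mem_Ioi.1 hi).ne']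
              lia
            rw [hexp, Finsupp.add_apply, Finsupp.single_eq_same, add_comm 2 (F j)]
            ring
          · push Not at hE
            obtain ⟨i, hi⟩ := hE
            have hz : gaussCoeff q ((Finsupp.single j 2 + F : Fin n →₀ ℕ) i) = 0 := by
              rw [gaussCoeff, if_neg]
              rw [Finsupp.add_apply, Nat.not_even_iff_odd]
              refine Even.add_odd ?_ (Nat.not_even_iff_odd.1 hi)
              by_cases hij : i = j
              · simp [hij]
              · simp [Finsupp.single_eq_of_ne hij]
            rw [Finset.prod_eq_zero (Finset.mem_univ i) hz]
            ring
        · rw [if_neg hk, if_neg (by lia), mul_zero]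
      · rw [coeff_mul_monomial_of_not_le fun h => hj (Finsupp.single_le_iff.1 h),
          show E j / 2 = 0 by lia]
        simp
    rw [pow_succ, mul_neg, Finset.mul_sum, coeff_neg, coeff_sum]
    simp only [hterm]
    split_ifs with hs
    · rw [Finset.sum_neg_distrib, neg_neg, ← Finset.sum_mul, sum_pow_sum_Ioi_mul, hs,
        qPoch_self_succ]
      push_cast
      ring
    · simp

/-- The Gaussian `e_{q⁴}(-∑ x_j²)` is the ordered product of the `e_{q⁴}(-x_j²)`. -/
theorem coeff_gaussian (h0 : 0 < q) (h1 : q < 1) (E : Fin n →₀ ℕ) :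
    coeff E (gaussian n q) = ∏ j, gaussCoeff q (E j) := by
  rw [gaussian, subst, coeff_mk]
  simp only [coeff_sq_sum_pow h0 h1]
  rw [Finset.sum_eq_single (∑ j, E j / 2)]
  · rw [if_pos rfl, eSeries, PowerSeries.coeff_mk, ← mul_assoc, ← Complex.ofReal_mul,
      one_div_mul_cancel
        (qPoch_self_pos (pow_four_pos h0) (pow_four_lt_one h0 h1) _).ne', Complex.ofReal_one,
      one_mul]
  · intro k _ hk
    rw [if_neg hk.symm, mul_zero]
  · intro h
    refine (h ?_).elim
    rw [Finset.mem_range, Nat.lt_succ_iff]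
    exact Finset.sum_le_sum fun j _ => Nat.div_le_self _ _

end Gaussian

end BraidedFourier

namespace BraidedFourier

open QSeries

/-! ### Discrete `q`-Hermite polynomials and the transformed series -/

section Hermite

variable {p : ℝ}

/-- The coefficients of the discrete `q`-Hermite I polynomials, extended by zero. -/
noncomputable def hermiteCoeff (p : ℝ) (l k : ℕ) : ℝ :=
  if 2 * k ≤ l then
    qPoch p p l * ((-1) ^ k * p ^ (k * (k - 1)) / (qPoch (p ^ 2) (p ^ 2) k * qPoch p p (l - 2 * k)))
  else 0

theorem hermiteI_eq_sum {A : Type*} [Ring A] [Algebra ℂ A] (p : ℝ) (l : ℕ) (u : A) {N : ℕ}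
    (hN : l / 2 + 1 ≤ N) :
    hermiteI p l u = ∑ k ∈ Finset.range N, (hermiteCoeff p l k : ℂ) • u ^ (l - 2 * k) := by
  rw [hermiteI]
  refine Finset.sum_subset_zero_on_sdiff (Finset.range_subset_range.2 hN) (fun k hk => ?_)
    fun k hk => ?_
  · rw [Finset.mem_sdiff, Finset.mem_range, Finset.mem_range] at hk
    rw [hermiteCoeff, if_neg (by lia), Complex.ofReal_zero, zero_smul]
  · rw [Finset.mem_range] at hk
    rw [hermiteCoeff, if_pos (by lia)]

/-- The three-term recurrence `hermiteI_add_two`, read off coefficient by coefficient. -/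
theorem hermiteCoeff_succ (h0 : 0 < p) (h1 : p < 1) (l k : ℕ) :
    hermiteCoeff p (l + 2) (k + 1) =
      hermiteCoeff p (l + 1) (k + 1) - p ^ l * (1 - p ^ (l + 1)) * hermiteCoeff p l k := by
  have hp := fun m => (qPoch_self_pos h0 h1 m).ne'
  have h20 : 0 < p ^ 2 := by positivity
  have h21 : p ^ 2 < 1 := pow_lt_one₀ h0.le h1 (by norm_num)
  have hp2 := fun m => (qPoch_self_pos h20 h21 m).ne'
  have hsub : ∀ m, 1 - p ^ (m + 1) ≠ 0 := fun m =>
    (sub_pos.2 (pow_lt_one₀ h0.le h1 m.succ_ne_zero)).ne'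
  have hsub2 : 1 - (p ^ 2) ^ (k + 1) ≠ 0 := (sub_pos.2 (pow_lt_one₀ h20.le h21 k.succ_ne_zero)).ne'
  have hexp : p ^ ((k + 1) * (k + 1 - 1)) = p ^ (k * (k - 1)) * p ^ (2 * k) := by
    rw [← pow_add]; congr 1
    rcases k with - | k
    · rfl
    · simp only [Nat.add_sub_cancel]; ring
  by_cases hk : 2 * k ≤ l
  · obtain ⟨m, rfl⟩ := Nat.exists_eq_add_of_le hk
    rw [hermiteCoeff, if_pos (by lia), hermiteCoeff, hermiteCoeff, if_pos hk,
      show 2 * k + m + 2 - 2 * (k + 1) = m by lia, show 2 * k + m - 2 * k = m by lia,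
      qPoch_self_succ _ (2 * k + m + 1), qPoch_self_succ _ (2 * k + m), qPoch_self_succ _ k, hexp]
    -- For m = 0 the polynomial of degree l + 1 has no such term, so the coefficient extended by
    -- zero is used.
    rcases m with - | m
    · rw [if_neg (by lia)]
      have := hp (2 * k)
      have := hp2 k
      rw [qPoch_zero]
      field_simp
      simp only [add_zero]
      ring
    · rw [if_pos (by lia), show 2 * k + (m + 1) + 1 - 2 * (k + 1) = m by lia, qPoch_self_succ _ m]
      have := hp (2 * k + (m + 1))
      have := hp m
      have := hp2 k
      have := hsub m
      field_simp
      ring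
  · rw [hermiteCoeff, if_neg (by lia), hermiteCoeff, if_neg (by lia), hermiteCoeff, if_neg hk]
    ring

theorem hermiteI_zero {A : Type*} [Ring A] [Algebra ℂ A] (p : ℝ) (u : A) : hermiteI p 0 u = 1 := by
  simp [hermiteI]

theorem hermiteI_one {A : Type*} [Ring A] [Algebra ℂ A] (h0 : 0 < p) (h1 : p < 1) (u : A) :
    hermiteI p 1 u = u := by
  have := (qPoch_self_pos h0 h1 1).ne'
  simp [hermiteI, this]

theorem hermiteI_add_two {A : Type*} [Ring A] [Algebra ℂ A] (h0 : 0 < p) (h1 : p < 1) (l : ℕ)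
    (u : A) : hermiteI p (l + 2) u =
      u * hermiteI p (l + 1) u - ((p ^ l * (1 - p ^ (l + 1)) : ℝ) : ℂ) • hermiteI p l u := by
  have hcz : ∀ l, hermiteCoeff p l 0 = 1 := fun l => by
    have := (qPoch_self_pos h0 h1 l).ne'
    simp [hermiteCoeff, this]
  rw [hermiteI_eq_sum p (l + 2) u (N := l + 3) (by lia),
    hermiteI_eq_sum p (l + 1) u (N := l + 3) (by lia),
    hermiteI_eq_sum p l u (N := l + 2) (by lia), Finset.sum_range_succ' _ (l + 2),
    Finset.sum_range_succ' _ (l + 2), mul_add, Finset.mul_sum, Finset.smul_sum, add_sub_right_comm, ← Finset.sum_sub_distrib]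
  congr 1
  · refine Finset.sum_congr rfl fun k _ => ?_
    rw [hermiteCoeff_succ h0 h1, show l + 2 - 2 * (k + 1) = l - 2 * k by lia, mul_smul_comm,
      ← pow_succ', smul_smul, Complex.ofReal_sub, sub_smul, ← Complex.ofReal_mul]
    congr 1
    by_cases hk : 2 * (k + 1) ≤ l + 1
    · rw [show l + 1 - 2 * (k + 1) + 1 = l - 2 * k by lia]
    · rw [hermiteCoeff, if_neg hk, Complex.ofReal_zero, zero_smul, zero_smul]
  · rw [hcz, hcz, mul_smul_comm, ← pow_succ']
    rfl

theorem map_hermiteI {A B : Type*} [Ring A] [Algebra ℂ A] [Ring B] [Algebra ℂ B] (f : A →ₐ[ℂ] B)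
    (p : ℝ) (l : ℕ) (u : A) : f (hermiteI p l u) = hermiteI p l (f u) := by
  simp [hermiteI, map_sum]

/-- The coefficients of `E_{p²}(-p² t²) h_a(t; p)`. -/
noncomputable def hermiteGaussCoeff (p : ℝ) (a e : ℕ) : ℝ :=
  if Even (e + a) then
    (-1) ^ ((((e + a) / 2 : ℕ) : ℤ) - a) *
      p ^ (((((e + a) / 2 : ℕ) : ℤ) - a) * ((((e + a) / 2 : ℕ) : ℤ) - a + 1)) *
      qPoch p (p ^ 2) ((e + a) / 2) / qPoch p p e
  else 0

theorem hermiteGaussCoeff_of_eq {a e m : ℕ} (h : e + a = 2 * m) :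
    hermiteGaussCoeff p a e = (-1) ^ ((m : ℤ) - a) * p ^ (((m : ℤ) - a) * ((m : ℤ) - a + 1)) *
      qPoch p (p ^ 2) m / qPoch p p e := by
  rw [hermiteGaussCoeff, if_pos (h ▸ even_two_mul m), show (e + a) / 2 = m by lia]

theorem hermiteGaussCoeff_of_odd {a e : ℕ} (h : ¬Even (e + a)) : hermiteGaussCoeff p a e = 0 :=
  if_neg h

/-- The new factor 1 - p^(2m+1), with 2m + 1 = e + a + 1, splits as (1 - p^e) + p^e (1 - p^(a+1)).
The second part is the multiple of the coefficient for a. The first vanishes at e = 0 and otherwise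
lowers the denominator to (p; p)_(e-1). -/
theorem hermiteGaussCoeff_add_two_of_eq (h0 : 0 < p) {a e m : ℕ} (h : e + a = 2 * m) :
    hermiteGaussCoeff p (a + 2) e =
      (-1) ^ ((m : ℤ) - a - 1) * p ^ (((m : ℤ) - a - 1) * ((m : ℤ) - a)) * qPoch p (p ^ 2) m *
          (1 - p ^ e) / qPoch p p e - p ^ a * (1 - p ^ (a + 1)) * hermiteGaussCoeff p a e := by
  rw [hermiteGaussCoeff_of_eq h, hermiteGaussCoeff_of_eq (m := m + 1) (by lia), qPoch_succ]
  have e1 : ((m + 1 : ℕ) : ℤ) - ((a + 2 : ℕ) : ℤ) = (m : ℤ) - a - 1 := by push_cast; ring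
  have e2 : (-1 : ℝ) ^ ((m : ℤ) - a) = -(-1) ^ ((m : ℤ) - a - 1) := by
    have h := zpow_add_one₀ (by norm_num : (-1 : ℝ) ≠ 0) ((m : ℤ) - a - 1)
    rw [sub_add_cancel] at h
    rw [h]; ring
  have e3 : p ^ (((m : ℤ) - a) * ((m : ℤ) - a + 1)) =
      p ^ (((m : ℤ) - a - 1) * ((m : ℤ) - a)) * p ^ (2 * ((m : ℤ) - a)) := by
    rw [← zpow_add₀ h0.ne']; congr 1; ring
  have e4 : p ^ a * p ^ (2 * ((m : ℤ) - a)) = p ^ e := by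
    rw [← zpow_natCast p a, ← zpow_natCast p e, ← zpow_add₀ h0.ne']; congr 1; lia
  have e5 : p * (p ^ 2) ^ m = p ^ e * p ^ (a + 1) := by
    rw [← pow_mul, ← pow_succ', ← pow_add]; congr 1; lia
  rw [e1, e2, e3, e5, sub_add_cancel, mul_div_assoc, mul_div_assoc, mul_div_assoc, ← e4]
  ring

theorem hermiteGaussCoeff_add_two_zero (h0 : 0 < p) (a : ℕ) :
    hermiteGaussCoeff p (a + 2) 0 = -(p ^ a * (1 - p ^ (a + 1)) * hermiteGaussCoeff p a 0) := by
  by_cases h : Even (0 + a)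
  · obtain ⟨m, hm⟩ := h
    rw [hermiteGaussCoeff_add_two_of_eq h0 (m := m) (by lia)]
    simp
  · rw [hermiteGaussCoeff_of_odd h, hermiteGaussCoeff_of_odd (by rwa [← add_assoc,
      Nat.even_add, iff_true_right even_two])]
    ring

theorem hermiteGaussCoeff_add_two_succ (h0 : 0 < p) (h1 : p < 1) (a e : ℕ) :
    hermiteGaussCoeff p (a + 2) (e + 1) = hermiteGaussCoeff p (a + 1) e -
      p ^ a * (1 - p ^ (a + 1)) * hermiteGaussCoeff p a (e + 1) := by
  by_cases h : Even (e + 1 + a)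
  · obtain ⟨m, hm⟩ := h
    rw [hermiteGaussCoeff_add_two_of_eq h0 (m := m) (by lia),
      hermiteGaussCoeff_of_eq (a := a + 1) (m := m) (by lia), qPoch_self_succ]
    have := (qPoch_self_pos h0 h1 e).ne'
    have : 1 - p ^ (e + 1) ≠ 0 := (sub_pos.2 (pow_lt_one₀ h0.le h1 e.succ_ne_zero)).ne'
    push_cast
    rw [show (m : ℤ) - (a + 1) = m - a - 1 by ring, sub_add_cancel]
    field_simp
  · rw [hermiteGaussCoeff_of_odd h, hermiteGaussCoeff_of_odd (by rwa [← add_assoc,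
      Nat.even_add, iff_true_right even_two]), hermiteGaussCoeff_of_odd (by
        rwa [show e + (a + 1) = e + 1 + a by ring])]
    ring

theorem hermiteGaussCoeff_one_zero (p : ℝ) : hermiteGaussCoeff p 1 0 = 0 :=
  hermiteGaussCoeff_of_odd (by decide)

theorem hermiteGaussCoeff_one_succ (h0 : 0 < p) (h1 : p < 1) (e : ℕ) :
    hermiteGaussCoeff p 1 (e + 1) = hermiteGaussCoeff p 0 e := by
  by_cases h : Even (e + 0)
  · obtain ⟨m, hm⟩ := h
    rw [hermiteGaussCoeff_of_eq (a := 1) (m := m + 1) (by lia),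
      hermiteGaussCoeff_of_eq (a := 0) (m := m) (by lia), qPoch_self_succ, qPoch_succ]
    have := (qPoch_self_pos h0 h1 e).ne'
    have : 1 - p ^ (e + 1) ≠ 0 := (sub_pos.2 (pow_lt_one₀ h0.le h1 e.succ_ne_zero)).ne'
    have h2 : p * (p ^ 2) ^ m = p ^ (e + 1) := by
      rw [← pow_mul, ← pow_succ']; congr 1; lia
    push_cast
    rw [h2, add_sub_cancel_right, sub_zero]
    field_simp
  · rw [hermiteGaussCoeff_of_odd h, hermiteGaussCoeff_of_odd (by
      rwa [show e + 1 + 1 = e + 0 + 2 by ring, Nat.even_add, iff_true_right even_two])]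

/-- The series `E_{p²}(-p² t²) h_a(t; p)`. -/
noncomputable def hermiteGaussSeries (p : ℝ) (a : ℕ) : PowerSeries ℂ :=
  PowerSeries.mk fun e => (hermiteGaussCoeff p a e : ℂ)

theorem hermiteGaussSeries_one (h0 : 0 < p) (h1 : p < 1) :
    hermiteGaussSeries p 1 = PowerSeries.X * hermiteGaussSeries p 0 := by
  ext e
  rcases e with - | e
  · simp [hermiteGaussSeries, hermiteGaussCoeff_one_zero]
  · rw [PowerSeries.coeff_succ_X_mul, hermiteGaussSeries, hermiteGaussSeries,
      PowerSeries.coeff_mk, PowerSeries.coeff_mk, hermiteGaussCoeff_one_succ h0 h1]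

theorem hermiteGaussSeries_add_two (h0 : 0 < p) (h1 : p < 1) (a : ℕ) :
    hermiteGaussSeries p (a + 2) = PowerSeries.X * hermiteGaussSeries p (a + 1) -
      ((p ^ a * (1 - p ^ (a + 1)) : ℝ) : ℂ) • hermiteGaussSeries p a := by
  ext e
  rcases e with - | e
  · simp [hermiteGaussSeries, hermiteGaussCoeff_add_two_zero h0]
  · rw [map_sub, PowerSeries.coeff_smul, PowerSeries.coeff_succ_X_mul, hermiteGaussSeries,
      hermiteGaussSeries, hermiteGaussSeries, PowerSeries.coeff_mk, PowerSeries.coeff_mk,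
      PowerSeries.coeff_mk, hermiteGaussCoeff_add_two_succ h0 h1, Complex.ofReal_sub,
      Complex.ofReal_mul _ (hermiteGaussCoeff _ _ _), smul_eq_mul]

/-- Both sides satisfy the same second-order recurrence in a and agree for a = 0 and a = 1. -/
theorem hermiteGaussSeries_eq (h0 : 0 < p) (h1 : p < 1) (a : ℕ) :
    hermiteGaussSeries p a = hermiteGaussSeries p 0 * hermiteI p a PowerSeries.X := by
  induction a using Nat.twoStepInduction with
  | zero => rw [hermiteI_zero, mul_one]
  | one => rw [hermiteI_one h0 h1, hermiteGaussSeries_one h0 h1, mul_comm]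
  | more a ih0 ih1 =>
    rw [hermiteI_add_two h0 h1, hermiteGaussSeries_add_two h0 h1, ih0, ih1,
      mul_sub (hermiteGaussSeries p 0), mul_smul_comm, mul_left_comm]

theorem qPoch_two_mul (p : ℝ) (m : ℕ) :
    qPoch p p (2 * m) = qPoch p (p ^ 2) m * qPoch (p ^ 2) (p ^ 2) m := by
  induction m with
  | zero => simp
  | succ m ih =>
    rw [show 2 * (m + 1) = 2 * m + 1 + 1 by ring, qPoch_succ, qPoch_succ, ih, qPoch_succ, qPoch_succ]
    ring

theorem hermiteGaussSeries_zero (h0 : 0 < p) (h1 : p < 1) :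
    hermiteGaussSeries p 0 =
      psComp (ESeries (p ^ 2)) ((-((p : ℂ) ^ 2)) • PowerSeries.X ^ 2) := by
  ext e
  rw [coeff_psComp_smul_sq, hermiteGaussSeries, PowerSeries.coeff_mk, ESeries, PowerSeries.coeff_mk]
  split_ifs with h
  · obtain ⟨m, rfl⟩ := h
    rw [show (m + m) / 2 = m by lia, hermiteGaussCoeff_of_eq (m := m) (by lia), ← two_mul,
      qPoch_two_mul]
    have := (qPoch_self_pos h0 h1 (2 * m)).ne'
    rw [qPoch_two_mul] at this
    have hne := left_ne_zero_of_mul this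
    have hexp : p ^ (((m : ℤ) - (0 : ℕ)) * ((m : ℤ) - (0 : ℕ) + 1)) =
        (p ^ 2) ^ m * (p ^ 2) ^ (m * (m - 1) / 2) := by
      rw [← pow_mul, ← pow_mul, ← pow_add, Nat.mul_div_cancel' (Nat.even_mul_pred_self m).two_dvd,
        ← zpow_natCast]
      congr 1
      rcases m with - | m
      · simp
      · rw [Nat.add_sub_cancel]; push_cast; ring
    rw [hexp, Nat.cast_zero, sub_zero, zpow_natCast,
      mul_comm (qPoch p (p ^ 2) m) (qPoch (p ^ 2) (p ^ 2) m), mul_div_mul_right _ _ hne, neg_pow]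
    push_cast
    ring
  · rw [hermiteGaussCoeff_of_odd (by rwa [add_zero]), Complex.ofReal_zero]

/-- With e = 2m - a the exponents match through e² + e - 2m² = a(1-a) + 2(m-a)(m-a+1), and (-i)^e =
(-i)^a (-1)^(m-a). Integer powers are needed because m - a may be negative. -/
theorem transformSeries_eq {q : ℝ} (hq0 : 0 < q) (a : ℕ) :
    transformSeries q a = ((-Complex.I) ^ a * (q : ℂ) ^ ((a : ℤ) * (1 - (a : ℤ)))) •
      hermiteGaussSeries (q ^ 2) a := by
  ext e
  rw [transformSeries, PowerSeries.coeff_mk, PowerSeries.coeff_smul, hermiteGaussSeries,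
    PowerSeries.coeff_mk]
  split_ifs with h
  · obtain ⟨m, hm⟩ := h
    have hI : (-Complex.I) ^ e = (-Complex.I) ^ a * (((-1) ^ ((m : ℤ) - a) : ℝ) : ℂ) := by
      have hne : -Complex.I ≠ 0 := neg_ne_zero.2 Complex.I_ne_zero
      have h2 : (-Complex.I) ^ (2 : ℤ) = -1 := by
        rw [show (2 : ℤ) = (2 : ℕ) by rfl, zpow_natCast, neg_sq, Complex.I_sq]
      rw [← zpow_natCast, ← zpow_natCast, show (e : ℤ) = a + 2 * ((m : ℤ) - a) by lia,
        zpow_add₀ hne, zpow_mul, h2]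
      push_cast; rfl
    have hq : q ^ (e ^ 2 + e) * (q ^ ((e + a) ^ 2 / 2))⁻¹ = q ^ ((a : ℤ) * (1 - (a : ℤ))) *
        (q ^ 2) ^ (((m : ℤ) - a) * ((m : ℤ) - a + 1)) := by
      have h2 : (e + a) ^ 2 / 2 = 2 * m ^ 2 := by
        rw [hm, show (m + m) ^ 2 = 2 * (2 * m ^ 2) by ring, Nat.mul_div_cancel_left _ two_pos]
      rw [h2, ← zpow_natCast, ← zpow_natCast, ← zpow_natCast q 2, ← zpow_neg, ← zpow_mul,
        ← zpow_add₀ hq0.ne', ← zpow_add₀ hq0.ne']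
      congr 1
      push_cast
      rw [show (e : ℤ) = 2 * m - a by lia]
      ring
    rw [hermiteGaussCoeff_of_eq (m := m) (by lia), show (e + a) / 2 = m by lia, hI,
      show (q ^ 2) ^ 2 = q ^ 4 by ring, smul_eq_mul, ← Complex.ofReal_zpow,
      mul_assoc ((-Complex.I) ^ a), mul_assoc ((-Complex.I) ^ a), ← Complex.ofReal_mul,
      ← Complex.ofReal_mul]
    congr 2
    linear_combination ((-1) ^ ((m : ℤ) - a) * qPoch (q ^ 2) (q ^ 4) m / qPoch (q ^ 2) (q ^ 2) e) * hq
  · rw [hermiteGaussCoeff_of_odd h, Complex.ofReal_zero, smul_zero]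

end Hermite

/-! ### Ordered products in the vector algebra -/

/-- The product increases in j while the normal order of the ∂'s decreases; the power of q is the
cost of reversing it. -/
theorem coeff_prod_subst_transformSeries {n : ℕ} {q : ℝ} (b : Fin n → ℂ) (φ : Fin n → PowerSeries ℂ)
    (E : Fin n →₀ ℕ) :
    coeff E ((List.ofFn fun j => b j • subst (φ j) (X j : Vec n q)).prod) =
      (q : ℂ) ^ crossExp (fun i j => if i < j then 1 else 0) E *
        ∏ j, (b j * PowerSeries.coeff (E j) (φ j)) := by
  have h : ∀ j, b j • subst (φ j) (X j : Vec n q) = ofVar j (vec_weight_self j) (b j • φ j) :=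
    fun j => by rw [← ofVar_X j (vec_weight_self j), subst_ofVar, psComp_X, map_smul]
  simp only [h]
  rw [coeff_prod_ofVar]
  simp

theorem prod_zpow_eq_zpow_sum {ι : Type*} (s : Finset ι) {x : ℂ} (hx : x ≠ 0) (f : ι → ℤ) :
    ∏ i ∈ s, x ^ f i = x ^ ∑ i ∈ s, f i := by
  classical
  induction s using Finset.induction_on with
  | empty => simp
  | insert i s hi ih => rw [Finset.prod_insert hi, Finset.sum_insert hi, zpow_add₀ hx, ih]

theorem hermiteGaussian_eq {n : ℕ} {q : ℝ} (h0 : 0 < q) (h1 : q < 1) (a : Fin n → ℕ) :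
    hermiteGaussian q a =
      (List.ofFn fun j => subst (transformSeries q (a j)) (X j : Vec n q)).prod := by
  have hp0 : 0 < q ^ 2 := by positivity
  have hp1 : q ^ 2 < 1 := pow_lt_one₀ h0.le h1 (by norm_num)
  have h : ∀ k : Fin n, subst (ESeries (q ^ 4)) (-((q : ℂ) ^ 4 • (X k : Vec n q) ^ 2)) *
      hermiteI (q ^ 2) (a k) (X k : Vec n q) =
        ofVar k (vec_weight_self k) (hermiteGaussSeries (q ^ 2) (a k)) := fun k => by
    have hX : -((q : ℂ) ^ 4 • (X k : Vec n q) ^ 2) =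
        ofVar k (vec_weight_self k) ((-((q : ℂ) ^ 4)) • PowerSeries.X ^ 2) := by
      rw [map_smul, map_pow, ofVar_X, neg_smul]
    have h4 : (((q ^ 2 : ℝ) : ℂ)) ^ 2 = (q : ℂ) ^ 4 := by push_cast; ring
    have h4' : (q ^ 2) ^ 2 = q ^ 4 := by ring
    rw [hermiteGaussSeries_eq hp0 hp1, hermiteGaussSeries_zero hp0 hp1, map_mul, map_hermiteI,
      ofVar_X, hX, subst_ofVar, h4, h4']
  ext E
  have h1' := coeff_prod_subst_transformSeries (q := q) (fun _ => 1)
    (fun j : Fin n => transformSeries q (a j)) E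
  simp only [one_smul, one_mul] at h1'
  rw [h1', hermiteGaussian, coeff_smul]
  simp only [h]
  rw [coeff_prod_ofVar]
  simp only [transformSeries_eq h0, PowerSeries.coeff_smul, smul_eq_mul, Finset.prod_mul_distrib]
  rw [Finset.prod_pow_eq_pow_sum, prod_zpow_eq_zpow_sum _ (Complex.ofReal_ne_zero.2 h0.ne')]
  ring

end BraidedFourier

namespace BraidedFourier

open QSeries Filter Topology

/-! ### Analytic continuation of normally ordered series -/

section Continuation

variable {n : ℕ} {q : ℝ}

/-- The identity theorem, which makes the choice of continuation in `value` immaterial. -/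
theorem IsContinuation.eq_of_real {f : Covec n q} {F G : (Fin n → ℂ) → ℂ} (hF : IsContinuation f F)
    (hG : IsContinuation f G) (z : Fin n → ℝ) :
    F (fun j => (z j : ℂ)) = G (fun j => (z j : ℂ)) := by
  obtain ⟨⟨r, hr, hFs⟩, U, hU, hU0, hFa⟩ := hF
  obtain ⟨⟨s, hs, hGs⟩, V, hV, hV0, hGa⟩ := hG
  obtain ⟨δ, hδ, hball⟩ := Metric.isOpen_iff.1 (hU.inter hV) 0 ⟨hU0, hV0⟩
  let imL : (Fin n → ℂ) →ₗ[ℝ] (Fin n → ℝ) := LinearMap.pi fun j => Complex.imLm.comp (LinearMap.proj j)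
  have himL : ∀ z : Fin n → ℂ, imL z = fun j => (z j).im := fun z => rfl
  -- The intersection of the two tubes need not be connected; the tube over a ball inside it is
  -- convex and still contains ℝⁿ.
  have hconv : Convex ℝ (imL ⁻¹' Metric.ball 0 δ) := (convex_ball 0 δ).linear_preimage imL
  have h := (hFa.mono fun z hz => (hball hz).1 :
      AnalyticOnNhd ℂ F (imL ⁻¹' Metric.ball 0 δ)).eqOn_of_preconnected_of_eventuallyEq
    (hGa.mono fun z hz => (hball hz).2 : AnalyticOnNhd ℂ G (imL ⁻¹' Metric.ball 0 δ))
    hconv.isPreconnected (z₀ := 0) (by simpa using hδ) ?_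
  · refine h ?_
    rw [Set.mem_preimage, himL]
    simpa [← Pi.zero_def] using hδ
  · filter_upwards [Metric.ball_mem_nhds (0 : Fin n → ℂ) (lt_min hr hs)] with z hz
    have hz' : ∀ j, ‖z j‖ < min r s := fun j =>
      (norm_le_pi_norm z j).trans_lt (mem_ball_zero_iff.1 hz)
    exact (hFs z fun j => (hz' j).trans_le (min_le_left _ _)).unique
      (hGs z fun j => (hz' j).trans_le (min_le_right _ _))

theorem IsContinuation.value_eq {f : Covec n q} {F : (Fin n → ℂ) → ℂ} (hF : IsContinuation f F)
    (z : Fin n → ℝ) : value f z = F fun j => (z j : ℂ) := by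
  have h : ∃ F, IsContinuation f F := ⟨F, hF⟩
  rw [value, dif_pos h]
  exact h.choose_spec.eq_of_real hF z

theorem isContinuation_zero : IsContinuation (0 : Covec n q) 0 :=
  ⟨⟨1, one_pos, fun z _ => by simp [hasSum_zero]⟩, Set.univ, isOpen_univ, trivial, fun _ _ =>
    analyticAt_const⟩

/-- Continuations of series whose coefficients arise from those of `f` by shifting the exponents
and rescaling the variables. -/
theorem IsContinuation.twist {f g : Covec n q} {F : (Fin n → ℂ) → ℂ} (hF : IsContinuation f F)
    (A : Fin n →₀ ℕ) (c : ℂ) (l : Fin n → ℝ)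
    (hg : ∀ E, coeff (A + E) g = c * (∏ j, (l j : ℂ) ^ E j) * coeff E f)
    (hg0 : ∀ E, ¬A ≤ E → coeff E g = 0) :
    IsContinuation g fun z => c * (∏ j, z j ^ A j) * F fun j => l j * z j := by
  obtain ⟨⟨r, hr, hFs⟩, U, hU, hU0, hFa⟩ := hF
  -- The radius forces |l_j z_j| < r for every j, the summand 1 keeping the denominator positive. As
  -- the l_j are real, imaginary parts are simply scaled by them.
  refine ⟨⟨r / (∑ j, |l j| + 1), by positivity, fun z hz => ?_⟩,
    {y | (fun j => l j * y j) ∈ U}, hU.preimage (by fun_prop), by simpa [← Pi.zero_def] using hU0,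
    fun z hz => ?_⟩
  · have hlz : ∀ j, ‖(l j : ℂ) * z j‖ < r := fun j => by
      have h1 : |l j| ≤ ∑ j, |l j| :=
        Finset.single_le_sum (f := fun j => |l j|) (fun j _ => abs_nonneg _) (Finset.mem_univ j)
      have h2 := hz j
      rw [lt_div_iff₀ (by positivity)] at h2
      rw [norm_mul, Complex.norm_real, Real.norm_eq_abs]
      nlinarith [norm_nonneg (z j)]
    have hs := (hFs _ hlz).mul_left (c * ∏ j, z j ^ A j)
    rw [← Function.Injective.hasSum_iff (add_right_injective A)]
    · refine hs.congr_fun fun E => ?_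
      simp only [Function.comp, hg, mul_pow, Finset.prod_mul_distrib, Finsupp.add_apply, pow_add]
      ring
    · intro E hE
      rw [hg0 E fun h => hE ⟨E - A, add_tsub_cancel_of_le h⟩, zero_mul]
  · have hlin : AnalyticAt ℂ (fun z : Fin n → ℂ => fun j => (l j : ℂ) * z j) z :=
      AnalyticAt.pi fun j => analyticAt_const.mul
        ((ContinuousLinearMap.proj (R := ℂ) (φ := fun _ : Fin n => ℂ) j).analyticAt z)
    have hmem : (fun j => ((l j : ℂ) * z j).im) ∈ U := by
      simpa [Complex.re_ofReal_mul, Complex.im_ofReal_mul] using hz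
    refine (analyticAt_const.mul (Finset.analyticAt_fun_prod _ fun j _ => ?_)).mul
      (AnalyticAt.fun_comp (g := F) (hFa _ hmem) hlin)
    exact ((ContinuousLinearMap.proj (R := ℂ) (φ := fun _ : Fin n => ℂ) j).analyticAt z).pow _

/-! ### Terms of the iterated integral -/

theorem IsContinuation.integralStep {f : Covec n q} {F : (Fin n → ℂ) → ℂ}
    (hF : IsContinuation f F) (hq : q ≠ 0) (i : Fin n) (s : ℕ) (k : ℤ) (ε : ℤˣ) :
    IsContinuation (integralStep i s k ε f) fun z =>
      (((1 - q ^ 2) * q ^ (2 * k + s) : ℝ) : ℂ) * z i * F fun j =>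
        ((if j < i then q⁻¹ else if j = i then ((ε : ℤ) : ℝ) * q ^ (2 * k + s) else 1 : ℝ) : ℂ) *
          z j := by
  have h := hF.twist (g := BraidedFourier.integralStep i s k ε f) (Finsupp.single i 1)
    (((1 - q ^ 2) * q ^ (2 * k + s) : ℝ) : ℂ)
    (fun j => if j < i then q⁻¹ else if j = i then ((ε : ℤ) : ℝ) * q ^ (2 * k + s) else 1)
    (fun E => ?_) fun E hE => ?_
  · convert h using 4 with z
    rw [Finset.prod_eq_single i]
    · simp
    · intro j _ hj; simp [Finsupp.single_eq_of_ne hj]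
    · simp
  · rw [BraidedFourier.integralStep, coeff_smul, X, coeff_monomial_mul_add, reorder_single_left,
      rescale, coeff_mk, one_mul, mul_one, ← Finset.prod_pow_eq_pow_sum, ← mul_assoc (∏ _, _),
      ← Finset.prod_mul_distrib, ← mul_assoc]
    congr 2
    refine Finset.prod_congr rfl fun j _ => ?_
    have hq' : (q : ℂ) ≠ 0 := Complex.ofReal_ne_zero.2 hq
    split_ifs with h1 h2
    -- Moving x_i to the right past x_j with j < i gives q for each x_j, which turns the rescaling
    -- q⁻² into q⁻¹.
    · rw [one_mul, ← mul_pow]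
      congr 1
      push_cast
      field_simp
    · rw [zero_mul, pow_zero, one_mul]
    · rw [zero_mul, pow_zero, one_mul, Complex.ofReal_one]
  · rw [BraidedFourier.integralStep, coeff_smul, X, coeff_monomial_mul_of_not_le hE, mul_zero]

/-- The power of `q` picked up by the variable `x_j` while integrating over the variables in `L`. -/
noncomputable def integralShift (q : ℝ) (L : List (Fin n)) (j : Fin n) : ℝ :=
  (L.map fun l => if j < l then q⁻¹ else 1).prod

/-- Each further step rescales every smaller variable by q⁻¹, including the prefactors z_i left by
the steps already done; hence the same shift appears in the prefactor and in the argument. -/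
theorem isContinuation_foldl_integralStep {f : Covec n q} {F : (Fin n → ℂ) → ℂ}
    (hF : IsContinuation f F) (hq : q ≠ 0) (s : Fin n → ℕ) (K : Fin n → ℤ) (ε : Fin n → ℤˣ)
    (L : List (Fin n)) (hL : L.Pairwise (· < ·)) :
    IsContinuation (L.foldl (fun g i => integralStep i (s i) (K i) (ε i) g) f) fun z =>
      (L.map fun i => (((1 - q ^ 2) * q ^ (2 * K i + s i) * integralShift q L i : ℝ) : ℂ) * z i).prod *
        F fun j => (((if j ∈ L then ((ε j : ℤ) : ℝ) * q ^ (2 * K j + s j) else 1) *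
          integralShift q L j : ℝ) : ℂ) * z j := by
  induction L using List.reverseRecOn with
  | nil => simpa [integralShift] using hF
  | append_singleton L k ih =>
    rw [List.pairwise_append] at hL
    obtain ⟨hL, -, hlt⟩ := hL
    have hlt : ∀ i ∈ L, i < k := fun i hi => hlt i hi k (by simp)
    rw [List.foldl_append, List.foldl_cons, List.foldl_nil]
    have hshift : ∀ j, integralShift q (L ++ [k]) j =
        integralShift q L j * if j < k then q⁻¹ else 1 := fun j => by
      simp [integralShift]
    have hshift1 : ∀ j, k ≤ j → integralShift q L j = 1 := fun j hj => by
      rw [integralShift]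
      refine List.prod_eq_one fun x hx => ?_
      obtain ⟨l, hl, rfl⟩ := List.mem_map.1 hx
      exact if_neg ((hlt l hl).trans_le hj).not_gt
    convert (ih hL).integralStep hq k (s k) (K k) (ε k) using 2 with z
    rw [List.map_append, List.prod_append, List.map_singleton, List.prod_singleton, hshift,
      hshift1 k le_rfl, if_neg (lt_irrefl k), mul_one, mul_one, mul_comm (List.prod _), mul_assoc,
      mul_assoc, mul_assoc]
    congr 3
    · congr 1
      refine List.map_congr_left fun i hi => ?_
      simp only [hshift, if_pos (hlt i hi)]
      push_cast
      ring
    · congr 1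
      funext j
      simp only [hshift]
      rw [← mul_assoc (Complex.ofReal _) (Complex.ofReal _) (z j), ← Complex.ofReal_mul]
      congr 2
      rcases lt_trichotomy j k with hj | rfl | hj
      · simp only [hj, if_true, List.mem_append, List.mem_singleton, hj.ne, or_false]
        ring
      · have hjL : j ∉ L := fun h => lt_irrefl _ (hlt j h)
        simp [hjL, hshift1 j le_rfl]
      · have hjL : j ∉ L := fun h => lt_asymm hj (hlt j h)
        simp [hjL, hshift1 j hj.le, hj.not_gt, hj.ne']

theorem integralShift_finRange (q : ℝ) (j : Fin n) :
    integralShift q (List.finRange n) j = q ^ (-((n - 1 - (j : ℕ) : ℕ) : ℤ)) := by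
  rw [integralShift, ← List.ofFn_eq_map, List.prod_ofFn, Finset.prod_ite, Finset.prod_const_one,
    mul_one, Finset.prod_const, zpow_neg, zpow_natCast, inv_pow, ← Fin.card_Ioi j]
  congr 3
  ext i; simp

/-- The realization of one term of the iterated integral. -/
theorem IsContinuation.value_integralTerm {f : Covec n q} {F : (Fin n → ℂ) → ℂ}
    (hF : IsContinuation f F) (hq : q ≠ 0) (s : Fin n → ℕ) (p : (Fin n → ℤ) × (Fin n → ℤˣ))
    (γ : Fin n → ℝ) :
    value (integralTerm s p f) γ =
      (∏ j, (((1 - q ^ 2) * (q ^ (2 * p.1 j) * (q ^ ((s j : ℤ) - (n - 1 - (j : ℕ) : ℕ)) * γ j)) : ℝ) :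
        ℂ)) * F fun j => (((p.2 j : ℤ) : ℝ) * (q ^ (2 * p.1 j) *
          (q ^ ((s j : ℤ) - (n - 1 - (j : ℕ) : ℕ)) * γ j)) : ℝ) := by
  have h := isContinuation_foldl_integralStep hF hq s p.1 p.2 (List.finRange n)
    (List.pairwise_lt_finRange n)
  rw [integralTerm, h.value_eq, ← List.ofFn_eq_map, List.prod_ofFn]
  have e : ∀ j : Fin n, q ^ (2 * p.1 j + s j) * q ^ (-((n - 1 - (j : ℕ) : ℕ) : ℤ)) =
      q ^ (2 * p.1 j) * q ^ ((s j : ℤ) - (n - 1 - (j : ℕ) : ℕ)) := fun j => by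
    rw [← zpow_add₀ hq, ← zpow_add₀ hq]; congr 1; ring
  congr 1
  · refine Finset.prod_congr rfl fun j _ => ?_
    rw [integralShift_finRange, ← Complex.ofReal_mul, mul_assoc (1 - q ^ 2), e]
    congr 1; ring
  · congr 1
    funext j
    rw [if_pos (List.mem_finRange j), integralShift_finRange, ← Complex.ofReal_mul,
      mul_assoc ((p.2 j : ℤ) : ℝ), e]
    congr 1; ring

/-! ### Sums of products -/

theorem summable_norm_and_tsum_pi_prod {κ : Type*} (f : Fin n → κ → ℂ)
    (hf : ∀ j, Summable fun k => ‖f j k‖) :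
    (Summable fun p : Fin n → κ => ‖∏ j, f j (p j)‖) ∧
      ∑' p : Fin n → κ, ∏ j, f j (p j) = ∏ j, ∑' k, f j k := by
  induction n with
  | zero => exact ⟨(hasSum_unique _).summable, by simp⟩
  | succ n ih =>
    obtain ⟨ihs, iht⟩ := ih (fun j => f j.succ) fun j => hf j.succ
    let e := Fin.consEquiv fun _ : Fin (n + 1) => κ
    have he : ∀ p : κ × (Fin n → κ), ∏ j, f j (e p j) = f 0 p.1 * ∏ j, f j.succ (p.2 j) := fun p => by
      rw [Fin.prod_univ_succ]; simp [e, Fin.consEquiv]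
    constructor
    · rw [← e.summable_iff]
      refine ((hf 0).mul_norm ihs).congr fun p => ?_
      simp only [Function.comp, he]
    · rw [← e.tsum_eq, Fin.prod_univ_succ, ← iht, tsum_mul_tsum_of_summable_norm (hf 0) ihs]
      exact tsum_congr he

theorem summable_norm_prod_pair (f : Fin n → ℤ → ℤˣ → ℂ)
    (hf : ∀ j, Summable fun k : ℤ × ℤˣ => ‖f j k.1 k.2‖) :
    (Summable fun p : (Fin n → ℤ) × (Fin n → ℤˣ) => ‖∏ j, f j (p.1 j) (p.2 j)‖) ∧
      ∑' p : (Fin n → ℤ) × (Fin n → ℤˣ), ∏ j, f j (p.1 j) (p.2 j) =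
        ∏ j, ∑' k : ℤ × ℤˣ, f j k.1 k.2 := by
  obtain ⟨h1, h2⟩ := summable_norm_and_tsum_pi_prod (fun j (k : ℤ × ℤˣ) => f j k.1 k.2) hf
  let e := Equiv.arrowProdEquivProdArrow (Fin n) (fun _ => ℤ) (fun _ => ℤˣ)
  exact ⟨e.summable_iff.1 h1, by rw [← h2, ← e.tsum_eq]; rfl⟩

/-! ### Continuation of the Gaussian -/

/-- The function `e_{q⁴}(-z²) = 1 / (-z²; q⁴)_∞`. -/
noncomputable def gaussFn (q : ℝ) (z : ℂ) : ℂ := (eulerE (q ^ 4) (-z ^ 2))⁻¹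

theorem gaussFn_ofReal (h0 : 0 < q) (h1 : q < 1) (x : ℝ) :
    gaussFn q x = (((qPochInf (-x ^ 2) (q ^ 4))⁻¹ : ℝ) : ℂ) := by
  rw [gaussFn, Complex.ofReal_inv]
  congr 1
  have := eulerE_ofReal (𝕜 := ℂ) (pow_four_pos h0) (pow_four_lt_one h0 h1) (-x ^ 2)
  simpa using this

/-- The poles solve z² q^(4l) = -1, that is z = ±i q^(-2l), and these have imaginary part of modulus
at least 1. -/
theorem analyticAt_gaussFn (h0 : 0 < q) (h1 : q < 1) {z : ℂ} (hz : |z.im| < 1) :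
    AnalyticAt ℂ (gaussFn q) z := by
  have hQ0 := pow_four_pos h0
  have hQ1 := pow_four_lt_one h0 h1
  have hd : Differentiable ℂ fun z : ℂ => eulerE (q ^ 4) (-z ^ 2) :=
    (differentiable_eulerE hQ0 hQ1).comp (by fun_prop)
  refine (hd.analyticAt z).inv (eulerE_ne_zero hQ0 hQ1 fun l hl => ?_)
  have hq : (((q ^ 4 : ℝ) : ℂ)) ^ l = ((q ^ (2 * l) : ℝ) : ℂ) ^ 2 := by
    push_cast; rw [← pow_mul, ← pow_mul]; congr 1; ring
  have hprod : (z * (q ^ (2 * l) : ℝ) - Complex.I) * (z * (q ^ (2 * l) : ℝ) + Complex.I) = 0 := by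
    have hl' : 1 - -z ^ 2 * (((q ^ 4 : ℝ) : ℂ)) ^ l = 0 := by simpa using hl
    rw [hq] at hl'
    linear_combination hl' - Complex.I_sq
  have hpow : 0 < q ^ (2 * l) ∧ q ^ (2 * l) ≤ 1 := ⟨by positivity, pow_le_one₀ h0.le h1.le⟩
  obtain ⟨hlo, hhi⟩ := abs_lt.1 hz
  rcases mul_eq_zero.1 hprod with h | h
  · have him := congrArg Complex.im h
    simp only [Complex.sub_im, Complex.im_mul_ofReal, Complex.I_im, Complex.zero_im] at him
    nlinarith
  · have him := congrArg Complex.im h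
    simp only [Complex.add_im, Complex.im_mul_ofReal, Complex.I_im, Complex.zero_im] at him
    nlinarith

theorem hasSum_gaussCoeff (h0 : 0 < q) (h1 : q < 1) {z : ℂ} (hz : ‖z‖ < 1) :
    (Summable fun e => ‖gaussCoeff q e * z ^ e‖) ∧ ∑' e, gaussCoeff q e * z ^ e = gaussFn q z := by
  have hQ0 := pow_four_pos h0
  have hQ1 := pow_four_lt_one h0 h1
  have hz2 : ‖-z ^ 2‖ < 1 := by
    rw [norm_neg, norm_pow]; exact pow_lt_one₀ (norm_nonneg z) hz two_ne_zero
  have hinj : Function.Injective fun k : ℕ => 2 * k := fun a b h => by simpa using h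
  have hzero : ∀ e, e ∉ Set.range (fun k : ℕ => 2 * k) → gaussCoeff q e * z ^ e = 0 := fun e he => by
    rw [gaussCoeff, if_neg, zero_mul]
    rintro ⟨m, rfl⟩
    exact he ⟨m, by simp only; ring⟩
  have hterm : ∀ k, gaussCoeff q (2 * k) * z ^ (2 * k) =
      ((1 / qPoch (q ^ 4) (q ^ 4) k : ℝ) : ℂ) * (-z ^ 2) ^ k := fun k => by
    rw [gaussCoeff, if_pos (even_two_mul k), Nat.mul_div_cancel_left _ two_pos, neg_pow, pow_mul]
    ring
  constructor
  · rw [← hinj.summable_iff fun e he => by rw [hzero e he, norm_zero]]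
    refine (summable_norm_eulerSum hQ0 hQ1 hz2).congr fun k => ?_
    simp only [Function.comp, hterm]
  · have h := (summable_eulerSum hQ0 hQ1 hz2).hasSum
    have h2 : HasSum (fun e => gaussCoeff q e * z ^ e) (eulerSum (q ^ 4) (-z ^ 2)) := by
      rw [← hinj.hasSum_iff hzero]
      exact h.congr_fun fun k => hterm k
    rw [h2.tsum_eq, gaussFn]
    exact eq_inv_of_mul_eq_one_left (eulerSum_mul_eulerE hQ0 hQ1 hz2)

theorem isContinuation_gaussian (h0 : 0 < q) (h1 : q < 1) :
    IsContinuation (gaussian n q) fun z => ∏ j, gaussFn q (z j) := by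
  refine ⟨⟨1, one_pos, fun z hz => ?_⟩, {y | ∀ j, |y j| < 1}, ?_, by simp, fun z hz => ?_⟩
  · have hj := fun j => hasSum_gaussCoeff h0 h1 (hz j)
    obtain ⟨hs, ht⟩ := summable_norm_and_tsum_pi_prod (fun j e => gaussCoeff q e * z j ^ e)
      fun j => (hj j).1
    have h := hs.of_norm.hasSum
    rw [ht, Finset.prod_congr rfl fun j _ => (hj j).2] at h
    rw [← Finsupp.equivFunOnFinite.symm.hasSum_iff]
    refine h.congr_fun fun E => ?_
    simp [coeff_gaussian h0 h1, Finset.prod_mul_distrib]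
  · simp only [Set.ofPred_forall]
    exact isOpen_iInter_of_finite fun j => isOpen_lt (by fun_prop) continuous_const
  · refine Finset.analyticAt_fun_prod _ fun j _ => ?_
    exact AnalyticAt.fun_comp (g := gaussFn q) (f := fun z : Fin n → ℂ => z j)
      (analyticAt_gaussFn h0 h1 (hz j))
      ((ContinuousLinearMap.proj (R := ℂ) (φ := fun _ : Fin n => ℂ) j).analyticAt z)

/-- The continuation of `M x^E`. -/
theorem isContinuation_gaussianMonomial_mul (h0 : 0 < q) (h1 : q < 1) (a : Fin n → ℕ)
    (E : Fin n →₀ ℕ) (c : ℂ) :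
    IsContinuation (gaussianMonomial q a * monomial E c) fun z =>
      c * (q : ℂ) ^ reorder (fun i j : Fin n => if j < i then 1 else 0)
          (Finsupp.equivFunOnFinite.symm a) E *
        (∏ j, z j ^ (a j + E j)) *
        ∏ j, gaussFn q ((q ^ ∑ i ∈ Finset.Iio j, E i : ℝ) * z j) := by
  set A : Fin n →₀ ℕ := Finsupp.equivFunOnFinite.symm a with hA
  have hAa : ∀ j, A j = a j := fun j => rfl
  have hle : ∀ F : Fin n →₀ ℕ, ¬A ≤ F → coeff F (gaussianMonomial q a) = 0 := fun F hF => by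
    rw [Finsupp.le_def, not_forall] at hF
    obtain ⟨j, hj⟩ := hF
    rw [coeff_gaussianMonomial]
    exact Finset.prod_eq_zero (Finset.mem_univ j) (if_neg hj)
  have hadd : ∀ F : Fin n →₀ ℕ, coeff (A + F) (gaussianMonomial q a) = coeff F (gaussian n q) :=
    fun F => by
      rw [coeff_gaussianMonomial, coeff_gaussian h0 h1]
      refine Finset.prod_congr rfl fun j _ => ?_
      rw [Finsupp.add_apply, hAa, if_pos (Nat.le_add_right _ _), Nat.add_sub_cancel_left]
  refine (isContinuation_gaussian h0 h1).twist (A + E)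
    (c * (q : ℂ) ^ reorder (fun i j : Fin n => if j < i then 1 else 0) A E)
    (fun j => q ^ ∑ i ∈ Finset.Iio j, E i) (fun F => ?_) fun F hF => ?_
  -- Reordering x^(A+F) against x^E splits: the fixed part A gives a constant, and the part F gives
  -- the dilation of the variables.
  · rw [show A + E + F = E + (A + F) by rw [add_comm A E, add_assoc], coeff_mul_monomial_add, hadd,
      reorder_add_left, pow_add]
    have : (q : ℂ) ^ reorder (fun i j : Fin n => if j < i then 1 else 0) F E =
        ∏ j, (((q ^ ∑ i ∈ Finset.Iio j, E i : ℝ) : ℂ)) ^ F j := by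
      rw [reorder, ← Finset.prod_pow_eq_pow_sum]
      refine Finset.prod_congr rfl fun j _ => ?_
      rw [Complex.ofReal_pow, ← pow_mul, Finset.sum_mul]
      congr 1
      simp only [ite_mul, one_mul, zero_mul]
      rw [← Finset.sum_filter]
      refine Finset.sum_congr (by ext i; simp) fun i _ => mul_comm _ _
    rw [this]
    ring
  · by_cases hE : E ≤ F
    · obtain ⟨G, rfl⟩ := exists_add_of_le hE
      rw [coeff_mul_monomial_add, hle, mul_zero, zero_mul]
      intro h
      exact hF (by rw [add_comm]; exact add_le_add_right h E)
    · exact coeff_mul_monomial_of_not_le hE _ _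

end Continuation

end BraidedFourier

namespace BraidedFourier

open QSeries Filter Topology

/-! ### One-variable Gaussian integrals -/

section GaussianIntegral

variable {q : ℝ}

/-- The term of the one-variable `q²`-integral of `e_{q⁴}(-x²) x^{2m}` at `q^{2k} y`. -/
noncomputable def gaussTerm (q : ℝ) (m : ℕ) (y : ℝ) (k : ℤ) : ℝ :=
  (1 - q ^ 2) * (q ^ (2 * k) * y) ^ (2 * m + 1) * (qPochInf (-(q ^ (2 * k) * y) ^ 2) (q ^ 4))⁻¹

theorem gaussTerm_eq (q : ℝ) (m : ℕ) (y : ℝ) (k : ℤ) :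
    gaussTerm q m y k = (1 - q ^ 2) * y ^ (2 * m + 1) *
      ((q ^ (2 * (2 * m + 1))) ^ k * invPoch (q ^ 4) (y ^ 2) k) := by
  have h1 : (q ^ (2 * k) * y) ^ 2 = y ^ 2 * (q ^ 4) ^ k := by
    have h : (q ^ (2 * k)) ^ 2 = (q ^ 4) ^ k := by
      rw [← zpow_natCast, ← zpow_natCast q 4, ← zpow_mul, ← zpow_mul]
      congr 1; push_cast; ring
    rw [mul_pow, mul_comm, h]
  have h2 : (q ^ (2 * k)) ^ (2 * m + 1) = (q ^ (2 * (2 * m + 1))) ^ k := by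
    rw [← zpow_natCast, ← zpow_natCast q (2 * (2 * m + 1)), ← zpow_mul, ← zpow_mul]
    congr 1; push_cast; ring
  rw [gaussTerm, invPoch, h1, mul_pow, h2]
  ring

theorem gaussTerm_shift (h0 : 0 < q) (m : ℕ) (y : ℝ) (t k : ℤ) :
    gaussTerm q m (q ^ (2 * t) * y) k = gaussTerm q m y (k + t) := by
  rw [gaussTerm, gaussTerm, ← mul_assoc, ← zpow_add₀ h0.ne', mul_add]

theorem pow_odd_lt_one (h0 : 0 < q) (h1 : q < 1) (m : ℕ) : q ^ (2 * (2 * m + 1)) < 1 :=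
  pow_lt_one₀ h0.le h1 (by lia)

theorem summable_gaussTerm (h0 : 0 < q) (h1 : q < 1) (m : ℕ) {y : ℝ} (hy : y ≠ 0) :
    Summable (gaussTerm q m y) := by
  simp only [funext (gaussTerm_eq q m y)]
  exact (summable_zpow_mul_invPoch (pow_four_pos h0) (pow_four_lt_one h0 h1) (by positivity)
    (by positivity) (pow_odd_lt_one h0 h1 m)).mul_left _

/-- Iterate the contiguity relation from z = q². The powers of q accumulate through ∑_{j<m} (4j+2) =
2m². -/
theorem bilateralSum_pow_odd (h0 : 0 < q) (h1 : q < 1) {c : ℝ} (hc : 0 < c) (m : ℕ) :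
    c ^ m * bilateralSum (q ^ 4) c (q ^ (2 * (2 * m + 1))) =
      (q ^ (2 * m ^ 2))⁻¹ * qPoch (q ^ 2) (q ^ 4) m * bilateralSum (q ^ 4) c (q ^ 2) := by
  induction m with
  | zero => simp
  | succ m ih =>
    have hz : 0 < q ^ (2 * (2 * m + 1)) := by positivity
    have h := bilateralSum_mul (pow_four_pos h0) (pow_four_lt_one h0 h1) hc hz
      (pow_odd_lt_one h0 h1 m)
    rw [← pow_add, show 4 + 2 * (2 * m + 1) = 2 * (2 * (m + 1) + 1) by ring] at h
    rw [pow_succ, mul_assoc, h, mul_left_comm, ih, qPoch_succ]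
    have e1 : q ^ 2 * (q ^ 4) ^ m = q ^ (2 * (2 * m + 1)) := by
      rw [← pow_mul, ← pow_add]; congr 1; ring
    have e2 : q ^ (2 * (m + 1) ^ 2) = q ^ (2 * m ^ 2) * q ^ (2 * (2 * m + 1)) := by
      rw [← pow_add]; congr 1; ring
    rw [e1, e2]
    field_simp

theorem cConst_eq (h0 : 0 < q) (h1 : q < 1) {y : ℝ} (hy : y ≠ 0) :
    2 * (1 - q ^ 2) * y * bilateralSum (q ^ 4) (y ^ 2) (q ^ 2) = cConst (q ^ 2) y := by
  rw [bilateralSum_eq (pow_four_pos h0) (pow_four_lt_one h0 h1) (by positivity) (by positivity)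
    (pow_lt_one₀ h0.le h1 two_ne_zero), cConst]
  have e1 : (q ^ 2) ^ 2 = q ^ 4 := by ring
  have e2 : -q ^ 2 * y ^ 2 = -(y ^ 2 * q ^ 2) := by ring
  have e3 : -q ^ 2 / y ^ 2 = -(q ^ 4 / (y ^ 2 * q ^ 2)) := by field_simp
  have e4 : -(q ^ 2) ^ 2 / y ^ 2 = -(q ^ 4 / y ^ 2) := by rw [e1]; ring
  rw [e2, e3, e4, e1, ← mul_div_assoc]

theorem tsum_gaussTerm (h0 : 0 < q) (h1 : q < 1) (m : ℕ) {y : ℝ} (hy : y ≠ 0) :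
    2 * ∑' k, gaussTerm q m y k =
      (q ^ (2 * m ^ 2))⁻¹ * qPoch (q ^ 2) (q ^ 4) m * cConst (q ^ 2) y := by
  have h := bilateralSum_pow_odd h0 h1 (c := y ^ 2) (by positivity) m
  rw [← cConst_eq h0 h1 hy, tsum_congr (gaussTerm_eq q m y), tsum_mul_left, ← bilateralSum]
  rw [← pow_mul] at h
  linear_combination 2 * (1 - q ^ 2) * y * h

/-- The constant is a sum over the lattice y q^(2ℤ), which is unchanged when y is multiplied by a
power of q²; no manipulation of the infinite products is needed. -/
theorem cConst_shift (h0 : 0 < q) (h1 : q < 1) {y : ℝ} (hy : y ≠ 0) (t : ℤ) :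
    cConst (q ^ 2) (q ^ (2 * t) * y) = cConst (q ^ 2) y := by
  have hy' : q ^ (2 * t) * y ≠ 0 := mul_ne_zero (zpow_ne_zero _ h0.ne') hy
  have h := tsum_gaussTerm h0 h1 0 hy
  have h' := tsum_gaussTerm h0 h1 0 hy'
  simp only [gaussTerm_shift h0] at h'
  have hs : ∑' k, gaussTerm q 0 y (k + t) = ∑' k, gaussTerm q 0 y k :=
    (Equiv.addRight t).tsum_eq (gaussTerm q 0 y)
  rw [hs, h] at h'
  simpa using h'.symm

theorem cConst_zpow_congr (h0 : 0 < q) (h1 : q < 1) {y : ℝ} (hy : y ≠ 0) {r s : ℤ}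
    (h : Even (r - s)) : cConst (q ^ 2) (q ^ r * y) = cConst (q ^ 2) (q ^ s * y) := by
  obtain ⟨t, ht⟩ := h
  rw [← cConst_shift h0 h1 (mul_ne_zero (zpow_ne_zero s h0.ne') hy) t, ← mul_assoc,
    ← zpow_add₀ h0.ne']
  congr 3; lia

/-- The term of the one-variable integral of `x^{2m} e_{q⁴}(-(l x)²)` at `ε q^{2k} y`. -/
noncomputable def integrand (q : ℝ) (m : ℕ) (l y : ℝ) (k : ℤ) (ε : ℤˣ) : ℂ :=
  (((1 - q ^ 2) * (q ^ (2 * k) * y) : ℝ) : ℂ) *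
    ((((ε : ℤ) : ℝ) * (q ^ (2 * k) * y) : ℝ) : ℂ) ^ (2 * m) *
    gaussFn q (l * (((ε : ℤ) : ℝ) * (q ^ (2 * k) * y) : ℝ))

/-- The function integrated is even, so ε drops out; the substitution x ↦ lx produces the factor
l^(-(2m+1)). -/
theorem integrand_eq (h0 : 0 < q) (h1 : q < 1) (m : ℕ) {l : ℝ} (hl : l ≠ 0) (y : ℝ) (k : ℤ)
    (ε : ℤˣ) :
    integrand q m l y k ε = (((l ^ (2 * m + 1))⁻¹ * gaussTerm q m (l * y) k : ℝ) : ℂ) := by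
  have hε : (((ε : ℤ) : ℝ)) ^ 2 = 1 := by
    rcases Int.units_eq_one_or ε with rfl | rfl <;> simp
  have e1 : -(l * (((ε : ℤ) : ℝ) * (q ^ (2 * k) * y))) ^ 2 = -(q ^ (2 * k) * (l * y)) ^ 2 := by
    linear_combination -(l ^ 2 * (q ^ (2 * k) * y) ^ 2) * hε
  have e2 : (((ε : ℤ) : ℝ) * (q ^ (2 * k) * y)) ^ (2 * m) = (q ^ (2 * k) * y) ^ (2 * m) := by
    rw [mul_pow, pow_mul, hε, one_pow, one_mul]
  rw [integrand, ← Complex.ofReal_mul, gaussFn_ofReal h0 h1, ← Complex.ofReal_pow,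
    ← Complex.ofReal_mul, ← Complex.ofReal_mul, e1, e2, gaussTerm]
  congr 1
  rw [show q ^ (2 * k) * (l * y) = l * (q ^ (2 * k) * y) by ring, mul_pow l _ (2 * m + 1),
    pow_succ (q ^ (2 * k) * y) (2 * m)]
  field_simp

theorem summable_integrand (h0 : 0 < q) (h1 : q < 1) (m : ℕ) {l y : ℝ} (hl : l ≠ 0) (hy : y ≠ 0) :
    Summable fun k : ℤ × ℤˣ => ‖integrand q m l y k.1 k.2‖ := by
  simp only [integrand_eq h0 h1 m hl]
  have hs := (summable_gaussTerm h0 h1 m (mul_ne_zero hl hy)).mul_left (l ^ (2 * m + 1))⁻¹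
  have h := hs.norm.mul_of_nonneg (Summable.of_finite (f := fun _ : ℤˣ => (1 : ℝ)))
    (fun _ => norm_nonneg _) fun _ => zero_le_one
  refine h.congr fun k => ?_
  rw [mul_one, Complex.norm_real]

theorem tsum_integrand (h0 : 0 < q) (h1 : q < 1) (m : ℕ) {l y : ℝ} (hl : l ≠ 0) (hy : y ≠ 0) :
    ∑' k : ℤ × ℤˣ, integrand q m l y k.1 k.2 =
      (((l ^ (2 * m + 1))⁻¹ * ((q ^ (2 * m ^ 2))⁻¹ * qPoch (q ^ 2) (q ^ 4) m *
        cConst (q ^ 2) (l * y)) : ℝ) : ℂ) := by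
  rw [(summable_integrand h0 h1 m hl hy).of_norm.tsum_prod]
  simp only [integrand_eq h0 h1 m hl, tsum_const, Nat.card_eq_fintype_card]
  rw [← tsum_gaussTerm h0 h1 m (mul_ne_zero hl hy)]
  simp only [Fintype.card_units_int, nsmul_eq_mul]
  rw [tsum_mul_left, ← Complex.ofReal_tsum, tsum_mul_left]
  push_cast
  ring

end GaussianIntegral

/-! ### The braided Fourier transform of the Gaussian monomials -/

section Transform

variable {n : ℕ} {q : ℝ}

/-- The average over signs factors into (1 + (-1)^(e_j))/2. -/
theorem coeff_evenPart (f : Covec n q) (E : Fin n →₀ ℕ) :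
    coeff E (evenPart f) = if ∀ j, Even (E j) then coeff E f else 0 := by
  have hsum : ∑ ε : Fin n → ℤˣ, ∏ j, ((((ε j : ℤˣ) : ℤ) : ℂ)) ^ E j =
      ∏ j, ((1 : ℂ) ^ E j + (-1) ^ E j) := by
    have h := Finset.prod_univ_sum (fun _ : Fin n => (Finset.univ : Finset ℤˣ))
      fun j e => (((e : ℤ) : ℂ)) ^ E j
    rw [Fintype.piFinset_univ] at h
    rw [← h]
    refine Finset.prod_congr rfl fun j _ => ?_
    simp [UnitsInt.univ, Finset.sum_pair (show (1 : ℤˣ) ≠ -1 by decide)]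
  rw [evenPart, coeff_smul, coeff_sum]
  simp only [rescale, coeff_mk]
  rw [← Finset.sum_mul, hsum]
  split_ifs with h
  · have : ∀ j, (1 : ℂ) ^ E j + (-1) ^ E j = 2 := fun j => by
      rw [one_pow, (h j).neg_one_pow]; norm_num
    rw [Finset.prod_congr rfl fun j _ => this j]
    simp
  · push Not at h
    obtain ⟨j, hj⟩ := h
    rw [Finset.prod_eq_zero (Finset.mem_univ j)]
    · simp
    · rw [one_pow, (Nat.not_even_iff_odd.1 hj).neg_one_pow]; norm_num

/-- All monomials of M x^E share one parity vector, that of A + E, because the Gaussian factors are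
even. The even projection is therefore all or nothing. -/
theorem even_of_coeff_ne_zero {a : Fin n → ℕ} {E F : Fin n →₀ ℕ} {c : ℂ}
    (h : coeff F (gaussianMonomial q a * monomial E c) ≠ 0) (j : Fin n) :
    Even (F j) ↔ Even (a j + E j) := by
  by_cases hE : E ≤ F
  · obtain ⟨G, rfl⟩ := exists_add_of_le hE
    rw [coeff_mul_monomial_add] at h
    have h2 := right_ne_zero_of_mul (left_ne_zero_of_mul h)
    rw [coeff_gaussianMonomial] at h2
    have h3 := Finset.prod_ne_zero_iff.1 h2 j (Finset.mem_univ j)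
    split_ifs at h3 with h4
    · have h5 : Even (G j - a j) := by
        by_contra h6
        exact h3 (if_neg h6)
      obtain ⟨m, hm⟩ := h5
      rw [Finsupp.add_apply, show G j = a j + (m + m) by lia]
      grind
    · exact (h3 rfl).elim
  · exact (h (coeff_mul_monomial_of_not_le hE _ _)).elim

theorem evenPart_gaussianMonomial_mul (a : Fin n → ℕ) (E : Fin n →₀ ℕ) (c : ℂ) :
    evenPart (gaussianMonomial q a * monomial E c) =
      if ∀ j, Even (a j + E j) then gaussianMonomial q a * monomial E c else 0 := by
  ext F
  rw [coeff_evenPart]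
  by_cases h : coeff F (gaussianMonomial q a * monomial E c) = 0
  · rw [h, ite_self]
    split_ifs <;> simp [h]
  · simp only [even_of_coeff_ne_zero h]
    split_ifs <;> simp

theorem value_zero (z : Fin n → ℝ) : value (0 : Covec n q) z = 0 :=
  isContinuation_zero.value_eq z

theorem isIntegrable_zero : IsIntegrable (0 : Covec n q) :=
  ⟨⟨0, isContinuation_zero⟩, fun z _ => by simp [value_zero, summable_zero]⟩

/-- Integrability of series whose continuation is a Gaussian times an even monomial. -/
theorem isIntegrable_of_isContinuation (h0 : 0 < q) (h1 : q < 1) {f : Covec n q} (C : ℂ)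
    (m : Fin n → ℕ) (l : Fin n → ℝ) (hl : ∀ j, l j ≠ 0)
    (hf : IsContinuation f fun z => C * (∏ j, z j ^ (2 * m j)) * ∏ j, gaussFn q (l j * z j)) :
    IsIntegrable f := by
  refine ⟨⟨_, hf⟩, fun z hz => ?_⟩
  have h := (summable_norm_prod_pair (fun j => integrand q (m j) (l j) (z j))
    fun j => summable_integrand h0 h1 (m j) (hl j) (hz j)).1
  refine (h.mul_left (‖C‖ * ((1 - q ^ 2) ^ n)⁻¹)).congr fun p => ?_
  have hq2 : 0 < 1 - q ^ 2 := sub_pos.2 (pow_lt_one₀ h0.le h1 two_ne_zero)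
  rw [hf.value_eq]
  have hprod : ∏ j, integrand q (m j) (l j) (z j) (p.1 j) (p.2 j) =
      (∏ j, (((1 - q ^ 2) * (q ^ (2 * p.1 j) * z j) : ℝ) : ℂ)) *
        ((∏ j, ((((p.2 j : ℤ) : ℝ) * q ^ (2 * p.1 j) * z j : ℝ) : ℂ) ^ (2 * m j)) *
        ∏ j, gaussFn q (l j * (((p.2 j : ℤ) : ℝ) * q ^ (2 * p.1 j) * z j : ℝ))) := by
    simp only [integrand, ← Finset.prod_mul_distrib, mul_assoc]
  have hnorm : ‖∏ j, (((1 - q ^ 2) * (q ^ (2 * p.1 j) * z j) : ℝ) : ℂ)‖ =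
      (1 - q ^ 2) ^ n * (q ^ (2 * ∑ j, p.1 j) * ∏ j, |z j|) := by
    have hs : q ^ (2 * ∑ j, p.1 j) = ∏ j, q ^ (2 * p.1 j) := by
      have h := prod_zpow_eq_zpow_sum Finset.univ (Complex.ofReal_ne_zero.2 h0.ne')
        fun j => 2 * p.1 j
      rw [← Finset.mul_sum] at h
      exact_mod_cast h.symm
    rw [hs, ← Finset.prod_mul_distrib, norm_prod]
    simp only [Complex.norm_real, norm_mul, Real.norm_eq_abs, abs_of_pos hq2,
      abs_of_pos (zpow_pos h0 _)]
    rw [Finset.prod_mul_distrib, Finset.prod_const, Finset.card_univ, Fintype.card_fin]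
  rw [hprod, norm_mul, hnorm, mul_assoc C, norm_mul C]
  field_simp

theorem isContinuation_gaussianMonomial_mul_of_even (h0 : 0 < q) (h1 : q < 1) {a : Fin n → ℕ}
    {E : Fin n →₀ ℕ} {m : Fin n → ℕ} (hm : ∀ j, a j + E j = 2 * m j) (c : ℂ) :
    IsContinuation (gaussianMonomial q a * monomial E c) fun z =>
      c * (q : ℂ) ^ reorder (fun i j : Fin n => if j < i then 1 else 0)
          (Finsupp.equivFunOnFinite.symm a) E *
        (∏ j, z j ^ (2 * m j)) *
        ∏ j, gaussFn q ((q ^ ∑ i ∈ Finset.Iio j, E i : ℝ) * z j) := by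
  simpa only [hm] using isContinuation_gaussianMonomial_mul h0 h1 a E c

theorem isClassR_gaussianMonomial (h0 : 0 < q) (h1 : q < 1) (a : Fin n → ℕ) :
    IsClassR (gaussianMonomial q a) := by
  intro E
  rw [evenPart_gaussianMonomial_mul]
  split_ifs with h
  · choose m hm using fun j => (h j).two_dvd
    exact isIntegrable_of_isContinuation h0 h1 _ m _ (fun j => pow_ne_zero _ h0.ne')
      (isContinuation_gaussianMonomial_mul_of_even h0 h1 hm 1)
  · exact isIntegrable_zero

theorem isContinuation_gaussian' (h0 : 0 < q) (h1 : q < 1) :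
    IsContinuation (gaussian n q) fun z =>
      1 * (∏ j, z j ^ (2 * 0)) * ∏ j, gaussFn q (((1 : ℝ) : ℂ) * z j) := by
  simpa using isContinuation_gaussian (n := n) h0 h1

theorem isIntegrable_gaussian (h0 : 0 < q) (h1 : q < 1) : IsIntegrable (gaussian n q) :=
  isIntegrable_of_isContinuation h0 h1 1 (fun _ => 0) (fun _ => 1) (fun _ => one_ne_zero)
    (isContinuation_gaussian' h0 h1)

/-- Shifted integrals of series whose continuation is a Gaussian times an even monomial. -/
theorem shiftedIntegral_eq (h0 : 0 < q) (h1 : q < 1) {f : Covec n q} (C : ℂ)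
    (m : Fin n → ℕ) (l : Fin n → ℝ) (hl : ∀ j, l j ≠ 0)
    (hf : IsContinuation f fun z => C * (∏ j, z j ^ (2 * m j)) * ∏ j, gaussFn q (l j * z j))
    (s : Fin n → ℕ) {γ : Fin n → ℝ} (hγ : ∀ j, γ j ≠ 0) :
    (Summable fun p => ‖value (integralTerm s p f) γ‖) ∧
    shiftedIntegral s f γ = C * ∏ j, ((((l j) ^ (2 * m j + 1))⁻¹ * ((q ^ (2 * m j ^ 2))⁻¹ *
      qPoch (q ^ 2) (q ^ 4) (m j) *
        cConst (q ^ 2) (l j * (q ^ ((s j : ℤ) - (n - 1 - (j : ℕ) : ℕ)) * γ j))) : ℝ) : ℂ) := by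
  have hy : ∀ j, q ^ ((s j : ℤ) - (n - 1 - (j : ℕ) : ℕ)) * γ j ≠ 0 := fun j =>
    mul_ne_zero (zpow_ne_zero _ h0.ne') (hγ j)
  obtain ⟨hs, ht⟩ := summable_norm_prod_pair
    (fun j => integrand q (m j) (l j) (q ^ ((s j : ℤ) - (n - 1 - (j : ℕ) : ℕ)) * γ j))
    fun j => summable_integrand h0 h1 (m j) (hl j) (hy j)
  have hval : ∀ p, value (integralTerm s p f) γ = C * ∏ j, integrand q (m j) (l j)
      (q ^ ((s j : ℤ) - (n - 1 - (j : ℕ) : ℕ)) * γ j) (p.1 j) (p.2 j) := fun p => by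
    rw [hf.value_integralTerm h0.ne']
    simp only [integrand, Finset.prod_mul_distrib]
    ring
  constructor
  · refine (hs.mul_left ‖C‖).congr fun p => ?_
    rw [hval, norm_mul]
  · rw [shiftedIntegral, tsum_congr hval, tsum_mul_left, ht]
    congr 1
    exact Finset.prod_congr rfl fun j _ => tsum_integrand h0 h1 (m j) (hl j) (hy j)

/-- Shows that the dilation exponent ∑_{i<j} e_i agrees with B_j modulo 2, so that the constants do
not depend on E. -/
theorem even_parityShift_add (a : Fin n → ℕ) (E : Fin n →₀ ℕ) (h : ∀ j, Even (a j + E j))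
    (j : Fin n) : Even (parityShift a j + ∑ i ∈ Finset.Iio j, E i) := by
  rw [parityShift, ← Finset.sum_add_distrib]
  refine Finset.even_sum _ fun i _ => ?_
  have := h i
  grind

theorem shiftedIntegral_gaussian (h0 : 0 < q) (h1 : q < 1) (s : Fin n → ℕ) {γ : Fin n → ℝ}
    (hγ : ∀ j, γ j ≠ 0) :
    (Summable fun p => ‖value (integralTerm s p (gaussian n q)) γ‖) ∧
    shiftedIntegral s (gaussian n q) γ =
      ∏ j : Fin n, (cConst (q ^ 2) (q ^ (n - 1 - (j : ℕ) + s j) * γ j) : ℂ) := by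
  obtain ⟨h, h'⟩ := shiftedIntegral_eq h0 h1 1 (fun _ => 0) (fun _ => 1) (fun _ => one_ne_zero)
    (isContinuation_gaussian' h0 h1) s hγ
  refine ⟨h, ?_⟩
  rw [h', one_mul]
  refine Finset.prod_congr rfl fun j _ => ?_
  -- The integral naturally gives the exponent s_j - (n-1-j); it differs from the stated one by the
  -- even number 2(n-1-j).
  rw [← zpow_natCast q (n - 1 - (j : ℕ) + s j), cConst_zpow_congr h0 h1 (hγ j)
    (r := ((n - 1 - (j : ℕ) + s j : ℕ) : ℤ)) (s := (s j : ℤ) - (n - 1 - (j : ℕ) : ℕ))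
    ⟨((n - 1 - (j : ℕ) : ℕ) : ℤ), by push_cast; ring⟩]
  simp

/-! ### Exponent identities and assembly of the transform. -/

theorem qFact_eq (h1 : q < 1) (h0 : 0 < q) (m : ℕ) :
    qFact (q ^ 2) m = qPoch (q ^ 2) (q ^ 2) m / (1 - q ^ 2) ^ m := by
  have hq2 : 1 - q ^ 2 ≠ 0 := (sub_pos.2 (pow_lt_one₀ h0.le h1 two_ne_zero)).ne'
  have hq2' : q ^ 2 - 1 ≠ 0 := sub_ne_zero.2 (sub_ne_zero.1 hq2).symm
  induction m with
  | zero => simp [qFact]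
  | succ m ih =>
    rw [qFact, Finset.prod_range_succ, ← qFact, ih, qPoch_self_succ, pow_succ (1 - q ^ 2)]
    field_simp
    ring

theorem sum_Iio_eq_sum_ite (E : Fin n → ℕ) (j : Fin n) :
    ∑ i ∈ Finset.Iio j, E i = ∑ i, if i < j then E i else 0 := by
  rw [← Finset.sum_filter]
  exact Finset.sum_congr (by ext i; simp) fun _ _ => rfl

theorem crossExp_vec (E : Fin n →₀ ℕ) :
    crossExp (fun i j => if i < j then 1 else 0) E = ∑ j, (∑ i ∈ Finset.Iio j, E i) * E j := by
  rw [crossExp, Finset.sum_comm]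
  refine Finset.sum_congr rfl fun j _ => ?_
  rw [sum_Iio_eq_sum_ite, Finset.sum_mul]
  refine Finset.sum_congr rfl fun i _ => ?_
  split_ifs <;> simp

theorem sum_sq_eq (E : Fin n → ℕ) :
    (∑ j, E j) ^ 2 = ∑ j, E j ^ 2 + 2 * ∑ j, (∑ i ∈ Finset.Iio j, E i) * E j := by
  have hsplit : ∑ i, ∑ j, E i * E j = ∑ j, E j ^ 2 + (∑ j, (∑ i ∈ Finset.Iio j, E i) * E j +
      ∑ j, (∑ i ∈ Finset.Iio j, E i) * E j) := by
    have h1 : ∑ j, (∑ i ∈ Finset.Iio j, E i) * E j =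
        ∑ i, ∑ j, if j < i then E i * E j else 0 :=
      Finset.sum_congr rfl fun j _ => by
        rw [sum_Iio_eq_sum_ite, Finset.sum_mul]
        exact Finset.sum_congr rfl fun i _ => by rw [ite_mul, zero_mul, mul_comm (E i)]
    have h2 : ∑ j, (∑ i ∈ Finset.Iio j, E i) * E j =
        ∑ i, ∑ j, if i < j then E i * E j else 0 := by
      rw [h1, Finset.sum_comm]
      exact Finset.sum_congr rfl fun i _ => Finset.sum_congr rfl fun j _ => by rw [mul_comm]
    have h3 : ∑ j, E j ^ 2 = ∑ i, ∑ j, if i = j then E i * E j else 0 :=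
      Finset.sum_congr rfl fun i _ => by rw [Finset.sum_ite_eq]; simp [sq]
    conv_rhs => rw [h3]; enter [2]; rw [h1]; enter [1]; rw [← h1, h2]
    simp only [← Finset.sum_add_distrib]
    refine Finset.sum_congr rfl fun i _ => Finset.sum_congr rfl fun j _ => ?_
    rcases lt_trichotomy i j with h | h | h
    · simp [h, h.ne, h.not_gt]
    · simp [h]
    · simp [h, h.ne', h.not_gt]
  rw [sq, Finset.sum_mul_sum, hsplit]
  ring

/-- Counting how many later indices see e_j. The powers q^(n-1-j) in the c_j are there to cancel the
factors q^(-S_j) from the dilations. -/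
theorem sum_sum_Iio (E : Fin n → ℕ) :
    ∑ j, ∑ i ∈ Finset.Iio j, E i = ∑ j : Fin n, (n - 1 - (j : ℕ)) * E j := by
  simp only [sum_Iio_eq_sum_ite]
  rw [Finset.sum_comm]
  refine Finset.sum_congr rfl fun i _ => ?_
  rw [← Finset.sum_filter, Finset.sum_const, smul_eq_mul, ← Fin.card_Ioi]
  congr 2
  ext j; simp

theorem integral_zero (hq : q ≠ 0) (γ : Fin n → ℝ) : integral (0 : Covec n q) γ = 0 := by
  have h : ∀ p, value (integralTerm 0 p (0 : Covec n q)) γ = 0 := fun p => by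
    rw [isContinuation_zero.value_integralTerm hq, Pi.zero_apply, mul_zero]
  rw [integral, shiftedIntegral, tsum_congr h, tsum_zero]

/-- The one-variable integrals give the factors depending on a single j; what remains is to collect
the powers of q and the signs, the antipode's (-1)^|E| turning each i^(e_j) into (-i)^(e_j). -/
theorem coeff_fourierS (h0 : 0 < q) (h1 : q < 1) (a : Fin n → ℕ) {γ : Fin n → ℝ}
    (hγ : ∀ j, γ j ≠ 0) (E : Fin n →₀ ℕ) :
    coeff E (fourierS (gaussianMonomial q a) γ) =
      (q : ℂ) ^ crossExp (fun i j => if i < j then 1 else 0) E *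
        ∏ j : Fin n, ((cConst (q ^ 2) (q ^ (n - 1 - (j : ℕ) + parityShift a j) * γ j) : ℂ) *
          PowerSeries.coeff (E j) (transformSeries q (a j))) := by
  rw [fourierS, antipode, coeff_mk, coeff_mk, expElement, evenPart_gaussianMonomial_mul]
  split_ifs with h
  · choose m hm using fun j => (h j).two_dvd
    have hint := (shiftedIntegral_eq h0 h1 _ m _ (fun j => pow_ne_zero _ h0.ne')
      (isContinuation_gaussianMonomial_mul_of_even h0 h1 hm
        (∏ j : Fin n, (Complex.I * (q : ℂ) ^ 2 / (1 - (q : ℂ) ^ 2) * (q : ℂ) ^ (n - 1 - (j : ℕ))) ^ E j /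
          ((qFact (q ^ 2) (E j) : ℝ) : ℂ))) 0 hγ).2
    rw [integral, hint]
    have hc : ∀ j : Fin n, cConst (q ^ 2) (q ^ (∑ i ∈ Finset.Iio j, E i) *
        (q ^ (((0 : Fin n → ℕ) j : ℤ) - (n - 1 - (j : ℕ) : ℕ)) * γ j)) =
        cConst (q ^ 2) (q ^ (n - 1 - (j : ℕ) + parityShift a j) * γ j) := fun j => by
      rw [← mul_assoc, ← zpow_natCast q (∑ i ∈ Finset.Iio j, E i), ← zpow_add₀ h0.ne',
        ← zpow_natCast q (n - 1 - (j : ℕ) + parityShift a j)]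
      refine cConst_zpow_congr h0 h1 (hγ j) ?_
      have hev := even_parityShift_add a E h j
      rw [Pi.zero_apply]
      obtain ⟨t, ht⟩ := hev
      exact ⟨t - parityShift a j - (n - 1 - (j : ℕ) : ℕ), by
        rw [show ∑ i ∈ Finset.Iio j, E i = t + t - parityShift a j by lia]
        push_cast [show parityShift a j ≤ t + t by lia]
        ring⟩
    have hqC : (q : ℂ) ≠ 0 := Complex.ofReal_ne_zero.2 h0.ne'
    have hq2 : (1 : ℂ) - (q : ℂ) ^ 2 ≠ 0 := by
      exact_mod_cast (sub_pos.2 (pow_lt_one₀ h0.le h1 two_ne_zero)).ne'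
    have hp : ∀ j, ((qPoch (q ^ 2) (q ^ 2) (E j) : ℝ) : ℂ) ≠ 0 := fun j => by
      exact_mod_cast (qPoch_self_pos (by positivity) (pow_lt_one₀ h0.le h1 two_ne_zero) _).ne'
    set S : Fin n → ℕ := fun j => ∑ i ∈ Finset.Iio j, E i with hS
    have hfac : ∀ j : Fin n, (Complex.I * (q : ℂ) ^ 2 / (1 - (q : ℂ) ^ 2) *
        (q : ℂ) ^ (n - 1 - (j : ℕ))) ^ E j / ((qFact (q ^ 2) (E j) : ℝ) : ℂ) =
        (-1) ^ E j * ((q : ℂ) ^ (2 * E j + (n - 1 - (j : ℕ)) * E j) *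
          ((-Complex.I) ^ E j / (qPoch (q ^ 2) (q ^ 2) (E j) : ℝ))) := fun j => by
      have := hp j
      rw [qFact_eq h1 h0, pow_add, pow_mul, pow_mul, neg_pow Complex.I, mul_pow, div_pow, mul_pow]
      push_cast at this ⊢
      have h1 : ((-1 : ℂ) ^ E j) * (-1) ^ E j = 1 := by rw [← mul_pow]; simp
      field_simp
      linear_combination -h1
    have hrhs : ∀ j, PowerSeries.coeff (E j) (transformSeries q (a j)) =
        (q : ℂ) ^ (E j ^ 2 + E j) * (((-Complex.I) ^ E j / (qPoch (q ^ 2) (q ^ 2) (E j) : ℝ)) *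
          (((q : ℂ) ^ (2 * m j ^ 2))⁻¹ * (qPoch (q ^ 2) (q ^ 4) (m j) : ℝ))) := fun j => by
      have hm' : E j + a j = 2 * m j := by rw [← hm]; ring
      rw [transformSeries, PowerSeries.coeff_mk, if_pos (hm' ▸ even_two_mul _), hm',
        show (2 * m j) ^ 2 / 2 = 2 * m j ^ 2 by
          rw [show (2 * m j) ^ 2 = 2 * (2 * m j ^ 2) by ring, Nat.mul_div_cancel_left _ two_pos],
        Nat.mul_div_cancel_left _ two_pos]
      push_cast
      ring
    have hreorder : reorder (fun i j : Fin n => if j < i then 1 else 0)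
        (Finsupp.equivFunOnFinite.symm a) E = ∑ j, a j * S j := by
      rw [reorder]
      refine Finset.sum_congr rfl fun j _ => ?_
      rw [hS]
      simp only [sum_Iio_eq_sum_ite, Finset.mul_sum]
      refine Finset.sum_congr rfl fun i _ => ?_
      split_ifs <;> simp
    -- On the left stand the antipode, the c_j and the reordering of x^A against x^E; on the right
    -- the reordering of the ∂'s, the series and the dilation factors. The square of |E| supplies
    -- the cross term twice: one copy is kept, the other cancels against ∑ S_j e_j.
    have hexp : (∑ j, E j) * (∑ j, E j - 1) + ∑ j : Fin n, (2 * E j + (n - 1 - (j : ℕ)) * E j) +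
        ∑ j, a j * S j = crossExp (fun i j => if i < j then 1 else 0) E +
          ∑ j, (E j ^ 2 + E j) + ∑ j, S j * (2 * m j + 1) := by
      have e1 := sum_sq_eq E
      have e2 := sum_sum_Iio E
      have e3 : (∑ j, E j) * (∑ j, E j - 1) + ∑ j, E j = (∑ j, E j) ^ 2 := by
        generalize ∑ j, E j = N
        rcases N with - | N
        · rfl
        · rw [Nat.add_sub_cancel]; ring
      have e4 : ∑ j, S j * (2 * m j + 1) = ∑ j, a j * S j + ∑ j, S j * E j + ∑ j, S j := by
        rw [← Finset.sum_add_distrib, ← Finset.sum_add_distrib]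
        exact Finset.sum_congr rfl fun j _ => by rw [← hm]; ring
      rw [crossExp_vec, e4]
      simp only [Finset.sum_add_distrib, ← Finset.mul_sum]
      simp only [hS] at e1 e2 ⊢
      lia
    have hpow : (q : ℂ) ^ ((∑ j, E j) * (∑ j, E j - 1)) *
        (∏ j : Fin n, (q : ℂ) ^ (2 * E j + (n - 1 - (j : ℕ)) * E j)) * (q : ℂ) ^ (∑ j, a j * S j) *
        ∏ j, ((q : ℂ) ^ (S j * (2 * m j + 1)))⁻¹ =
        (q : ℂ) ^ crossExp (fun i j => if i < j then 1 else 0) E *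
          ∏ j, (q : ℂ) ^ (E j ^ 2 + E j) := by
      rw [Finset.prod_inv_distrib, Finset.prod_pow_eq_pow_sum, Finset.prod_pow_eq_pow_sum,
        Finset.prod_pow_eq_pow_sum, mul_inv_eq_iff_eq_mul₀ (pow_ne_zero _ hqC), ← pow_add, ← pow_add,
        hexp, pow_add, pow_add]
    have hsign : (-1 : ℂ) ^ (∑ j, E j) * ∏ j, (-1 : ℂ) ^ E j = 1 := by
      rw [Finset.prod_pow_eq_pow_sum, ← mul_pow]; simp
    simp only [hc, hfac, hrhs, hreorder, Finset.prod_mul_distrib]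
    push_cast
    simp only [← pow_mul, Finset.prod_mul_distrib]
    simp only [hS] at hpow ⊢
    set G : ℂ := (∏ j, (-Complex.I) ^ E j / ((qPoch (q ^ 2) (q ^ 2) (E j) : ℝ) : ℂ)) *
      (∏ j, ((q : ℂ) ^ (2 * m j ^ 2))⁻¹) * (∏ j, ((qPoch (q ^ 2) (q ^ 4) (m j) : ℝ) : ℂ)) *
      ∏ j : Fin n, (cConst (q ^ 2) (q ^ (n - 1 - (j : ℕ) + parityShift a j) * γ j) : ℂ) with hG
    calc _ = ((-1 : ℂ) ^ (∑ j, E j) * ∏ j, (-1 : ℂ) ^ E j) *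
        ((q : ℂ) ^ ((∑ j, E j) * (∑ j, E j - 1)) *
          (∏ j : Fin n, (q : ℂ) ^ (2 * E j + (n - 1 - (j : ℕ)) * E j)) *
          (q : ℂ) ^ (∑ j, a j * ∑ i ∈ Finset.Iio j, E i) *
          ∏ j, ((q : ℂ) ^ ((∑ i ∈ Finset.Iio j, E i) * (2 * m j + 1)))⁻¹) * G := by rw [hG]; ring
      _ = _ := by rw [hsign, hpow, hG]; ring
  · rw [integral_zero h0.ne', mul_zero]
    push Not at h
    obtain ⟨j, hj⟩ := h
    rw [Finset.prod_eq_zero (Finset.mem_univ j), mul_zero]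
    rw [transformSeries, PowerSeries.coeff_mk, if_neg (by rwa [add_comm]), mul_zero]

theorem fourierS_gaussianMonomial (h0 : 0 < q) (h1 : q < 1) (a : Fin n → ℕ) {γ : Fin n → ℝ}
    (hγ : ∀ j, γ j ≠ 0) :
    fourierS (gaussianMonomial q a) γ =
      (List.ofFn fun j : Fin n =>
        (cConst (q ^ 2) (q ^ (n - 1 - (j : ℕ) + parityShift a j) * γ j) : ℂ) •
          subst (transformSeries q (a j)) (X j : Vec n q)).prod := by
  ext E
  rw [coeff_fourierS h0 h1 a hγ, coeff_prod_subst_transformSeries]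

theorem fourierS_eq_smul_hermiteGaussian (h0 : 0 < q) (h1 : q < 1) (a : Fin n → ℕ)
    {γ : Fin n → ℝ} (hγ : ∀ j, γ j ≠ 0) :
    fourierS (gaussianMonomial q a) γ =
      (∏ j : Fin n, (cConst (q ^ 2) (q ^ (n - 1 - (j : ℕ) + parityShift a j) * γ j) : ℂ)) •
        hermiteGaussian q a := by
  ext E
  have h := coeff_prod_subst_transformSeries (q := q) (fun _ => 1)
    (fun j : Fin n => transformSeries q (a j)) E
  simp only [one_smul, one_mul] at h
  rw [coeff_fourierS h0 h1 a hγ, coeff_smul, hermiteGaussian_eq h0 h1, h, Finset.prod_mul_distrib]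
  ring

end Transform

end BraidedFourier
theorem mainTheorem3 (n : ℕ) (q : ℝ) (hq0 : 0 < q) (hq1 : q < 1) (a : Fin n → ℕ) :
    -- the transform and the integral of the Gaussian are defined
    BraidedFourier.IsClassR (BraidedFourier.gaussianMonomial q a) ∧
    BraidedFourier.IsIntegrable (BraidedFourier.gaussian n q) ∧
    ∀ γ : Fin n → ℝ, (∀ j, γ j ≠ 0) →
      -- the transform realized at `γ`, as a series and in closed form
      BraidedFourier.fourierS (BraidedFourier.gaussianMonomial q a) γ =
        (List.ofFn fun j : Fin n =>
          (BraidedFourier.cConst (q ^ 2)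
              (q ^ (n - 1 - (j : ℕ) + BraidedFourier.parityShift a j) * γ j) : ℂ) •
            BraidedFourier.QSeries.subst (BraidedFourier.transformSeries q (a j))
              (BraidedFourier.QSeries.X j : BraidedFourier.Vec n q)).prod ∧
      BraidedFourier.fourierS (BraidedFourier.gaussianMonomial q a) γ =
        (∏ j : Fin n, (BraidedFourier.cConst (q ^ 2)
            (q ^ (n - 1 - (j : ℕ) + BraidedFourier.parityShift a j) * γ j) : ℂ)) •
          BraidedFourier.hermiteGaussian q a ∧
      -- the transform as a shifted integral of the Gaussian tensored with a series in `∂`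
      Summable (fun p => ‖BraidedFourier.value (BraidedFourier.integralTerm
        (BraidedFourier.parityShift a) p (BraidedFourier.gaussian n q)) γ‖) ∧
      BraidedFourier.fourierS (BraidedFourier.gaussianMonomial q a) γ =
        BraidedFourier.shiftedIntegral (BraidedFourier.parityShift a)
            (BraidedFourier.gaussian n q) γ •
          BraidedFourier.hermiteGaussian q a := by
  refine ⟨BraidedFourier.isClassR_gaussianMonomial hq0 hq1 a,
    BraidedFourier.isIntegrable_gaussian hq0 hq1, fun γ hγ => ?_⟩
  obtain ⟨hs, hi⟩ := BraidedFourier.shiftedIntegral_gaussian hq0 hq1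
    (BraidedFourier.parityShift a) hγ
  have h1 := BraidedFourier.fourierS_gaussianMonomial hq0 hq1 a hγ
  have h2 := BraidedFourier.fourierS_eq_smul_hermiteGaussian hq0 hq1 a hγ
  exact ⟨h1, h2, hs, by rw [hi]; exact h2⟩
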